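/- **Setting.** Let $F/F_\bullet$ be a ramified quadratic extension of non-Archimedean local fields of odd residual characteristic $p$, let $c$ generate $\mathrm{Gal}(F/F_\bullet)$, and let $V$ be a finite-dimensional $F$-vector space with a non-degenerate $(F/F_\bullet,\pm1)$-Hermitian form $h$. For $X\in\mathrm{End}_F(V)$ let $\bar X$ be its adjoint, $h(Xv,w)=h(v,\bar Xw)$, and put ${}^\alpha X=-\bar X$. Let $\mathbf s=[\Lambda,n,0,\beta]$ be a skew simple or null stratum in $\mathrm{End}_F(V)$ (so ${}^\alpha\beta=\beta$, $E=F[\beta]$ is a field, and $\Lambda$ is a self-dual $\mathfrak o_E$-lattice chain) which is strongly ramified, i.e. $[E:F]=\dim_FV$ and $E/E_\bullet$ is quadratic ramified, where $E_\bullet$ is the subfield of $E$ fixed by $X\mapsto\bar X$. Suppose that $E/F$ is tamely ramified and write $f=f(E/F)$. Index $\Lambda$ as a strictly decreasing chain, so that a uniformizer of $E$ maps $\Lambda(m)$ onto $\Lambda(m+1)$, and put $\mathfrak P^k=\{x\in\mathrm{End}_F(V): x\Lambda(m)\subseteq\Lambda(m+k)\ \forall m\}$ for $k\in\mathbb Z$.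 Fix together with $\mathbf s$ a sequence of skew approximating strata in the sense of Bushnell–Kutzko, with fields forming a tower: skew elements $\gamma_0=\beta,\gamma_1,\dots,\gamma_d,\gamma_{d+1}=0$ of $E$ with $E_j=F[\gamma_j]$, $E=E_0\supseteq E_1\supseteq\dots\supseteq E_{d+1}=F$, and integers $0<r_0<\dots<r_d=n$, such that $[\Lambda,n,r_j,\gamma_{j+1}]$ is simple (for $j<d$) and equivalent to $[\Lambda,n,r_j,\gamma_j]$ (for $j\le d$), $-r_j$ is the critical exponent $k_0(\gamma_j,\Lambda)$ for $j<d$, $k_0(\gamma_d,\Lambda)\in\{-n,-\infty\}$, and each derived stratum $[\Lambda,r_j,r_j-1,\gamma_j-\gamma_{j+1}]$ in the centralizer of $E_{j+1}$ is equivalent to a simple stratum. (For the null stratum $\beta=0$, $E=F$, the sequence is empty.) Put $c_j=\gamma_j-\gamma_{j+1}$, let $\mathfrak P^k_{E_j}$ be the centralizer of $\gamma_j$ in $\mathfrak P^k$, and let $$\mathfrak W_z=\bigoplus_{j=0}^d\mathfrak W_{z,j},\qquad \mathfrak W_{z,j}=\mathfrak P_{E_{j+1}}^{\lfloor r_j/2\rfloor}\Big/\Big(\mathfrak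 P_{E_j}^{\lfloor r_j/2\rfloor}+\mathfrak P_{E_{j+1}}^{\lceil r_j/2\rceil}\Big).$$ For a uniformizer $\varpi_E$ of $E$ and an additive character $\psi$ of $F$ of conductor one (trivial on $\mathfrak p_F$ but not on $\mathfrak o_F$) let $$\epsilon_z^P(\varpi_E,\mathbf s,\psi)=(\#\mathfrak W_z)^{-1/2}\sum_{X\in\mathfrak W_z}\ \prod_{j=0}^d\psi\Big(\mathrm{tr}_{\mathrm{End}_F(V)/F}\big(\varpi_E\,(c_jX_{j+1}-X_{j+1}c_j)\,{}^\alpha X_{j+1}\big)\Big),$$ where $X_{j+1}$ is a representative of the component of $X$ in $\mathfrak W_{z,j}$. **Proposition.** (i) For every uniformizer $\varpi_E$ of $E$, the number $\epsilon_z^P(\varpi_E,\mathbf s,\psi)$ is a sign $\pm1$ which does not depend on the additive character $\psi$ of conductor one; it is hence denoted by $\epsilon_z^P(\varpi_E,\mathbf s)$. (ii) Let $\tilde\rho$ be a character of $E^\times$ trivial on $1+\mathfrak p_E$ whose restriction to the group $\boldsymbol\mu_E$ of roots of unity in $E$ of order prime to $p$ is $\left(\frac{\cdot}{\boldsymbol\mu_E}\right)^{f-1}$,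 where $\left(\frac{\cdot}{\boldsymbol\mu_E}\right)$ is the quadratic character of $\boldsymbol\mu_E$, and let $\rho$ be a character of $\{\pm1\}$. Then the relation $$\tilde\rho(\varpi_E)=\epsilon_z^P(\varpi_E,\mathbf s)\,\rho(-1)$$ is independent of the choice of the uniformizer $\varpi_E$: if it holds for one uniformizer of $E$, it holds for every uniformizer of $E$. -/

import Mathlib

open ValuativeRel

noncomputable section

namespace StronglyRamified

/-! ### Local fields -/

section LocalFields

variable (F E : Type*) [Field F] [ValuativeRel F] [Field E] [ValuativeRel E]
  [Algebra F E] [ValuativeExtension F E]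

/-- The inclusion of the ring of integers of `F` into that of an extension `E`. -/
def integerMap : 𝒪[F] →+* 𝒪[E] :=
  ((algebraMap F E).comp (Subring.subtype 𝒪[F])).codRestrict 𝒪[E] fun x => by
    have hx : valuation F (x : F) ≤ 1 := x.2
    have h1 : (x : F) ≤ᵥ 1 := by
      rwa [(valuation F).vle_iff_le, map_one]
    have h2 : algebraMap F E (x : F) ≤ᵥ algebraMap F E 1 :=
      (ValuativeExtension.vle_iff_vle _ _).2 h1
    rw [map_one, (valuation E).vle_iff_le, map_one] at h2
    exact h2

instance integerMap_isLocalHom : IsLocalHom (integerMap F E) where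
  map_nonunit x hx := by
    rw [Valuation.Integers.isUnit_iff_valuation_eq_one (Valuation.integer.integers _)] at hx ⊢
    have hx' : valuation E (algebraMap F E (x : F)) = valuation E 1 := by
      rw [map_one]; exact hx
    have h2 : algebraMap F E 1 ≤ᵥ algebraMap F E (x : F) := by
      rw [map_one, (valuation E).vle_iff_le, hx']
    have h3 := (valuation F).vle_iff_le.1 ((ValuativeExtension.vle_iff_vle _ _).1 h2)
    rw [map_one] at h3
    exact le_antisymm x.2 h3

/-- The ramification index `e(E/F)`: the largest `e` with `𝔭_F 𝔬_E ⊆ 𝔭_E ^ e`. -/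
def ramificationIndex : ℕ :=
  sSup {e : ℕ | Ideal.map (integerMap F E) 𝓂[F] ≤ 𝓂[E] ^ e}

/-- The residue degree `f(E/F) = [k_E : k_F]`. -/
def residueDegree : ℕ :=
  letI : Algebra 𝓀[F] 𝓀[E] := (IsLocalRing.ResidueField.map (integerMap F E)).toAlgebra
  Module.finrank 𝓀[F] 𝓀[E]

variable {F E}

/-- `x` is a uniformizer: a nonzero element of the maximal ideal with maximal absolute value. -/
def IsUniformizer (x : E) : Prop :=
  x ≠ 0 ∧ valuation E x < 1 ∧ ∀ y : E, valuation E y < 1 → valuation E y ≤ valuation E x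

/-- For a subfield `E₀` of `E` (with the restricted valuation), `E/E₀` is quadratic and
ramified: `[E : E₀] = 2`, and the value group of `E₀` is strictly smaller than that of `E`,
i.e. no uniformizer of `E` lies in `E₀`. -/
def IsQuadraticRamified (E₀ : Subfield E) : Prop :=
  Module.finrank E₀ E = 2 ∧ ∀ x ∈ E₀, ¬ IsUniformizer x

/-- An additive character of `F` of conductor one: trivial on `𝔭_F` but not on `𝔬_F`. -/
def HasConductorOne (ψ : AddChar F ℂ) : Prop :=
  (∀ x : F, valuation F x < 1 → ψ x = 1) ∧ ∃ x : F, valuation F x ≤ 1 ∧ ψ x ≠ 1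

variable (E) in
/-- `μ_E`: the roots of unity in `E` of order prime to the residual characteristic. -/
def rootsOfUnityPrimeToP : Set Eˣ :=
  {x | (orderOf x).Coprime (ringChar 𝓀[E])}

open Classical in
/-- The quadratic character of the cyclic group `μ_E` (used at elements of `μ_E` only). -/
def quadraticCharacter (x : Eˣ) : ℂ :=
  if ∃ y ∈ rootsOfUnityPrimeToP E, y ^ 2 = x then 1 else -1

/-- A character of `E^×` is tamely ramified (of level zero) if it is trivial on
`U_E^1 = 1 + 𝔭_E`. -/
def IsTamelyRamified (χ : Eˣ →* ℂˣ) : Prop :=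
  ∀ x : Eˣ, valuation E ((x : E) - 1) < 1 → χ x = 1

end LocalFields

/-! ### Hermitian forms -/

section Hermitian

variable {F V : Type*} [Field F] [AddCommGroup V] [Module F V] {c : F →+* F}

/-- `h` is a non-degenerate `ε`-Hermitian form with respect to the involution `c`. -/
structure IsHermitianForm (h : V →ₛₗ[c] V →ₗ[F] F) (ε : F) : Prop where
  sign : ε = 1 ∨ ε = -1
  symm : ∀ v w, h w v = ε * c (h v w)
  nondegenerate : ∀ v, (∀ w, h v w = 0) → v = 0

/-- The conjugate-adjoint `X ↦ X̄` of a non-degenerate form `h` on a finite-dimensional space: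
the unique `Y` with `h (X v) w = h v (Y w)`. -/
def adjoint (h : V →ₛₗ[c] V →ₗ[F] F) (X : Module.End F V) : Module.End F V :=
  Classical.epsilon fun Y => ∀ v w, h (X v) w = h v (Y w)

/-- The adjoint anti-involution `α`, with `α X = - X̄`. Its fixed points are the Lie algebra of
the unitary group. -/
def alpha (h : V →ₛₗ[c] V →ₗ[F] F) (X : Module.End F V) : Module.End F V :=
  -adjoint h X

end Hermitian

section Strata

variable {F E V : Type*} [Field F] [ValuativeRel F] [Field E] [ValuativeRel E] [Algebra F E]
  [AddCommGroup V] [Module F V] [Module E V] [IsScalarTower F E V] {c : F →+* F}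

variable (F V) in
/-- The embedding `E → End_F(V)` given by the `E`-vector space structure of `V`. -/
def emb (x : E) : Module.End F V := Algebra.lsmul F F V x

variable (E) in
/-- The subfield `E_•` of the elements of `E` which are self-adjoint, i.e. fixed by `- α`. -/
def fixedSubfield (h : V →ₛₗ[c] V →ₗ[F] F) : Subfield E where
  carrier := {x | ∀ v w, h (x • v) w = h v (x • w)}
  mul_mem' {x y} hx hy v w := by rw [mul_smul, hx, hy, ← mul_smul, mul_comm]
  one_mem' v w := by simp
  add_mem' {x y} hx hy v w := by
    rw [add_smul, add_smul, map_add, map_add, LinearMap.add_apply, hx, hy]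
  zero_mem' v w := by simp
  neg_mem' {x} hx v w := by
    rw [neg_smul, neg_smul, map_neg, map_neg, LinearMap.neg_apply, hx]
  inv_mem' x hx v w := by
    by_cases h0 : x = 0
    · simp [h0]
    · have := hx (x⁻¹ • v) (x⁻¹ • w)
      rwa [smul_inv_smul₀ h0, smul_inv_smul₀ h0, eq_comm] at this

/-! ### Lattice chains and filtrations

The filtrations are indexed by the strictly decreasing lattice chain, so that a uniformizer
of `E` shifts the index by one. -/

/-- A strictly decreasing `𝔬_E`-lattice chain of `𝔬_E`-period one in `V` (for `dim_E V = 1`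
every `𝔬_E`-lattice chain is of this form). -/
structure IsLatticeChain (Λ : ℤ → Submodule 𝒪[E] V) : Prop where
  fg : ∀ k, (Λ k).FG
  span_eq_top : ∀ k, Submodule.span E (Λ k : Set V) = ⊤
  period : ∀ k, Λ (k + 1) = 𝓂[E] • Λ k

/-- `Λ` is self-dual: there is `d` such that `{v | h(v, Λ(k)) ⊆ 𝔭_F} = Λ(d - k)` for all `k`. -/
def IsSelfDual (h : V →ₛₗ[c] V →ₗ[F] F) (Λ : ℤ → Submodule 𝒪[E] V) : Prop :=
  ∃ d : ℤ, ∀ k v, v ∈ Λ (d - k) ↔ ∀ w ∈ Λ k, valuation F (h v w) < 1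

variable (F) in
/-- `𝔓_Λ^k = {x ∈ End_F(V) | x Λ(m) ⊆ Λ(m + k) for all m}`. -/
def filtration (Λ : ℤ → Submodule 𝒪[E] V) (k : ℤ) : AddSubgroup (Module.End F V) where
  carrier := {x | ∀ m, ∀ v ∈ Λ m, x v ∈ Λ (m + k)}
  add_mem' hx hy m v hv := (Λ (m + k)).add_mem (hx m v hv) (hy m v hv)
  zero_mem' m _ _ := (Λ (m + k)).zero_mem
  neg_mem' hx m v hv := (Λ (m + k)).neg_mem (hx m v hv)

/-- `𝔓_{Λ, F[γ]}^k`: the elements of `𝔓_Λ^k` which commute with `γ`. -/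
def centralizerFiltration (Λ : ℤ → Submodule 𝒪[E] V) (γ : Module.End F V) (k : ℤ) :
    AddSubgroup (Module.End F V) :=
  filtration F Λ k ⊓ (Subring.centralizer {γ}).toAddSubgroup

/-! ### Simple strata -/

/-- Let `B` be the centralizer of `γ`. This is the set of integers `k` with
`{x ∈ 𝔅 | δ x - x δ ∈ 𝔓_B^k} ⊄ 𝔅_δ + 𝔓_B`, where `𝔅 = 𝔓_B^0` and `𝔅_δ` is the centralizer
of `δ` in `𝔅`. Its maximum is the critical exponent `k₀` of `δ` in `B`
(with `k₀ = - ∞` if the set is empty). -/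
def criticalSet (Λ : ℤ → Submodule 𝒪[E] V) (γ δ : Module.End F V) : Set ℤ :=
  {k | ¬ ∀ x ∈ centralizerFiltration Λ γ 0, δ * x - x * δ ∈ filtration F Λ k →
    x ∈ (centralizerFiltration Λ γ 0 ⊓ (Subring.centralizer {δ}).toAddSubgroup) ⊔
      centralizerFiltration Λ γ 1}

/-- `[Λ, n, r, δ]` is a simple stratum in the centralizer `B` of `γ`, where `F[γ]` is a field:
`F[γ][δ] ⊆ B` is a field whose multiplicative group normalizes the chain `Λ`,
`v_Λ(δ) = - n`, and `0 ≤ r < min(n, - k₀(δ))`. For `γ = 0`, `B = End_F(V)`. -/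
structure IsSimpleStratum (Λ : ℤ → Submodule 𝒪[E] V) (γ : Module.End F V) (n r : ℤ)
    (δ : Module.End F V) : Prop where
  nonneg : 0 ≤ r
  lt : r < n
  commute : Commute γ δ
  isField : IsField (Algebra.adjoin F ({γ, δ} : Set (Module.End F V)))
  normalizes : ∀ y ∈ Algebra.adjoin F ({γ, δ} : Set (Module.End F V)), y ≠ 0 →
    ∃ t : ℤ, ∀ m, y '' (Λ m : Set V) = Λ (m + t)
  mem : δ ∈ filtration F Λ (-n)
  notMem : δ ∉ filtration F Λ (-n + 1)
  critical : ∀ k ∈ criticalSet Λ γ δ, k < -r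

/-- A skew simple or null stratum `𝐬 = [Λ, n, 0, β]` in `End_F(V)` with `E = F[β]`,
together with a sequence of skew approximating strata `[Λ, n, r j, γ (j + 1)]`,
`0 ≤ j < len`, where `γ 0 = β`, `γ len = 0`, such that the fields `E_j = F[γ j]` form a tower
`E = E_0 ⊇ E_1 ⊇ ⋯ ⊇ E_len = F`. The null stratum is the case `len = 0`.
(The values of `γ`, `r` at indices other than `0, …, len`, resp. `0, …, len - 1`,
are not used.) -/
structure SkewStratum (E : Type*) [Field E] [ValuativeRel E] [Algebra F E] [Module E V]
    [IsScalarTower F E V] (h : V →ₛₗ[c] V →ₗ[F] F) where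
  /-- the self-dual lattice chain -/
  Λ : ℤ → Submodule 𝒪[E] V
  isLatticeChain : IsLatticeChain Λ
  isSelfDual : IsSelfDual h Λ
  /-- the negative of the valuation of `β` -/
  n : ℤ
  /-- the element generating `E` -/
  β : E
  adjoin_eq_top : Algebra.adjoin F {β} = ⊤
  /-- the number `d + 1` of critical exponents -/
  len : ℕ
  /-- `[Λ, n, 0, β]` is simple, or it is the null stratum -/
  simple_or_null : IsSimpleStratum Λ 0 n 0 (emb F V β) ∨ (β = 0 ∧ n = 0 ∧ len = 0)
  /-- the approximating elements -/
  γ : ℕ → E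
  /-- the critical exponents (with the last one equal to `n`) -/
  r : ℕ → ℤ
  γ_zero : γ 0 = β
  γ_len : γ len = 0
  skew : ∀ j ≤ len, ∀ v w, h (γ j • v) w = -h v (γ j • w)
  tower : ∀ j < len, γ (j + 1) ∈ Algebra.adjoin F {γ j}
  r_pos : ∀ j < len, 0 < r j
  r_lt : ∀ j, j + 1 < len → r j < r (j + 1)
  r_last : ∀ j, j + 1 = len → r j = n
  /-- `[Λ, n, r j, γ (j + 1)]` is simple (except for the last one, which is null) -/
  simple : ∀ j, j + 1 < len → IsSimpleStratum Λ 0 n (r j) (emb F V (γ (j + 1)))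
  /-- `[Λ, n, r j, γ (j + 1)]` is equivalent to `[Λ, n, r j, γ j]` -/
  equivalent : ∀ j < len, emb F V (γ j - γ (j + 1)) ∈ filtration F Λ (-r j)
  /-- `r j` is the negative of the critical exponent `k₀(γ j)` in `End_F(V)` -/
  critical : ∀ j, j + 1 < len → IsGreatest (criticalSet Λ 0 (emb F V (γ j))) (-r j)
  /-- for the last index, `k₀(γ j)` is `- n` or `- ∞` -/
  critical_last : ∀ j, j + 1 = len → ∀ k ∈ criticalSet Λ 0 (emb F V (γ j)), k ≤ -r j
  /-- The derived stratum `[Λ, r j, r j - 1, γ j - γ (j + 1)]` in the centralizer of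
  `γ (j + 1)` is equivalent to a simple stratum (the element `γ j - γ (j + 1)` already lies in
  that centralizer, on which a tame corestriction is the identity up to a unit). -/
  derived : ∀ j < len, ∃ δ : Module.End F V,
    IsSimpleStratum Λ (emb F V (γ (j + 1))) (r j) (r j - 1) δ ∧
    emb F V (γ j - γ (j + 1)) - δ ∈ filtration F Λ (-(r j - 1))

namespace SkewStratum

variable {h : V →ₛₗ[c] V →ₗ[F] F} (s : SkewStratum E h)

/-- `𝔓_{Λ, E_{j+1}}^{-1 + (r_j/2)₊}`, where `(r_j/2)₊ = ⌊r_j/2⌋ + 1` is the smallest integer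
greater than `r_j/2`. -/
def numerator (j : ℕ) : AddSubgroup (Module.End F V) :=
  centralizerFiltration s.Λ (emb F V (s.γ (j + 1))) (-1 + (s.r j / 2 + 1))

/-- `𝔓_{Λ, E_j}^{-1 + (r_j/2)₊} + 𝔓_{Λ, E_{j+1}}^{⌈r_j/2⌉}`. -/
def denominator (j : ℕ) : AddSubgroup (Module.End F V) :=
  centralizerFiltration s.Λ (emb F V (s.γ j)) (-1 + (s.r j / 2 + 1)) ⊔
    centralizerFiltration s.Λ (emb F V (s.γ (j + 1))) ((s.r j + 1) / 2)

/-- The summand `𝔚_{z,j}`. -/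
abbrev W (j : ℕ) : Type _ :=
  s.numerator j ⧸ (s.denominator j).addSubgroupOf (s.numerator j)

/-- `𝔚_z = ⨁_{j=0}^{d} 𝔚_{z,j}`, as a set. -/
abbrev Wz : Type _ := ∀ j : Fin s.len, s.W j

/-- A representative `X_{j+1}` in `End_F(V)` of an element of `𝔚_{z,j}`. -/
def rep {j : ℕ} (X : s.W j) : Module.End F V := (X.out : s.numerator j)

/-- `tr (ϖ (c_j X - X c_j) (α X))`, where `c_j = γ_j - γ_{j+1}`. -/
def quadraticForm (ϖ : E) (j : ℕ) (X : Module.End F V) : F :=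
  LinearMap.trace F V (emb F V ϖ *
    (emb F V (s.γ j - s.γ (j + 1)) * X - X * emb F V (s.γ j - s.γ (j + 1))) * alpha h X)

/-- The quadratic Gauss sum
`∑_{X ∈ 𝔚_z} ∏_j ψ (tr (ϖ (c_j X_{j+1} - X_{j+1} c_j) (α X_{j+1})))`. -/
def gaussSum (ϖ : E) (ψ : AddChar F ℂ) : ℂ :=
  ∑ᶠ X : s.Wz, ∏ j : Fin s.len, ψ (s.quadraticForm ϖ j (s.rep (X j)))

/-- The normalized Gauss sum `ε_z^P(ϖ, 𝐬, ψ)`: the Gauss sum divided by `(#𝔚_z)^{1/2}`. -/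
def epsilonZ (ϖ : E) (ψ : AddChar F ℂ) : ℂ :=
  s.gaussSum ϖ ψ / (Real.sqrt (Nat.card s.Wz) : ℂ)

end SkewStratum

end Strata

end StronglyRamified

end

/-!
The normalized Gauss sum is the Gauss sum of a non-degenerate quadratic form over the residue
field `k_E`, and everything is read off from the dimension of that form.

Fix `j`, put `c_j = γ_j - γ_{j+1}` and let `B(X, Y) = tr (ϖ (c_j X - X c_j) (α Y))`. Self-duality of
`Λ` makes the conjugation `x ↦ x̄` of `E` preserve the valuation. As no uniformizer of `E` is fixed
by it, it is the identity on `k_E` and `-1` on `𝔭_E / 𝔭_E ^ 2`; hence skew elements have odd order,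
so that `r_j` is odd, and `e = e(E/F)` is odd (`odd_of_isConj_neg`, `odd_ramificationIndex`).
Modulo `𝔭_F` the form `B` is therefore symmetric with `k_E` self-adjoint for left multiplication
(`SkewStratum.pairing_symm`). It is non-degenerate on `𝔚_{z,j}`: the property which defines the
critical exponent (`SkewStratum.mem_sup_of_commutator_mem`) reduces this to the non-degeneracy
modulo `𝔭_F` of the trace form on the centralizer of each `γ_j`. That follows by descending
induction on `j` from the duality of `𝔓^m` and `𝔓^(1-m)` in `End_F(V)`. In the induction step one
averages over conjugation by the powers of `c_j`, some power of `c_j`, with exponent prime to `p`,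
being in `F^× (1 + 𝔭_E)` because `E/F` is tame (`SkewStratum.trace_mem_of_forall_level`).

The orders of the `𝔚_{z,j}` multiply up to the index of `𝔬_E + 𝔓^1` in `𝔓^0`, so that the dimension
of `𝔚_z` over `k_E` is `w = e f - 1` (`SkewStratum.card_Wz`), which has the parity of `f - 1`.
Scaling the form by `u` multiplies the Gauss sum by `χ(u) ^ w`, where `χ` is the quadratic
character of `k_E`, and the square of the Gauss sum is `χ(-1) ^ w` times the order of `𝔚_z`
(`IsSymmetricBicharacter.finsum_smul`, `IsSymmetricBicharacter.finsum_sq`). Changing the additive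
character scales the form by a unit of `F`. If `w` is even then `χ ^ w = 1`; if `w` is odd then `f`
is even, and units of `F` are squares in `k_E`. In both cases the normalized sum is a sign which
does not depend on the additive character (`SkewStratum.exists_sign`). Replacing `ϖ` by `ϖ u`
multiplies the sign by `χ(u) ^ w = χ(u) ^ (f - 1)`, which is also the value at `u` of the tamely
ramified character of the second part, by Teichmüller representatives
(`IsTamelyRamified.apply_unit`).
-/

noncomputable section

namespace StronglyRamified

set_option linter.unusedSectionVars false

/-! ### Gauss sums of quadratic forms over a finite field -/

section QuadraticGaussSum

variable {K : Type*} [Field K] [Fintype K]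

/-- A finite field is its own dual, once a primitive additive character is fixed. -/
lemma exists_eq_mulShift {ψ : AddChar K ℂ} (hψ : ψ.IsPrimitive) (φ : AddChar K ℂ) :
    ∃ a, φ = ψ.mulShift a := by
  classical
  have h := (Fintype.bijective_iff_injective_and_card ψ.mulShift).2
    ⟨AddChar.to_mulShift_inj_of_isPrimitive hψ, (AddChar.card_eq).symm⟩
  obtain ⟨a, ha⟩ := h.2 φ
  exact ⟨a, ha.symm⟩

lemma sum_mul_sq [DecidableEq K] (hK : ringChar K ≠ 2) {ψ : AddChar K ℂ} (hψ : ψ.IsPrimitive)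
    {ζ d : K} (hζ : ζ ≠ 0) (hd : d ≠ 0) :
    ∑ t, ψ (ζ * t ^ 2 * d) = (quadraticChar K ζ : ℂ) * ∑ t, ψ (t ^ 2 * d) := by
  -- The value `x` is taken by `t ^ 2` exactly `χ x + 1` times.
  have hcount (a : K) : ∑ t, ψ (a * t ^ 2) = ∑ x, (quadraticChar K x + 1 : ℂ) * ψ (a * x) := by
    rw [← Finset.sum_fiberwise (s := Finset.univ) (g := fun t : K => t ^ 2)]
    refine Finset.sum_congr rfl fun x _ => ?_
    have hc := quadraticChar_card_sqrts hK x
    rw [Finset.sum_congr rfl (g := fun _ => ψ (a * x)), Finset.sum_const, nsmul_eq_mul]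
    · congr 1
      have : ({t | t ^ 2 = x} : Set K).toFinset = Finset.univ.filter (fun t => t ^ 2 = x) := by
        ext; simp
      rw [this] at hc
      exact_mod_cast hc
    · intro t ht
      simp only [Finset.mem_filter, Finset.mem_univ, true_and] at ht
      simp [ht]
  have hgauss (a : K) (ha : a ≠ 0) :
      ∑ t, ψ (a * t ^ 2) = (quadraticChar K a : ℂ) * ∑ x, (quadraticChar K x : ℂ) * ψ x := by
    have h0 : ∑ x, ψ (a * x) = 0 := by
      have := AddChar.sum_eq_zero_iff_ne_zero (ψ := ψ.mulShift a)
      simpa using this.2 (hψ ha)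
    rw [hcount]
    simp only [add_mul, one_mul, Finset.sum_add_distrib, h0, add_zero]
    rw [Finset.mul_sum, ← Equiv.sum_comp (Equiv.mulLeft₀ a ha) fun x =>
      (quadraticChar K a : ℂ) * ((quadraticChar K x : ℂ) * ψ x)]
    refine Finset.sum_congr rfl fun x _ => ?_
    have hs : (quadraticChar K a : ℂ) * (quadraticChar K a : ℂ) = 1 := by
      have := quadraticChar_sq_one ha
      rw [sq] at this
      exact_mod_cast this
    simp only [Equiv.mulLeft₀_apply, map_mul, Int.cast_mul]
    rw [← mul_assoc, ← mul_assoc, hs, one_mul]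
  have e1 : ∀ t : K, ζ * t ^ 2 * d = (ζ * d) * t ^ 2 := fun t => by ring
  have e2 : ∀ t : K, t ^ 2 * d = d * t ^ 2 := fun t => by ring
  simp only [e1, e2]
  rw [hgauss _ (mul_ne_zero hζ hd), hgauss _ hd, map_mul, Int.cast_mul, mul_assoc]

variable {W : Type*} [AddCommGroup W] [Module K W]

/-- A symmetric bicharacter on a `K`-vector space for which the scalars of `K` are
self-adjoint, and which has no kernel. Its Gauss sum is the sum of the diagonal values `b x x`. -/
structure IsSymmetricBicharacter (K : Type*) [Field K] {W : Type*} [AddCommGroup W] [Module K W]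
    (b : W → W → ℂ) : Prop where
  zero_left : ∀ y, b 0 y = 1
  add_left : ∀ x x' y, b (x + x') y = b x y * b x' y
  symm : ∀ x y, b x y = b y x
  smul_left : ∀ (a : K) x y, b (a • x) y = b x (a • y)
  nondegenerate : ∀ x, (∀ y, b x y = 1) → x = 0

namespace IsSymmetricBicharacter

variable {b : W → W → ℂ}

/-- A bicharacter for which `K` is self-adjoint is a fixed primitive additive character of `K`
applied to a `K`-bilinear form. -/
lemma exists_bilinForm (hb : IsSymmetricBicharacter K b) {ψ : AddChar K ℂ} (hψ : ψ.IsPrimitive) :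
    ∃ β : LinearMap.BilinForm K W, LinearMap.IsSymm β ∧ (∀ x y, b x y = ψ (β x y)) ∧
      ∀ x, (∀ y, β x y = 0) → x = 0 := by
  have key (x y : W) : ∃ a : K, ∀ t : K, b (t • x) y = ψ (a * t) := by
    obtain ⟨a, ha⟩ := exists_eq_mulShift hψ
      (φ := ⟨fun t => b (t • x) y, by simp [hb.zero_left], fun s t => by
        rw [add_smul, hb.add_left]⟩)
    refine ⟨a, fun t => ?_⟩
    have := DFunLike.congr_fun ha t
    simpa using this
  choose β hβ using key
  have uniq {a a' : K} (h : ∀ t, ψ (a * t) = ψ (a' * t)) : a = a' := by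
    refine AddChar.to_mulShift_inj_of_isPrimitive hψ ?_
    ext t
    simpa using h t
  have hsymm (x y : W) : β x y = β y x := uniq fun t => by
    rw [← hβ, ← hβ, hb.smul_left, hb.symm]
  have hadd (x x' y : W) : β (x + x') y = β x y + β x' y := uniq fun t => by
    rw [← hβ, smul_add, hb.add_left, hβ, hβ, add_mul, AddChar.map_add_eq_mul]
  have hsmul (a : K) (x y : W) : β (a • x) y = a * β x y := uniq fun t => by
    rw [← hβ, smul_smul, hβ]
    congr 1
    ring
  refine ⟨LinearMap.mk₂ K β hadd (fun a x y => hsmul a x y) (fun x y y' => ?_)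
    (fun a x y => ?_), ⟨fun x y => hsymm x y⟩, fun x y => ?_, fun x hx => ?_⟩
  · rw [hsymm, hadd, hsymm y, hsymm y']
  · rw [hsymm, hsmul, hsymm y]; rfl
  · simpa using hβ x y 1
  · refine hb.nondegenerate x fun y => ?_
    have h1 := hβ x y 1
    have h2 : β x y = 0 := hx y
    rw [h2] at h1
    simpa using h1

/-- Scaling a nondegenerate quadratic form by `ζ` multiplies its Gauss sum by the quadratic
character of `ζ`, to the power of the dimension. -/
theorem finsum_smul [DecidableEq K] [Finite W] (hb : IsSymmetricBicharacter K b)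
    (hK : ringChar K ≠ 2) {ζ : K} (hζ : ζ ≠ 0) :
    ∑ᶠ x, b (ζ • x) x =
      (quadraticChar K ζ : ℂ) ^ Module.finrank K W * ∑ᶠ x, b x x := by
  have : Fintype W := Fintype.ofFinite W
  rw [finsum_eq_sum_of_fintype, finsum_eq_sum_of_fintype]
  obtain ⟨ψ, hψ⟩ : ∃ ψ : AddChar K ℂ, ψ.IsPrimitive :=
    ⟨_, AddChar.FiniteField.primitiveChar_to_Complex_isPrimitive K⟩
  obtain ⟨β, hsymm, hβ, hnd⟩ := hb.exists_bilinForm hψ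
  have h2 : (2 : K) ≠ 0 := Ring.two_ne_zero hK
  have : Invertible (2 : K) := invertibleOfNonzero h2
  obtain ⟨v, hv⟩ := LinearMap.BilinForm.exists_orthogonal_basis hsymm
  have hd (i) : β (v i) (v i) ≠ 0 := by
    intro h0
    refine v.ne_zero i (hnd _ fun y => ?_)
    rw [← v.sum_repr y, map_sum]
    refine Finset.sum_eq_zero fun k _ => ?_
    rw [map_smul]
    by_cases hk : i = k
    · subst hk; simp [h0]
    · have : β (v i) (v k) = 0 := hv hk
      simp [this]
  -- In an orthogonal basis the sum is a product of one-dimensional Gauss sums.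
  have hS (a : K) : ∑ x, b (a • x) x =
      ∏ i : Fin (Module.finrank K W), ∑ t, ψ (a * t ^ 2 * β (v i) (v i)) := by
    rw [Finset.prod_univ_sum, Fintype.piFinset_univ, ← Equiv.sum_comp v.equivFun.symm.toEquiv]
    refine Finset.sum_congr rfl fun t _ => ?_
    rw [hβ, show v.equivFun.symm.toEquiv t = ∑ i, t i • v i from v.equivFun_symm_apply t]
    have : β (a • ∑ i, t i • v i) (∑ i, t i • v i) = ∑ i, a * t i ^ 2 * β (v i) (v i) := by
      simp only [map_smul, map_sum, LinearMap.smul_apply, LinearMap.sum_apply, smul_eq_mul,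
        Finset.mul_sum]
      refine Finset.sum_congr rfl fun i _ => ?_
      rw [Finset.sum_eq_single i]
      · ring
      · intro k _ hk
        have : β (v k) (v i) = 0 := hv hk
        simp [this]
      · simp
    rw [this]
    have hm := map_sum ψ.toAddMonoidHom (fun i => a * t i ^ 2 * β (v i) (v i)) Finset.univ
    exact congrArg Additive.toMul hm
  have h1 : ∑ x, b x x = ∏ i, ∑ t, ψ (t ^ 2 * β (v i) (v i)) := by
    simpa using hS 1
  rw [hS, h1, Finset.prod_congr rfl fun i _ => sum_mul_sq hK hψ hζ (hd i), Finset.prod_mul_distrib]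
  simp

/-- The square of the Gauss sum `S(1)` of a nondegenerate quadratic form: by orthogonality of
characters `S(1) S(-1) = # W`, and `S(-1)` is a multiple of `S(1)` by scaling. -/
theorem finsum_sq [DecidableEq K] [Finite W] (hb : IsSymmetricBicharacter K b)
    (hK : ringChar K ≠ 2) :
    (∑ᶠ x, b x x) ^ 2 = (quadraticChar K (-1) : ℂ) ^ Module.finrank K W * Nat.card W := by
  have hne : (-1 : K) ≠ 0 := by simp
  have hscale := hb.finsum_smul hK hne
  have : Fintype W := Fintype.ofFinite W
  classical
  simp only [finsum_eq_sum_of_fintype] at hscale ⊢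
  have h2 : (2 : K) ≠ 0 := Ring.two_ne_zero hK
  have hr (x y y' : W) : b x (y + y') = b x y * b x y' := by
    rw [hb.symm, hb.add_left, hb.symm y, hb.symm y']
  have hinv (x y : W) : b x y * b (-x) y = 1 := by
    rw [← hb.add_left, add_neg_cancel, hb.zero_left]
  -- `S(1) S(-1) = # W`: substitute `x = y + z`, then sum over `y` first.
  have hprod : (∑ x, b x x) * ∑ y, b ((-1 : K) • y) y = Nat.card W := by
    rw [Finset.sum_mul_sum, Finset.sum_comm]
    have : ∀ y, ∑ x, b x x * b ((-1 : K) • y) y = ∑ z, b z z * b ((2 : K) • z) y := by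
      intro y
      rw [← Equiv.sum_comp (Equiv.addRight y)]
      refine Finset.sum_congr rfl fun z _ => ?_
      have e : b ((2 : K) • z) y = b z y * b z y := by
        rw [two_smul, hb.add_left]
      simp only [Equiv.coe_addRight, neg_smul, one_smul]
      rw [hb.add_left, hr, hr, e, hb.symm y z]
      linear_combination (b z z * b z y * b z y) * hinv y y
    rw [Finset.sum_congr rfl fun y _ => this y, Finset.sum_comm]
    rw [Finset.sum_eq_single 0]
    · simp [hb.zero_left]
    · intro z _ hz
      rw [← Finset.mul_sum]
      let φ : AddChar W ℂ := ⟨fun y => b ((2 : K) • z) y, by rw [hb.symm, hb.zero_left],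
        fun y y' => hr _ y y'⟩
      have hφ : φ ≠ 0 := by
        intro h0
        refine (smul_ne_zero h2 hz) (hb.nondegenerate _ fun y => ?_)
        exact DFunLike.congr_fun h0 y
      have : ∑ y, b ((2 : K) • z) y = 0 := (AddChar.sum_eq_zero_iff_ne_zero (ψ := φ)).2 hφ
      rw [this, mul_zero]
    · simp
  have hs : (quadraticChar K (-1) : ℂ) * (quadraticChar K (-1) : ℂ) = 1 := by
    have := quadraticChar_sq_one hne
    rw [sq] at this
    exact_mod_cast this
  have hs' : (quadraticChar K (-1) : ℂ) ^ Module.finrank K W *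
      (quadraticChar K (-1) : ℂ) ^ Module.finrank K W = 1 := by
    rw [← mul_pow, hs, one_pow]
  rw [hscale] at hprod
  rw [← hprod]
  linear_combination (-(∑ x, b x x) ^ 2) * hs'

end IsSymmetricBicharacter

end QuadraticGaussSum

/-! ### Orders and residue classes in a local field -/

section NormalizedValuation

open WithZero

variable (E : Type*) [Field E] [ValuativeRel E] [TopologicalSpace E]
  [IsNonarchimedeanLocalField E]

/-- The normalized valuation of a local field, written multiplicatively: an element of the
`k`-th but not the `(k+1)`-st power of the maximal ideal has value `exp (-k)`. -/
def normVal : Valuation E (WithZero (Multiplicative ℤ)) :=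
  (valuation E).map
    { toFun := IsNonarchimedeanLocalField.valueGroupWithZeroIsoInt E
      map_zero' := map_zero (IsNonarchimedeanLocalField.valueGroupWithZeroIsoInt E).toMulEquiv
      map_one' := map_one (IsNonarchimedeanLocalField.valueGroupWithZeroIsoInt E).toMulEquiv
      map_mul' := map_mul (IsNonarchimedeanLocalField.valueGroupWithZeroIsoInt E).toMulEquiv }
    (IsNonarchimedeanLocalField.valueGroupWithZeroIsoInt E).strictMono.monotone

/-- `x` has normalized order `k`; zero has no order. -/
def HasOrd {E : Type*} [Field E] [ValuativeRel E] [TopologicalSpace E]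
    [IsNonarchimedeanLocalField E] (x : E) (k : ℤ) : Prop :=
  normVal E x = exp (-k)

/-- The fractional ideal `𝔭_E ^ k`, for an arbitrary integer `k`. -/
def primePow (k : ℤ) : AddSubgroup E where
  carrier := {x | normVal E x ≤ exp (-k)}
  zero_mem' := by simp
  add_mem' hx hy := by
    rw [Set.mem_ofPred_eq] at *
    exact Valuation.map_add_le _ hx hy
  neg_mem' {x} hx := by
    rw [Set.mem_ofPred_eq] at *
    rwa [Valuation.map_neg]

variable {E}

lemma normVal_le_iff {x y : E} : normVal E x ≤ normVal E y ↔ valuation E x ≤ valuation E y :=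
  (IsNonarchimedeanLocalField.valueGroupWithZeroIsoInt E).strictMono.le_iff_le

lemma normVal_lt_one {x : E} : normVal E x < 1 ↔ valuation E x < 1 := by
  rw [← map_one (normVal E), ← map_one (valuation E)]
  exact (IsNonarchimedeanLocalField.valueGroupWithZeroIsoInt E).strictMono.lt_iff_lt

lemma normVal_le_one {x : E} : normVal E x ≤ 1 ↔ valuation E x ≤ 1 := by
  simpa using normVal_le_iff (x := x) (y := 1)

lemma exists_hasOrd (k : ℤ) : ∃ x : E, HasOrd x k := by
  obtain ⟨b, hb⟩ := (IsNonarchimedeanLocalField.valueGroupWithZeroIsoInt E).surjective (exp (-k))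
  obtain ⟨x, rfl⟩ := valuation_surjective b
  exact ⟨x, hb⟩

lemma HasOrd.ne_zero {x : E} {k : ℤ} (h : HasOrd x k) : x ≠ 0 := by
  rintro rfl
  rw [HasOrd, map_zero] at h
  exact exp_ne_zero h.symm

lemma exists_hasOrd_of_ne_zero {x : E} (hx : x ≠ 0) : ∃ k : ℤ, HasOrd x k := by
  have : normVal E x ≠ 0 := (Valuation.ne_zero_iff _).2 hx
  exact ⟨-log (normVal E x), by rw [HasOrd, neg_neg, exp_log this]⟩

lemma HasOrd.unique {x : E} {k l : ℤ} (h : HasOrd x k) (h' : HasOrd x l) : k = l := by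
  rw [HasOrd, h] at h'
  simpa using exp_injective h'

lemma mem_primePow {x : E} {k : ℤ} : x ∈ primePow E k ↔ normVal E x ≤ exp (-k) := by
  exact Set.mem_ofPred_eq.to_iff

lemma lt_exp_iff_le {a : WithZero (Multiplicative ℤ)} {k : ℤ} : a < exp k ↔ a ≤ exp (k - 1) := by
  by_cases h : a = 0
  · simp [h]
  · rw [← log_lt_iff_lt_exp h, ← log_le_iff_le_exp h]
    omega

lemma mem_primePow_zero {x : E} : x ∈ primePow E 0 ↔ valuation E x ≤ 1 := by
  rw [mem_primePow, ← normVal_le_one]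
  simp

lemma mem_primePow_one {x : E} : x ∈ primePow E 1 ↔ valuation E x < 1 := by
  rw [mem_primePow, ← normVal_lt_one, ← exp_zero, lt_exp_iff_le, zero_sub]

lemma primePow_antitone {k l : ℤ} (h : k ≤ l) : primePow E l ≤ primePow E k := fun x hx => by
  rw [mem_primePow] at hx ⊢
  exact hx.trans (exp_le_exp.2 (neg_le_neg h))

lemma mul_mem_primePow {x y : E} {k l : ℤ} (hx : x ∈ primePow E k) (hy : y ∈ primePow E l) :
    x * y ∈ primePow E (k + l) := by
  rw [mem_primePow] at *
  rw [map_mul, neg_add, exp_add]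
  exact mul_le_mul' hx hy

lemma HasOrd.mem {x : E} {k : ℤ} (h : HasOrd x k) : x ∈ primePow E k :=
  mem_primePow.2 (le_of_eq h)

lemma hasOrd_iff {x : E} {k : ℤ} :
    HasOrd x k ↔ x ∈ primePow E k ∧ x ∉ primePow E (k + 1) := by
  rw [HasOrd, mem_primePow, mem_primePow, neg_add, ← sub_eq_add_neg, ← lt_exp_iff_le, not_lt]
  exact ⟨fun h => ⟨h.le, h.ge⟩, fun h => le_antisymm h.1 h.2⟩

lemma HasOrd.inv {x : E} {k : ℤ} (h : HasOrd x k) : HasOrd x⁻¹ (-k) := by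
  rw [HasOrd, map_inv₀, h, ← exp_neg]

lemma HasOrd.mul {x y : E} {k l : ℤ} (hx : HasOrd x k) (hy : HasOrd y l) :
    HasOrd (x * y) (k + l) := by
  rw [HasOrd, map_mul, hx, hy, ← exp_add, neg_add]

lemma HasOrd.neg {x : E} {k : ℤ} (hx : HasOrd x k) : HasOrd (-x) k := by
  rw [HasOrd, Valuation.map_neg, hx]

lemma HasOrd.zpow {x : E} {k : ℤ} (h : HasOrd x k) (m : ℤ) : HasOrd (x ^ m) (m * k) := by
  rw [HasOrd, map_zpow₀, h, ← exp_zsmul]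
  simp

lemma HasOrd.pow {x : E} {k : ℤ} (h : HasOrd x k) (m : ℕ) : HasOrd (x ^ m) (m * k) := by
  rw [← zpow_natCast]
  exact h.zpow m

lemma hasOrd_one : HasOrd (1 : E) 0 := by simp [HasOrd]

lemma HasOrd.mul_mem_iff {x y : E} {k l : ℤ} (hx : HasOrd x k) :
    x * y ∈ primePow E (k + l) ↔ y ∈ primePow E l := by
  refine ⟨fun h => ?_, fun h => mul_mem_primePow hx.mem h⟩
  have := mul_mem_primePow hx.inv.mem h
  rwa [inv_mul_cancel_left₀ hx.ne_zero, neg_add_cancel_left] at this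

lemma HasOrd.of_sub_mem {x y : E} {k : ℤ} (hx : HasOrd x k)
    (h : y - x ∈ primePow E (k + 1)) : HasOrd y k := by
  rw [hasOrd_iff] at hx ⊢
  have h' := primePow_antitone (by omega : k ≤ k + 1) h
  refine ⟨by simpa using add_mem h' hx.1, fun hy => hx.2 ?_⟩
  simpa using sub_mem hy h

lemma isUniformizer_iff {x : E} : IsUniformizer x ↔ HasOrd x 1 := by
  obtain ⟨ϖ, hϖ⟩ := exists_hasOrd (E := E) 1
  constructor
  · rintro ⟨-, h1, h2⟩
    refine le_antisymm (mem_primePow.1 (mem_primePow_one.2 h1)) ?_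
    have hϖ' := hϖ
    rw [HasOrd] at hϖ'
    rw [← hϖ', normVal_le_iff]
    exact h2 ϖ (mem_primePow_one.1 hϖ.mem)
  · intro h
    refine ⟨h.ne_zero, mem_primePow_one.1 h.mem, fun y hy => ?_⟩
    rw [HasOrd] at h
    rw [← normVal_le_iff, h]
    exact mem_primePow.1 (mem_primePow_one.2 hy)

lemma mem_maximalIdeal_iff {x : 𝒪[E]} : x ∈ 𝓂[E] ↔ (x : E) ∈ primePow E 1 := by
  rw [IsLocalRing.mem_maximalIdeal, mem_nonunits_iff,
    Valuation.Integer.not_isUnit_iff_valuation_lt_one, mem_primePow_one]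

/-- The residue class in `k_E` of an integral element of `E` (zero on the other elements). -/
def res (x : E) : 𝓀[E] :=
  open Classical in
  if h : valuation E x ≤ 1 then IsLocalRing.residue 𝒪[E] ⟨x, h⟩ else 0

lemma res_coe (x : 𝒪[E]) : res (x : E) = IsLocalRing.residue 𝒪[E] x := dif_pos x.2

lemma res_eq_res_iff {x y : E} (hx : x ∈ primePow E 0) (hy : y ∈ primePow E 0) :
    res x = res y ↔ x - y ∈ primePow E 1 := by
  lift x to 𝒪[E] using mem_primePow_zero.1 hx
  lift y to 𝒪[E] using mem_primePow_zero.1 hy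
  rw [res_coe, res_coe, ← sub_eq_zero, ← map_sub, IsLocalRing.residue_eq_zero_iff,
    mem_maximalIdeal_iff]
  rfl

lemma res_mul {x y : E} (hx : x ∈ primePow E 0) (hy : y ∈ primePow E 0) :
    res (x * y) = res x * res y := by
  lift x to 𝒪[E] using mem_primePow_zero.1 hx
  lift y to 𝒪[E] using mem_primePow_zero.1 hy
  rw [res_coe, res_coe, ← map_mul, ← res_coe]
  rfl

lemma res_one : res (1 : E) = 1 := by
  rw [← map_one (IsLocalRing.residue 𝒪[E]), ← res_coe]; rfl

lemma res_ne_zero_iff {x : E} (hx : x ∈ primePow E 0) : res x ≠ 0 ↔ HasOrd x 0 := by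
  have h0 : res (0 : E) = 0 := by
    rw [← map_zero (IsLocalRing.residue 𝒪[E]), ← res_coe]; rfl
  rw [hasOrd_iff, ← h0, Ne, res_eq_res_iff hx (zero_mem _)]
  simp [hx]

lemma exists_res_eq (a : 𝓀[E]) : ∃ x ∈ primePow E 0, res x = a := by
  obtain ⟨y, rfl⟩ := IsLocalRing.residue_surjective a
  exact ⟨y, mem_primePow_zero.2 y.2, res_coe y⟩

lemma mem_maximalIdeal_pow_iff {x : 𝒪[E]} (t : ℕ) :
    x ∈ 𝓂[E] ^ t ↔ (x : E) ∈ primePow E t := by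
  obtain ⟨ϖ, hϖ⟩ := exists_hasOrd (E := E) 1
  lift ϖ to 𝒪[E] using mem_primePow_zero.1 (primePow_antitone zero_le_one hϖ.mem)
  have hdvd (m : ℕ) (y : 𝒪[E]) : ϖ ^ m ∣ y ↔ (y : E) ∈ primePow E m := by
    have h1 : HasOrd ((ϖ : E) ^ m) m := by simpa using hϖ.pow m
    rw [HasOrd] at h1
    rw [(Valuation.integer.integers (valuation E)).dvd_iff_le, mem_primePow, ← h1, normVal_le_iff]
    rfl
  have hspan : 𝓂[E] = Ideal.span {ϖ} := by
    ext y
    rw [Ideal.mem_span_singleton, mem_maximalIdeal_iff]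
    simpa using (hdvd 1 y).symm
  rw [hspan, Ideal.span_singleton_pow, Ideal.mem_span_singleton, hdvd]

/-- Teichmüller representatives: by Hensel's lemma for `X ^ (q - 1) - 1`. -/
lemma exists_rootsOfUnity {x : E} (hx : HasOrd x 0) :
    ∃ ζ : Eˣ, ζ ∈ rootsOfUnityPrimeToP E ∧ (ζ : E) - x ∈ primePow E 1 := by
  have : Fintype 𝓀[E] := Fintype.ofFinite _
  have hq : 1 < Fintype.card 𝓀[E] := Fintype.one_lt_card
  set q := Fintype.card 𝓀[E] with hqdef
  let _ := IsTopologicalAddGroup.rightUniformSpace E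
  have := isUniformAddGroup_of_addCommGroup (G := E)
  have hchar : ((q : ℕ) : 𝓀[E]) = 0 := Nat.cast_card_eq_zero _
  lift x to 𝒪[E] using mem_primePow_zero.1 hx.mem
  have hres : IsLocalRing.residue 𝒪[E] x ≠ 0 := by
    rw [← res_coe]; exact (res_ne_zero_iff hx.mem).2 hx
  have hpow (y : 𝒪[E]) (hy : IsLocalRing.residue 𝒪[E] y ≠ 0) :
      IsLocalRing.residue 𝒪[E] y ^ (q - 1) = 1 := FiniteField.pow_card_sub_one_eq_one _ hy
  obtain ⟨ζ, hζ, hζx⟩ := HenselianRing.is_henselian (I := 𝓂[E])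
    (Polynomial.X ^ (q - 1) - 1 : Polynomial 𝒪[E])
    (by simpa using Polynomial.monic_X_pow_sub_C (1 : 𝒪[E]) (by omega : q - 1 ≠ 0)) x
    (by
      rw [← IsLocalRing.residue_eq_zero_iff]
      simp [hpow x hres])
    (by
      change IsUnit (IsLocalRing.residue 𝒪[E] _)
      rw [isUnit_iff_ne_zero]
      have : ((q - 1 : ℕ) : 𝓀[E]) = -1 := by
        rw [Nat.cast_sub hq.le, hchar]; simp
      simp only [Polynomial.derivative_sub, Polynomial.derivative_X_pow, Polynomial.derivative_one,
        sub_zero, Polynomial.eval_mul, Polynomial.eval_pow, Polynomial.eval_X, map_mul, map_pow]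
      refine mul_ne_zero ?_ (pow_ne_zero _ hres)
      simp [this])
  have hroot : ζ ^ (q - 1) = 1 := by
    have h : Polynomial.eval ζ (Polynomial.X ^ (q - 1) - 1 : Polynomial 𝒪[E]) = 0 := hζ
    simp only [Polynomial.eval_sub, Polynomial.eval_pow, Polynomial.eval_X,
      Polynomial.eval_one] at h
    exact sub_eq_zero.1 h
  have hrootE : (ζ : E) ^ (q - 1) = 1 := by
    have := congrArg (Subtype.val) hroot
    simpa using this
  have hζ0 : (ζ : E) ≠ 0 := by
    intro h0
    rw [h0, zero_pow (by omega)] at hrootE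
    exact zero_ne_one hrootE
  refine ⟨Units.mk0 ζ hζ0, ?_, ?_⟩
  · have hdvd : orderOf (Units.mk0 (ζ : E) hζ0) ∣ q - 1 := by
      refine orderOf_dvd_of_pow_eq_one (Units.ext ?_)
      simpa using hrootE
    refine Nat.Coprime.coprime_dvd_left hdvd ?_
    have hp : ringChar 𝓀[E] ∣ q := (ringChar.spec _ _).1 hchar
    have : Nat.Coprime (q - 1) q := by
      have := Nat.coprime_self_add_right (m := q - 1) (n := 1)
      rw [Nat.sub_add_cancel hq.le] at this
      exact this.2 (Nat.coprime_one_right _)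
    exact Nat.Coprime.coprime_dvd_right hp this
  · simpa using mem_maximalIdeal_iff.1 hζx

lemma hasOrd_zero_of_pow_eq_one {x : E} {N : ℕ} (hN : N ≠ 0) (h : x ^ N = 1) :
    HasOrd x 0 := by
  have hx : x ≠ 0 := by
    rintro rfl
    rw [zero_pow hN] at h
    exact zero_ne_one h
  obtain ⟨k, hk⟩ := exists_hasOrd_of_ne_zero hx
  have h1 := hk.pow N
  rw [h] at h1
  have := hasOrd_one.unique h1
  have hk0 : k = 0 := by
    rcases mul_eq_zero.1 this.symm with h | h
    · exact absurd (by exact_mod_cast h) hN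
    · exact h
  rwa [hk0] at hk

lemma hasOrd_rootsOfUnity {ζ : Eˣ} (hζ : ζ ∈ rootsOfUnityPrimeToP E) :
    HasOrd (ζ : E) 0 := by
  refine hasOrd_zero_of_pow_eq_one (N := orderOf ζ) (fun h => ?_) ?_
  · have hc : (orderOf ζ).Coprime (ringChar 𝓀[E]) := hζ
    rw [h, Nat.coprime_zero_left] at hc
    exact CharP.ringChar_ne_one hc
  · rw [← Units.val_pow_eq_pow_val, pow_orderOf_eq_one, Units.val_one]

/-- A root of unity of order prime to `p` which is a principal unit is trivial. -/
lemma rootsOfUnity_eq_one {ζ : Eˣ} (hζ : ζ ∈ rootsOfUnityPrimeToP E)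
    (h1 : (ζ : E) - 1 ∈ primePow E 1) : ζ = 1 := by
  have hv := hasOrd_rootsOfUnity hζ
  have hc : (orderOf ζ).Coprime (ringChar 𝓀[E]) := hζ
  have hN : ((orderOf ζ : ℕ) : 𝓀[E]) ≠ 0 := fun h => by
    have hd := (ringChar.spec 𝓀[E] _).1 h
    exact CharP.ringChar_ne_one (R := 𝓀[E]) (Nat.Coprime.eq_one_of_dvd hc.symm hd)
  set N := orderOf ζ
  have hpow : (ζ : E) ^ N = 1 := by
    rw [← Units.val_pow_eq_pow_val, pow_orderOf_eq_one, Units.val_one]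
  obtain ⟨z, hz⟩ : ∃ z : 𝒪[E], (z : E) = ζ := ⟨⟨ζ, mem_primePow_zero.1 hv.mem⟩, rfl⟩
  have hzr : IsLocalRing.residue 𝒪[E] z = 1 := by
    rw [← res_coe, hz, ← res_one, res_eq_res_iff hv.mem (mem_primePow_zero.2 (by simp))]
    exact h1
  have hgeom : (z - 1) * ∑ i ∈ Finset.range N, z ^ i = 0 := by
    rw [mul_geom_sum]
    apply Subtype.ext
    simp [hz, hpow]
  have hsum : ∑ i ∈ Finset.range N, z ^ i ≠ 0 := by
    intro h
    have := congrArg (IsLocalRing.residue 𝒪[E]) h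
    simp [hzr] at this
    exact hN this
  have : z = 1 := sub_eq_zero.1 ((mul_eq_zero.1 hgeom).resolve_right hsum)
  ext
  rw [← hz, this]
  rfl

omit [TopologicalSpace E] [IsNonarchimedeanLocalField E] in
lemma mul_mem_rootsOfUnity {ζ ξ : Eˣ} (hζ : ζ ∈ rootsOfUnityPrimeToP E)
    (hξ : ξ ∈ rootsOfUnityPrimeToP E) : ζ * ξ ∈ rootsOfUnityPrimeToP E := by
  have : orderOf (ζ * ξ) ∣ orderOf ζ * orderOf ξ :=
    (Commute.all ζ ξ).orderOf_mul_dvd_mul_orderOf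
  exact Nat.Coprime.coprime_dvd_left this (Nat.Coprime.mul_left hζ hξ)

omit [TopologicalSpace E] [IsNonarchimedeanLocalField E] in
lemma inv_mem_rootsOfUnity {ζ : Eˣ} (hζ : ζ ∈ rootsOfUnityPrimeToP E) :
    ζ⁻¹ ∈ rootsOfUnityPrimeToP E := by
  change (orderOf ζ⁻¹).Coprime _
  rw [orderOf_inv]
  exact hζ

/-- On roots of unity of order prime to `p`, reduction is injective and has square roots in `μ_E`
for all squares of `k_E`, so that the quadratic characters of `μ_E` and of `k_E` correspond. -/
lemma quadraticCharacter_eq [Fintype 𝓀[E]] [DecidableEq 𝓀[E]] {ζ : Eˣ}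
    (hζ : ζ ∈ rootsOfUnityPrimeToP E) :
    quadraticCharacter ζ = (quadraticChar 𝓀[E] (res (ζ : E)) : ℂ) := by
  have hv := hasOrd_rootsOfUnity hζ
  have hne := (res_ne_zero_iff hv.mem).2 hv
  have hiff : (∃ y ∈ rootsOfUnityPrimeToP E, y ^ 2 = ζ) ↔ IsSquare (res (ζ : E)) := by
    constructor
    · rintro ⟨y, hy, rfl⟩
      have := (hasOrd_rootsOfUnity hy).mem
      refine ⟨res (y : E), ?_⟩
      rw [← res_mul this this, Units.val_pow_eq_pow_val, sq]
    · rintro ⟨a, ha⟩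
      obtain ⟨x, hx, rfl⟩ := exists_res_eq a
      have hx' : HasOrd x 0 := (res_ne_zero_iff hx).1 fun h0 => hne (by simp [ha, h0])
      obtain ⟨y, hy, hyx⟩ := exists_rootsOfUnity hx'
      have hyv := hasOrd_rootsOfUnity hy
      refine ⟨y, hy, ?_⟩
      have hm := mul_mem_rootsOfUnity (mul_mem_rootsOfUnity hy hy) (inv_mem_rootsOfUnity hζ)
      have := rootsOfUnity_eq_one hm ?_
      · rwa [mul_inv_eq_one, ← sq] at this
      · have e : ((y * y * ζ⁻¹ : Eˣ) : E) - 1 = ((ζ⁻¹ : Eˣ) : E) * ((y : E) * y - ζ) := by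
          simp only [Units.val_mul, mul_sub, Units.inv_mul]
          ring
        have hz := mul_mem_primePow (k := 0) (l := 1)
          (hasOrd_rootsOfUnity (inv_mem_rootsOfUnity hζ)).mem
          (y := (y : E) * y - ζ) ((res_eq_res_iff (by simpa using mul_mem_primePow hyv.mem hyv.mem)
            hv.mem).1 ?_)
        · rw [e]; simpa using hz
        · rw [res_mul hyv.mem hyv.mem, ha, (res_eq_res_iff hyv.mem hx).2 hyx]
  unfold quadraticCharacter
  by_cases hs : IsSquare (res (ζ : E))
  · rw [if_pos (hiff.2 hs), (quadraticChar_one_iff_isSquare hne).2 hs, Int.cast_one]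
  · rw [if_neg (fun h => hs (hiff.1 h)), quadraticChar_neg_one_iff_not_isSquare.2 hs]
    simp

end NormalizedValuation

/-! ### Extensions of local fields -/

section Extension

variable {F E : Type*} [Field F] [ValuativeRel F] [TopologicalSpace F]
  [IsNonarchimedeanLocalField F] [Field E] [ValuativeRel E] [TopologicalSpace E]
  [IsNonarchimedeanLocalField E] [Algebra F E] [ValuativeExtension F E]

lemma algebraMap_mem_primePow_zero {x : F} :
    algebraMap F E x ∈ primePow E 0 ↔ x ∈ primePow F 0 := by
  rw [mem_primePow_zero, mem_primePow_zero, ← (valuation E).vle_one_iff,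
    ← (valuation F).vle_one_iff, ← ValuativeExtension.vle_iff_vle (A := F) (B := E), map_one]

lemma algebraMap_mem_primePow_one {x : F} :
    algebraMap F E x ∈ primePow E 1 ↔ x ∈ primePow F 1 := by
  rw [mem_primePow_one, mem_primePow_one, ← (valuation E).vlt_one_iff,
    ← (valuation F).vlt_one_iff, ← ValuativeExtension.vlt_iff_vlt (A := F) (B := E), map_one]

omit [TopologicalSpace F] [IsNonarchimedeanLocalField F] [TopologicalSpace E]
  [IsNonarchimedeanLocalField E] in
lemma coe_integerMap (x : 𝒪[F]) : (integerMap F E x : E) = algebraMap F E x := rfl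

/-- The supremum which defines the ramification index is attained at the order in `E` of a
uniformizer of `F`, and gives the order in `E` of every element of `F`. -/
lemma exists_hasOrd_algebraMap :
    0 < ramificationIndex F E ∧ ∀ {x : F} {k : ℤ}, HasOrd x k →
      HasOrd (algebraMap F E x) (ramificationIndex F E * k) := by
  obtain ⟨ϖ, hϖ⟩ := exists_hasOrd (E := F) 1
  have h0 : algebraMap F E ϖ ≠ 0 := by
    rw [Ne, map_eq_zero]; exact hϖ.ne_zero
  obtain ⟨e', he'⟩ := exists_hasOrd_of_ne_zero h0
  have hpos : 0 < e' := by
    by_contra hneg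
    have h1 : algebraMap F E ϖ ∈ primePow E 1 := algebraMap_mem_primePow_one.2 hϖ.mem
    exact (hasOrd_iff.1 he').2 (primePow_antitone (by omega) h1)
  obtain ⟨e, rfl⟩ := Int.eq_ofNat_of_zero_le hpos.le
  have hunit {u : F} (hu : HasOrd u 0) : HasOrd (algebraMap F E u) 0 := by
    rw [hasOrd_iff, zero_add, algebraMap_mem_primePow_one, algebraMap_mem_primePow_zero]
    simpa using hasOrd_iff.1 hu
  have hord {x : F} {k : ℤ} (hx : HasOrd x k) : HasOrd (algebraMap F E x) (e * k) := by
    have h1 := hx.mul (hϖ.zpow (-k))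
    have h2 := hunit (u := x * ϖ ^ (-k)) (by simpa using h1)
    have h3 := h2.mul (he'.zpow k)
    rw [map_mul, map_zpow₀, mul_assoc, ← zpow_add₀ h0, neg_add_cancel, zpow_zero, mul_one] at h3
    convert h3 using 1
    ring
  have hgreat : IsGreatest {t : ℕ | Ideal.map (integerMap F E) 𝓂[F] ≤ 𝓂[E] ^ t} e := by
    constructor
    · rw [Set.mem_ofPred_eq, Ideal.map_le_iff_le_comap]
      intro x hx
      rw [Ideal.mem_comap, mem_maximalIdeal_pow_iff, coe_integerMap]
      rw [mem_maximalIdeal_iff] at hx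
      by_cases hx0 : (x : F) = 0
      · rw [hx0, map_zero]; exact zero_mem _
      obtain ⟨k, hk⟩ := exists_hasOrd_of_ne_zero hx0
      have hk1 : 1 ≤ k := by
        by_contra hneg
        exact (hasOrd_iff.1 hk).2 (primePow_antitone (by omega) hx)
      refine primePow_antitone ?_ (hord hk).mem
      nlinarith
    · intro t ht
      rw [Set.mem_ofPred_eq, Ideal.map_le_iff_le_comap] at ht
      have hmem :
          (⟨ϖ, mem_primePow_zero.1 (primePow_antitone zero_le_one hϖ.mem)⟩ : 𝒪[F]) ∈ 𝓂[F] :=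
        mem_maximalIdeal_iff.2 hϖ.mem
      have := ht hmem
      rw [Ideal.mem_comap, mem_maximalIdeal_pow_iff, coe_integerMap] at this
      by_contra hlt
      exact (hasOrd_iff.1 he').2 (primePow_antitone (by omega) this)
  have he : ramificationIndex F E = e := hgreat.csSup_eq
  rw [he]
  exact ⟨by exact_mod_cast hpos, hord⟩

lemma ramificationIndex_pos : 0 < ramificationIndex F E := exists_hasOrd_algebraMap.1

lemma HasOrd.algebraMap {x : F} {k : ℤ} (hx : HasOrd x k) :
    HasOrd (algebraMap F E x) (ramificationIndex F E * k) := exists_hasOrd_algebraMap.2 hx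

variable (F E) in
lemma card_residueField :
    Nat.card 𝓀[E] = Nat.card 𝓀[F] ^ residueDegree F E ∧ 0 < residueDegree F E ∧
      ringChar 𝓀[E] = ringChar 𝓀[F] := by
  let _ : Algebra 𝓀[F] 𝓀[E] := (IsLocalRing.ResidueField.map (integerMap F E)).toAlgebra
  have : Module.Finite 𝓀[F] 𝓀[E] := inferInstance
  refine ⟨Module.natCard_eq_pow_finrank, Module.finrank_pos, ?_⟩
  exact (Algebra.ringChar_eq 𝓀[F] 𝓀[E]).symm

lemma res_algebraMap_pow {x : F} (hx : HasOrd x 0) :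
    res (algebraMap F E x) ^ (Nat.card 𝓀[F] - 1) = 1 := by
  have : Fintype 𝓀[F] := Fintype.ofFinite _
  lift x to 𝒪[F] using mem_primePow_zero.1 hx.mem
  rw [← coe_integerMap, res_coe, ← IsLocalRing.ResidueField.map_residue, ← map_pow,
    Nat.card_eq_fintype_card, FiniteField.pow_card_sub_one_eq_one, map_one]
  rw [← res_coe]
  exact (res_ne_zero_iff hx.mem).2 hx

/-- If the residue degree is even, the units of the small field have square residue. -/
lemma quadraticChar_algebraMap [Fintype 𝓀[E]] [DecidableEq 𝓀[E]] (hp : ringChar 𝓀[F] ≠ 2)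
    (hf : Even (residueDegree F E)) {x : F} (hx : HasOrd x 0) :
    quadraticChar 𝓀[E] (res (algebraMap F E x)) = 1 := by
  have hxE : HasOrd (algebraMap F E x) 0 := by simpa using hx.algebraMap (E := E)
  have hne := (res_ne_zero_iff hxE.mem).2 hxE
  obtain ⟨hcard, -, hchar⟩ := card_residueField F E
  have : Fintype 𝓀[F] := Fintype.ofFinite _
  rw [quadraticChar_one_iff_isSquare hne, FiniteField.isSquare_iff (hchar ▸ hp) hne]
  obtain ⟨m, hm⟩ := hf
  have hodd : Nat.card 𝓀[F] % 2 = 1 := by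
    rw [Nat.card_eq_fintype_card]
    exact FiniteField.odd_card_of_char_ne_two hp
  rw [Nat.card_eq_fintype_card] at hcard
  have hdvd : Nat.card 𝓀[F] - 1 ∣ Fintype.card 𝓀[E] / 2 := by
    rw [hcard, hm, ← two_mul, pow_mul]
    obtain ⟨t, ht⟩ : ∃ t, Nat.card 𝓀[F] = 2 * t + 1 := ⟨Nat.card 𝓀[F] / 2, by omega⟩
    rw [ht]
    have h1 : (2 * t + 1) ^ 2 - 1 ∣ ((2 * t + 1) ^ 2) ^ m - 1 := Nat.sub_one_dvd_pow_sub_one _ _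
    obtain ⟨s, hs⟩ := h1
    have h2 : (2 * t + 1) ^ 2 - 1 = 2 * (2 * t * (t + 1)) := by
      have : (2 * t + 1) ^ 2 = 2 * (2 * t * (t + 1)) + 1 := by ring
      omega
    have h3 : 1 ≤ ((2 * t + 1) ^ 2) ^ m := Nat.one_le_pow _ _ (by positivity)
    refine ⟨(t + 1) * s, ?_⟩
    have h4 : ((2 * t + 1) ^ 2) ^ m = 2 * (2 * t * ((t + 1) * s)) + 1 := by
      rw [h2] at hs
      have : 2 * (2 * t * (t + 1)) * s = 2 * (2 * t * ((t + 1) * s)) := by ring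
      omega
    rw [h4]
    simp only [Nat.add_sub_cancel]
    omega
  obtain ⟨s, hs⟩ := hdvd
  rw [hs, pow_mul, res_algebraMap_pow hx, one_pow]

/-- In a tame extension, a power of exponent prime to `p` of any element lies in `F^× U_E^1`. -/
lemma exists_pow_eq (htame : (ramificationIndex F E).Coprime (ringChar 𝓀[F])) {x : E} {k : ℤ}
    (hx : HasOrd x k) :
    ∃ (N : ℕ) (a : F) (u : E), HasOrd (N : F) 0 ∧ a ≠ 0 ∧
      u - 1 ∈ primePow E 1 ∧ x ^ N = algebraMap F E a * u := by
  obtain ⟨a, ha⟩ := exists_hasOrd (E := F) k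
  have : Fintype 𝓀[F] := Fintype.ofFinite _
  have : Fintype 𝓀[E] := Fintype.ofFinite _
  have hb := ha.algebraMap (E := E)
  set e := ramificationIndex F E
  have hy := (hx.pow e).mul hb.inv
  rw [add_neg_cancel] at hy
  have hyres := (res_ne_zero_iff hy.mem).2 hy
  set y := x ^ e * (algebraMap F E a)⁻¹ with hydef
  have hq : 1 < Fintype.card 𝓀[E] := Fintype.one_lt_card
  set q := Fintype.card 𝓀[E]
  -- `x ^ e` is a unit times an element of `F`, and `(q - 1)`-st powers of units are principal.
  refine ⟨e * (q - 1), a ^ (q - 1), y ^ (q - 1), ?_, pow_ne_zero _ ha.ne_zero, ?_, ?_⟩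
  · have hnat (n : ℕ) : res ((n : ℕ) : F) = (n : 𝓀[F]) := by
      rw [← map_natCast (IsLocalRing.residue 𝒪[F]), ← res_coe]; rfl
    have hmem : ((e * (q - 1) : ℕ) : F) ∈ primePow F 0 :=
      mem_primePow_zero.2 ((e * (q - 1) : ℕ) : 𝒪[F]).2
    rw [← res_ne_zero_iff hmem, hnat, Nat.cast_mul]
    obtain ⟨-, -, hchar⟩ := card_residueField F E
    have hq0 : ((q : ℕ) : 𝓀[F]) = 0 := by
      rw [ringChar.spec, ← hchar, ← ringChar.spec]
      exact Nat.cast_card_eq_zero _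
    refine mul_ne_zero (fun h => ?_) ?_
    · have hd := (ringChar.spec 𝓀[F] _).1 h
      exact CharP.ringChar_ne_one (R := 𝓀[F]) (Nat.Coprime.eq_one_of_dvd htame.symm hd)
    · rw [Nat.cast_sub hq.le, hq0]
      simp
  · have hpow := (hy.pow (q - 1))
    rw [mul_zero] at hpow
    rw [← res_eq_res_iff hpow.mem hasOrd_one.mem, res_one]
    have hr (n : ℕ) : res (y ^ n) = res y ^ n := by
      induction n with
      | zero => simp [res_one]
      | succ n ih =>
        have := (hy.pow n).mem
        rw [mul_zero] at this
        rw [pow_succ, res_mul this hy.mem, ih, pow_succ]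
    rw [hr, FiniteField.pow_card_sub_one_eq_one _ hyres]
  · rw [map_pow, ← mul_pow, hydef, mul_comm (x ^ e), mul_inv_cancel_left₀ hb.ne_zero, pow_mul]

end Extension

/-! ### The lattice chain on a line -/

section Embedding

variable {F E V : Type*} [Field F] [Field E] [Algebra F E]
  [AddCommGroup V] [Module F V] [Module E V] [IsScalarTower F E V]

@[simp] lemma emb_apply (x : E) (v : V) : emb F V x v = x • v := rfl

lemma emb_add (x y : E) : emb F V (x + y) = emb F V x + emb F V y :=
  map_add (Algebra.lsmul F F V) x y

lemma emb_sub (x y : E) : emb F V (x - y) = emb F V x - emb F V y :=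
  map_sub (Algebra.lsmul F F V) x y

lemma emb_mul (x y : E) : emb F V (x * y) = emb F V x * emb F V y :=
  map_mul (Algebra.lsmul F F V) x y

lemma emb_one : emb F V (1 : E) = 1 := map_one (Algebra.lsmul F F V)

lemma emb_algebraMap (a : F) : emb F V (algebraMap F E a) = algebraMap F (Module.End F V) a :=
  (Algebra.lsmul F F V).commutes a

lemma emb_commute (x y : E) : emb F V x * emb F V y = emb F V y * emb F V x := by
  rw [← emb_mul, mul_comm, emb_mul]

lemma emb_inv_mul {x : E} (hx : x ≠ 0) : emb F V x⁻¹ * emb F V x = 1 := by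
  rw [← emb_mul, inv_mul_cancel₀ hx, emb_one]

lemma emb_mul_inv {x : E} (hx : x ≠ 0) : emb F V x * emb F V x⁻¹ = 1 := by
  rw [← emb_mul, mul_inv_cancel₀ hx, emb_one]

/-- An endomorphism commuting with `x` commutes with all of `F[x]`. -/
lemma emb_commute_of_mem_adjoin {x y : E} (hy : y ∈ Algebra.adjoin F {x}) {X : Module.End F V}
    (hX : emb F V x * X = X * emb F V x) : emb F V y * X = X * emb F V y := by
  induction hy using Algebra.adjoin_induction with
  | mem z hz => rw [Set.mem_singleton_iff] at hz; rwa [hz]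
  | algebraMap a => rw [emb_algebraMap]; exact Algebra.commutes a X
  | add y z _ _ hy hz => rw [emb_add, add_mul, hy, hz, mul_add]
  | mul y z _ _ hy hz => rw [emb_mul, mul_assoc, hz, ← mul_assoc, hy, mul_assoc]

end Embedding

section Chain

variable {F E V : Type*} [Field F] [ValuativeRel F] [TopologicalSpace F]
  [IsNonarchimedeanLocalField F] [Field E] [ValuativeRel E] [TopologicalSpace E]
  [IsNonarchimedeanLocalField E] [Algebra F E]
  [AddCommGroup V] [Module F V] [Module E V] [IsScalarTower F E V]

/-- The vector `v₀` spans the line `V`, and identifies the lattices of the chain with the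
powers of the maximal ideal. -/
structure IsChainGenerator (Λ : ℤ → Submodule 𝒪[E] V) (v₀ : V) : Prop where
  exists_smul : ∀ v, ∃ x : E, v = x • v₀
  smul_mem_iff : ∀ (k : ℤ) (x : E), x • v₀ ∈ Λ k ↔ x ∈ primePow E k

variable {Λ : ℤ → Submodule 𝒪[E] V}

lemma IsLatticeChain.mem_iff (hΛ : IsLatticeChain Λ) {ϖ : E} (hϖ : HasOrd ϖ 1) (k : ℤ) (v : V) :
    v ∈ Λ k ↔ (ϖ ^ k)⁻¹ • v ∈ Λ 0 := by
  have hϖ0 := hϖ.ne_zero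
  have hint : valuation E ϖ ≤ 1 := mem_primePow_zero.1 (primePow_antitone zero_le_one hϖ.mem)
  have step (k : ℤ) (v : V) : v ∈ Λ (k + 1) ↔ ϖ⁻¹ • v ∈ Λ k := by
    rw [hΛ.period]
    constructor
    · intro hv
      refine Submodule.smul_induction_on hv (fun a ha w hw => ?_) (fun x y hx hy => ?_)
      · have h1 : ϖ⁻¹ * (a : E) ∈ primePow E 0 := by
          simpa using mul_mem_primePow hϖ.inv.mem (mem_maximalIdeal_iff.1 ha)
        have : ϖ⁻¹ • a • w = (⟨ϖ⁻¹ * a, mem_primePow_zero.1 h1⟩ : 𝒪[E]) • w := by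
          rw [Subring.smul_def, Subring.smul_def, smul_smul]
        rw [this]
        exact (Λ k).smul_mem _ hw
      · rw [smul_add]; exact add_mem hx hy
    · intro hv
      have hm : (⟨ϖ, hint⟩ : 𝒪[E]) ∈ 𝓂[E] := mem_maximalIdeal_iff.2 hϖ.mem
      have := Submodule.smul_mem_smul hm hv
      rwa [Subring.smul_def, smul_inv_smul₀ hϖ0] at this
  induction k using Int.induction_on generalizing v with
  | zero => simp
  | succ k ih =>
    refine (step _ _).trans ((ih _).trans ?_)
    rw [smul_smul, ← mul_inv, ← zpow_add_one₀ hϖ0]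
  | pred k ih =>
    have := step (-(k : ℤ) - 1) (ϖ • v)
    rw [inv_smul_smul₀ hϖ0, sub_add_cancel] at this
    refine this.symm.trans ((ih _).trans ?_)
    rw [smul_smul, zpow_sub_one₀ hϖ0, mul_inv, inv_inv]

lemma IsLatticeChain.exists_generator (hΛ : IsLatticeChain Λ) (hV : Module.finrank E V = 1) :
    ∃ v₀, IsChainGenerator Λ v₀ := by
  obtain ⟨v, hv0, hv⟩ := finrank_eq_one_iff'.1 hV
  obtain ⟨ϖ, hϖ⟩ := exists_hasOrd (E := E) 1
  obtain ⟨s, hs⟩ := hΛ.fg 0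
  choose x hx using hv
  have hsne : s.Nonempty := by
    by_contra hne
    rw [Finset.not_nonempty_iff_eq_empty] at hne
    have h1 := hΛ.span_eq_top 0
    rw [← hs, hne] at h1
    simp only [Finset.coe_empty, Submodule.span_empty, Submodule.bot_coe,
      Submodule.span_zero_singleton] at h1
    exact hv0 ((Submodule.mem_bot E).1 (h1 ▸ Submodule.mem_top))
  obtain ⟨m, hm, hmax⟩ := s.exists_max_image (fun w => normVal E (x w)) hsne
  have hx0 : x m ≠ 0 := by
    intro h0
    have hall : ∀ w ∈ s, w = 0 := fun w hw => by
      have := hmax w hw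
      rw [h0, map_zero, le_zero_iff, map_eq_zero] at this
      rw [← hx w, this, zero_smul]
    have h1 := hΛ.span_eq_top 0
    rw [← hs, Submodule.span_eq_bot.2 (fun w hw => hall w hw)] at h1
    simp only [Submodule.bot_coe, Submodule.span_zero_singleton] at h1
    exact hv0 ((Submodule.mem_bot E).1 (h1 ▸ Submodule.mem_top))
  have hm0 : m ≠ 0 := by
    rintro rfl
    have := hx 0
    exact (smul_ne_zero hx0 hv0) this
  have hgen (w : V) : w = (x w * (x m)⁻¹) • m := by
    calc w = x w • v := (hx w).symm
      _ = (x w * (x m)⁻¹) • x m • v := by rw [smul_smul, inv_mul_cancel_right₀ hx0]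
      _ = _ := by rw [hx m]
  have hzero (y : E) : y • m ∈ Λ 0 ↔ y ∈ primePow E 0 := by
    constructor
    · intro hy
      suffices H : ∀ w ∈ Λ 0, x w * (x m)⁻¹ ∈ primePow E 0 by
        have h1 := H _ hy
        have h2 := hgen (y • m)
        have h3 : y = x (y • m) * (x m)⁻¹ := smul_left_injective E hm0 h2
        rwa [h3]
      have huniq (w : V) (z : E) (hz : z • m = w) : x w * (x m)⁻¹ = z :=
        smul_left_injective E hm0 ((hgen w).symm.trans hz.symm)
      intro w hw
      rw [← hs] at hw
      induction hw using Submodule.span_induction with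
      | mem w hw =>
        rw [mem_primePow, map_mul, map_inv₀, neg_zero, WithZero.exp_zero]
        exact mul_inv_le_one_of_le₀ (hmax w hw) zero_le
      | zero => rw [huniq 0 0 (zero_smul _ _)]; exact zero_mem _
      | add w w' _ _ hw hw' =>
        rw [huniq _ (x w * (x m)⁻¹ + x w' * (x m)⁻¹) (by rw [add_smul, ← hgen, ← hgen])]
        exact add_mem hw hw'
      | smul a w _ hw =>
        rw [huniq _ (a * (x w * (x m)⁻¹)) (by rw [mul_smul, ← hgen, Subring.smul_def])]
        simpa using mul_mem_primePow (mem_primePow_zero.2 a.2) hw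
    · intro hy
      have hmm : m ∈ Λ 0 := by rw [← hs]; exact Submodule.subset_span hm
      exact (Λ 0).smul_mem ⟨y, mem_primePow_zero.1 hy⟩ hmm
  refine ⟨m, fun w => ⟨_, hgen w⟩, fun k y => ?_⟩
  rw [hΛ.mem_iff hϖ, smul_smul, hzero]
  have := (hϖ.zpow k).inv.mul_mem_iff (y := y) (l := k)
  simpa using this

namespace IsChainGenerator

variable {v₀ : V} (hg : IsChainGenerator Λ v₀)
include hg

lemma smul_mem_chain_iff {x : E} {a : ℤ} (hx : HasOrd x a) (k : ℤ) (v : V) :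
    x • v ∈ Λ (a + k) ↔ v ∈ Λ k := by
  obtain ⟨y, rfl⟩ := hg.exists_smul v
  rw [smul_smul, hg.smul_mem_iff, hg.smul_mem_iff, hx.mul_mem_iff]

lemma smul_mem_chain {x : E} {a : ℤ} (hx : x ∈ primePow E a) {k : ℤ} {v : V} (hv : v ∈ Λ k) :
    x • v ∈ Λ (k + a) := by
  obtain ⟨y, rfl⟩ := hg.exists_smul v
  rw [hg.smul_mem_iff] at hv
  rw [smul_smul, hg.smul_mem_iff, add_comm]
  exact mul_mem_primePow hx hv

lemma antitone {k l : ℤ} (h : k ≤ l) : Λ l ≤ Λ k := fun v hv => by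
  obtain ⟨y, rfl⟩ := hg.exists_smul v
  rw [hg.smul_mem_iff] at hv ⊢
  exact primePow_antitone h hv

lemma exists_mem_notMem (v : V) (hv : v ≠ 0) : ∃ k, v ∈ Λ k ∧ v ∉ Λ (k + 1) := by
  obtain ⟨y, rfl⟩ := hg.exists_smul v
  have hy : y ≠ 0 := by rintro rfl; simp at hv
  obtain ⟨k, hk⟩ := exists_hasOrd_of_ne_zero hy
  refine ⟨k, ?_⟩
  rw [hg.smul_mem_iff, hg.smul_mem_iff]
  exact hasOrd_iff.1 hk

lemma filtration_antitone {k l : ℤ} (h : k ≤ l) : filtration F Λ l ≤ filtration F Λ k :=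
  fun X hX m v hv => hg.antitone (by omega) (hX m v hv)

lemma emb_mem_filtration {x : E} {k : ℤ} :
    emb F V x ∈ filtration F Λ k ↔ x ∈ primePow E k := by
  constructor
  · intro hx
    have h0 : v₀ ∈ Λ 0 := by
      have := (hg.smul_mem_iff 0 1).2 hasOrd_one.mem
      rwa [one_smul] at this
    have := hx 0 v₀ h0
    rw [emb_apply, hg.smul_mem_iff, zero_add] at this
    exact this
  · intro hx m v hv
    rw [emb_apply]
    exact hg.smul_mem_chain hx hv

end IsChainGenerator

lemma mul_mem_filtration {X Y : Module.End F V} {k l : ℤ} (hX : X ∈ filtration F Λ k)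
    (hY : Y ∈ filtration F Λ l) : X * Y ∈ filtration F Λ (k + l) := fun m v hv => by
  have := hX _ _ (hY m v hv)
  rwa [add_assoc, add_comm l] at this

lemma IsChainGenerator.emb_mul_mem_iff {v₀ : V} (hg : IsChainGenerator Λ v₀) {x : E} {a k : ℤ}
    (hx : HasOrd x a) {X : Module.End F V} :
    emb F V x * X ∈ filtration F Λ (a + k) ↔ X ∈ filtration F Λ k := by
  refine ⟨fun h => ?_, fun h => mul_mem_filtration (hg.emb_mem_filtration.2 hx.mem) h⟩
  have := mul_mem_filtration (hg.emb_mem_filtration (F := F).2 hx.inv.mem) h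
  rwa [← mul_assoc, emb_inv_mul hx.ne_zero, one_mul, neg_add_cancel_left] at this

lemma mem_centralizerFiltration {γ X : Module.End F V} {k : ℤ} :
    X ∈ centralizerFiltration Λ γ k ↔ X ∈ filtration F Λ k ∧ γ * X = X * γ := by
  rw [centralizerFiltration, AddSubgroup.mem_inf, Subring.mem_toAddSubgroup,
    Subring.mem_centralizer_iff]
  simp

end Chain

/-! ### Adjoints and self-duality -/

section Adjoint

variable {F V : Type*} [Field F] [AddCommGroup V] [Module F V] {c : F →+* F}
  {h : V →ₛₗ[c] V →ₗ[F] F} {ε : F}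

namespace IsHermitianForm

lemma mul_self (hh : IsHermitianForm h ε) : ε * ε = 1 := by
  rcases hh.sign with h | h <;> simp [h]

lemma map_sign (hh : IsHermitianForm h ε) : c ε = ε := by
  rcases hh.sign with h | h <;> simp [h]

lemma eq_of_forall (hh : IsHermitianForm h ε) {w w' : V} (H : ∀ v, h v w = h v w') : w = w' := by
  rw [← sub_eq_zero]
  refine hh.nondegenerate _ fun v => ?_
  rw [hh.symm, map_sub, H, sub_self, map_zero, mul_zero]

lemma involutive [Nontrivial V] (hh : IsHermitianForm h ε) (x : F) : c (c x) = x := by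
  obtain ⟨v, hv⟩ := exists_ne (0 : V)
  obtain ⟨w, hw⟩ : ∃ w, h v w ≠ 0 := by
    by_contra! H
    exact hv (hh.nondegenerate v H)
  have key (w : V) : c (c (h v w)) = h v w := by
    have h1 := hh.symm w v
    rw [hh.symm v w, map_mul, hh.map_sign, ← mul_assoc, hh.mul_self, one_mul] at h1
    exact h1.symm
  specialize key ((x / h v w) • w)
  rw [map_smul, smul_eq_mul, div_mul_cancel₀ _ hw] at key
  exact key

variable [FiniteDimensional F V]

/-- A non-degenerate form on a finite-dimensional space represents every linear functional. -/
lemma exists_eq_dual [Nontrivial V] (hh : IsHermitianForm h ε) (φ : V →ₗ[F] F) :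
    ∃ u, h u = φ := by
  let b := Module.finBasis F V
  have hli : LinearIndependent F fun i => h (b i) := by
    rw [Fintype.linearIndependent_iff]
    intro g hg i
    have h1 : h (∑ i, c (g i) • b i) = 0 := by
      rw [map_sum, ← hg]
      refine Finset.sum_congr rfl fun i _ => ?_
      rw [map_smulₛₗ, hh.involutive]
    have h2 : ∑ i, c (g i) • b i = 0 := hh.nondegenerate _ fun w => by rw [h1]; rfl
    have h3 := Fintype.linearIndependent_iff.1 b.linearIndependent _ h2 i
    rw [← hh.involutive (h := h) (g i), h3, map_zero]
  have hspan := hli.span_eq_top_of_card_eq_finrank' (by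
    rw [Fintype.card_fin]; exact (Subspace.dual_finrank_eq).symm)
  have hφ : φ ∈ Submodule.span F (Set.range fun i => h (b i)) := hspan ▸ Submodule.mem_top
  obtain ⟨g, hg⟩ := (Submodule.mem_span_range_iff_exists_fun F).1 hφ
  refine ⟨∑ i, c (g i) • b i, ?_⟩
  rw [map_sum, ← hg]
  refine Finset.sum_congr rfl fun i _ => ?_
  rw [map_smulₛₗ, hh.involutive]

variable [Nontrivial V]

/-- The operator chosen as the adjoint does satisfy the adjunction, since one exists. -/
lemma apply_adjoint (hh : IsHermitianForm h ε) (X : Module.End F V) (v w : V) :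
    h (X v) w = h v (adjoint h X w) := by
  have hex : ∃ Y : Module.End F V, ∀ v w, h (X v) w = h v (Y w) := by
    have H (w : V) : ∃ u, h u = (h w).comp X := hh.exists_eq_dual _
    choose Y hY using H
    have hinj {u u' : V} (H : h u = h u') : u = u' := by
      rw [← sub_eq_zero]
      exact hh.nondegenerate _ fun w => by rw [map_sub, H, sub_self]; rfl
    refine ⟨{ toFun := Y, map_add' := fun w w' => hinj ?_, map_smul' := fun a w => hinj ?_ },
      fun v w => ?_⟩
    · rw [map_add, hY, hY, hY, map_add, LinearMap.add_comp]
    · rw [map_smulₛₗ, hY, hY, map_smulₛₗ, LinearMap.smul_comp]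
      rfl
    · change h (X v) w = h v (Y w)
      rw [hh.symm, hh.symm (Y w), hY, LinearMap.comp_apply]
  exact Classical.epsilon_spec hex v w

lemma eq_adjoint (hh : IsHermitianForm h ε) {X Y : Module.End F V}
    (H : ∀ v w, h (X v) w = h v (Y w)) : adjoint h X = Y := by
  ext w
  refine hh.eq_of_forall fun v => ?_
  rw [← hh.apply_adjoint, H]

lemma adjoint_sub (hh : IsHermitianForm h ε) (X Y : Module.End F V) :
    adjoint h (X - Y) = adjoint h X - adjoint h Y :=
  hh.eq_adjoint fun v w => by
    simp only [LinearMap.sub_apply, map_sub, hh.apply_adjoint]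

lemma adjoint_mul (hh : IsHermitianForm h ε) (X Y : Module.End F V) :
    adjoint h (X * Y) = adjoint h Y * adjoint h X :=
  hh.eq_adjoint fun v w => by
    simp only [Module.End.mul_apply, hh.apply_adjoint]

lemma apply_adjoint' (hh : IsHermitianForm h ε) (X : Module.End F V) (v w : V) :
    h (adjoint h X v) w = h v (X w) := by
  rw [hh.symm, ← hh.apply_adjoint, ← hh.symm]

lemma adjoint_adjoint (hh : IsHermitianForm h ε) (X : Module.End F V) :
    adjoint h (adjoint h X) = X :=
  hh.eq_adjoint fun v w => hh.apply_adjoint' X v w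

/-- The trace of the adjoint, by decomposition into operators of rank one. -/
lemma trace_adjoint (hh : IsHermitianForm h ε) (X : Module.End F V) :
    LinearMap.trace F V (adjoint h X) = c (LinearMap.trace F V X) := by
  have rank_one (u v : V) : LinearMap.trace F V (adjoint h ((h u).smulRight v)) =
      c (LinearMap.trace F V ((h u).smulRight v)) := by
    have : adjoint h ((h u).smulRight v) = (h v).smulRight (ε • u) := by
      refine hh.eq_adjoint fun x y => ?_
      simp only [LinearMap.smulRight_apply, map_smulₛₗ, LinearMap.smul_apply, RingHom.id_apply,
        smul_eq_mul]
      rw [hh.symm u x]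
      linear_combination (-(c (h u x) * h v y)) * hh.mul_self
    rw [this, LinearMap.trace_smulRight, LinearMap.trace_smulRight, map_smul, smul_eq_mul,
      hh.symm u v, ← mul_assoc, hh.mul_self, one_mul]
  let b := Module.finBasis F V
  choose u hu using fun i => hh.exists_eq_dual (b.coord i)
  have hX : X = ∑ i, (h (u i)).smulRight (X (b i)) := by
    refine b.ext fun j => ?_
    simp [hu, Finsupp.single_apply]
  have hsum (s : Finset (Fin (Module.finrank F V))) (f : _ → Module.End F V) :
      adjoint h (∑ i ∈ s, f i) = ∑ i ∈ s, adjoint h (f i) := by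
    refine hh.eq_adjoint fun v w => ?_
    simp only [LinearMap.sum_apply, map_sum, hh.apply_adjoint]
  rw [hX, hsum, map_sum, map_sum, map_sum]
  exact Finset.sum_congr rfl fun i _ => rank_one _ _

end IsHermitianForm

end Adjoint

section Conj

variable {F E V : Type*} [Field F] [Field E] [Algebra F E]
  [AddCommGroup V] [Module F V] [Module E V] [IsScalarTower F E V] {c : F →+* F}
  {h : V →ₛₗ[c] V →ₗ[F] F} {ε : F}

/-- `y` is the conjugate of `x`, that is, its adjoint with respect to `h`. -/
def IsConj (h : V →ₛₗ[c] V →ₗ[F] F) (x y : E) : Prop := ∀ v w, h (x • v) w = h v (y • w)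

namespace IsConj

lemma symm (hh : IsHermitianForm h ε) {x y : E} (H : IsConj h x y) : IsConj h y x := fun v w => by
  rw [hh.symm, ← H, ← hh.symm]

lemma algebraMap (h : V →ₛₗ[c] V →ₗ[F] F) (a : F) :
    IsConj h (algebraMap F E a) (algebraMap F E (c a)) := fun v w => by
  rw [algebraMap_smul, algebraMap_smul, map_smulₛₗ, map_smul, LinearMap.smul_apply]

lemma add {x y x' y' : E} (H : IsConj h x y) (H' : IsConj h x' y') :
    IsConj h (x + x') (y + y') := fun v w => by
  rw [add_smul, add_smul, map_add, map_add, LinearMap.add_apply, H, H']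

lemma mul {x y x' y' : E} (H : IsConj h x y) (H' : IsConj h x' y') :
    IsConj h (x * x') (y * y') := fun v w => by
  rw [mul_smul, H, H', smul_smul, mul_comm]

lemma sub {x y x' y' : E} (H : IsConj h x y) (H' : IsConj h x' y') :
    IsConj h (x - x') (y - y') := fun v w => by
  rw [sub_smul, sub_smul, map_sub, map_sub, LinearMap.sub_apply, H, H']

lemma adjoint_emb [FiniteDimensional F V] [Nontrivial V] (hh : IsHermitianForm h ε) {x y : E}
    (H : IsConj h x y) : adjoint h (emb F V x) = emb F V y := hh.eq_adjoint H

end IsConj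

/-- If `E` is generated by a skew element, then every element of `E` has a conjugate in `E`. -/
lemma exists_isConj {β : E} (hβ : IsConj h β (-β)) (htop : Algebra.adjoin F {β} = ⊤) (x : E) :
    ∃ y, IsConj h x y := by
  have hx : x ∈ Algebra.adjoin F {β} := htop ▸ Algebra.mem_top
  induction hx using Algebra.adjoin_induction with
  | mem z hz => rw [Set.mem_singleton_iff] at hz; exact ⟨-β, hz ▸ hβ⟩
  | algebraMap a => exact ⟨_, IsConj.algebraMap h a⟩
  | add x y _ _ hx hy =>
    obtain ⟨x', hx⟩ := hx
    obtain ⟨y', hy⟩ := hy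
    exact ⟨_, hx.add hy⟩
  | mul x y _ _ hx hy =>
    obtain ⟨x', hx⟩ := hx
    obtain ⟨y', hy⟩ := hy
    exact ⟨_, hx.mul hy⟩

end Conj

section SelfDual

variable {F E V : Type*} [Field F] [ValuativeRel F] [TopologicalSpace F]
  [IsNonarchimedeanLocalField F] [Field E] [ValuativeRel E] [TopologicalSpace E]
  [IsNonarchimedeanLocalField E] [Algebra F E] [ValuativeExtension F E]
  [AddCommGroup V] [Module F V] [Module E V] [IsScalarTower F E V] {c : F →+* F}
  {h : V →ₛₗ[c] V →ₗ[F] F} {ε : F} {Λ : ℤ → Submodule 𝒪[E] V} {v₀ : V}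

/-- Self-duality of the chain implies that conjugation preserves the valuation of `E`. -/
lemma IsConj.mem_primePow_of_mem (hg : IsChainGenerator Λ v₀) (hd : IsSelfDual h Λ) {x y : E}
    (H : IsConj h x y) {a : ℤ} (hy : y ∈ primePow E a) : x ∈ primePow E a := by
  obtain ⟨d, hd⟩ := hd
  have h0 : v₀ ∈ Λ 0 := by simpa using (hg.smul_mem_iff 0 1).2 hasOrd_one.mem
  rw [← hg.smul_mem_iff]
  have e : a = d - (d - a) := by ring
  rw [e, hd]
  intro w hw
  rw [H]
  refine (hd d v₀).1 (by rwa [sub_self]) _ ?_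
  have := hg.smul_mem_chain hy hw
  rwa [sub_add_cancel] at this

lemma IsConj.mem_primePow_iff (hh : IsHermitianForm h ε) (hg : IsChainGenerator Λ v₀)
    (hd : IsSelfDual h Λ) {x y : E} (H : IsConj h x y) {a : ℤ} :
    y ∈ primePow E a ↔ x ∈ primePow E a :=
  ⟨H.mem_primePow_of_mem hg hd, (H.symm hh).mem_primePow_of_mem hg hd⟩

lemma IsConj.hasOrd_iff (hh : IsHermitianForm h ε) (hg : IsChainGenerator Λ v₀)
    (hd : IsSelfDual h Λ) {x y : E} (H : IsConj h x y) {a : ℤ} : HasOrd y a ↔ HasOrd x a := by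
  rw [StronglyRamified.hasOrd_iff, StronglyRamified.hasOrd_iff, H.mem_primePow_iff hh hg hd,
    H.mem_primePow_iff hh hg hd]

include E in
lemma map_mem_primePow_one_iff (hh : IsHermitianForm h ε) (hg : IsChainGenerator Λ v₀)
    (hd : IsSelfDual h Λ) {a : F} : c a ∈ primePow F 1 ↔ a ∈ primePow F 1 := by
  rw [← algebraMap_mem_primePow_one (F := F) (E := E),
    ← algebraMap_mem_primePow_one (F := F) (E := E)]
  exact (IsConj.algebraMap h a).mem_primePow_iff hh hg hd

lemma IsHermitianForm.apply_mem_primePow_one_comm (hh : IsHermitianForm h ε)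
    (hg : IsChainGenerator Λ v₀) (hd : IsSelfDual h Λ) {v w : V} :
    h v w ∈ primePow F 1 ↔ h w v ∈ primePow F 1 := by
  rw [hh.symm v w, ← map_mem_primePow_one_iff hh hg hd (a := h v w)]
  rcases hh.sign with h | h
  · rw [h, one_mul]
  · rw [h, neg_one_mul, neg_mem_iff]

/-- The duality of the lattice chain, as a pairing in the second variable. -/
lemma exists_mem_iff (hh : IsHermitianForm h ε) (hg : IsChainGenerator Λ v₀)
    (hd : IsSelfDual h Λ) :
    ∃ d : ℤ, ∀ k w, w ∈ Λ k ↔ ∀ u ∈ Λ (d - k), h u w ∈ primePow F 1 := by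
  obtain ⟨d, hd'⟩ := hd
  refine ⟨d, fun k w => ?_⟩
  have := hd' (d - k) w
  rw [sub_sub_cancel] at this
  rw [this]
  refine forall₂_congr fun u _ => ?_
  rw [← mem_primePow_one, hh.apply_mem_primePow_one_comm hg ⟨d, hd'⟩]

lemma IsHermitianForm.adjoint_mem_filtration [FiniteDimensional F V] [Nontrivial V]
    (hh : IsHermitianForm h ε) (hg : IsChainGenerator Λ v₀)
    (hd : IsSelfDual h Λ) {X : Module.End F V} {k : ℤ} (hX : X ∈ filtration F Λ k) :
    adjoint h X ∈ filtration F Λ k := by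
  obtain ⟨d, hd⟩ := exists_mem_iff hh hg hd
  intro m w hw
  rw [hd]
  intro u hu
  rw [← hh.apply_adjoint]
  refine (hd m w).1 hw _ ?_
  have := hX _ _ hu
  rwa [show d - (m + k) + k = d - m by ring] at this

/-- Criterion for an operator of rank one to lie in a given step of the filtration. -/
lemma smulRight_mem_filtration (hg : IsChainGenerator Λ v₀) {d : ℤ}
    (hd : ∀ k w, w ∈ Λ k ↔ ∀ u ∈ Λ (d - k), h u w ∈ primePow F 1) {m i : ℤ} {u v : V}
    (hv : v ∈ Λ i) (hu : u ∈ Λ (d - (i + (1 - m)))) : (h u).smulRight v ∈ filtration F Λ m := by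
  intro l w hw
  rw [LinearMap.smulRight_apply]
  by_cases hx : h u w = 0
  · rw [hx, zero_smul]; exact zero_mem _
  have hx' : algebraMap F E (h u w) ≠ 0 := by rwa [Ne, map_eq_zero]
  obtain ⟨a, ha⟩ := exists_hasOrd_of_ne_zero hx'
  have hone : h u ((algebraMap F E (h u w))⁻¹ • w) = 1 := by
    rw [← map_inv₀, algebraMap_smul, map_smul, smul_eq_mul, inv_mul_cancel₀ hx]
  have hmem : (algebraMap F E (h u w))⁻¹ • w ∈ Λ (-a + l) :=
    (hg.smul_mem_chain_iff ha.inv l w).2 hw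
  have hlt : -a + l < i + (1 - m) := by
    by_contra hge
    have h1 := (hd _ _).1 (hg.antitone (not_lt.1 hge) hmem) u hu
    rw [hone] at h1
    exact (hasOrd_iff.1 (hasOrd_one (E := F))).2 h1
  rw [← algebraMap_smul E]
  exact hg.antitone (by omega) (hg.smul_mem_chain ha.mem hv)

/-- The lattices `𝔓^m` and `𝔓^(1-m)` are dual to each other for the trace form: test with
operators of rank one. -/
lemma mem_filtration_of_trace (hh : IsHermitianForm h ε) (hg : IsChainGenerator Λ v₀)
    (hd : IsSelfDual h Λ) {Z : Module.End F V} {m : ℤ} [FiniteDimensional F V]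
    (H : ∀ Y ∈ filtration F Λ m, LinearMap.trace F V (Z * Y) ∈ primePow F 1) :
    Z ∈ filtration F Λ (1 - m) := by
  obtain ⟨d, hd⟩ := exists_mem_iff hh hg hd
  intro i v hv
  rw [hd]
  intro u hu
  have := H _ (smulRight_mem_filtration hg hd hv hu)
  rwa [show Z * (h u).smulRight v = (h u).smulRight (Z v) by ext; simp,
    LinearMap.trace_smulRight] at this

end SelfDual

/-! ### Indices of lattices -/

section Lattice

variable {F : Type*} [Field F] [ValuativeRel F] [TopologicalSpace F]
  [IsNonarchimedeanLocalField F]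

variable {U : Type*} [AddCommGroup U] [Module F U] [FiniteDimensional F U]

/-- A lattice in a finite-dimensional vector space over a local field, given by its additive
group: it is stable under the integers, spans, and is bounded in some coordinates. -/
structure IsLocalLattice (F : Type*) [Field F] [ValuativeRel F] [TopologicalSpace F]
    [IsNonarchimedeanLocalField F] {U : Type*} [AddCommGroup U] [Module F U]
    (L : AddSubgroup U) : Prop where
  smul_mem : ∀ a ∈ primePow F 0, ∀ u ∈ L, a • u ∈ L
  exists_smul_mem : ∀ u, ∃ a : F, a ≠ 0 ∧ a • u ∈ L
  bounded : ∃ (n : ℕ) (φ : U →ₗ[F] (Fin n → F)), Function.Injective φ ∧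
    ∀ u ∈ L, ∀ i, φ u i ∈ primePow F 0

namespace IsLocalLattice

variable {L : AddSubgroup U} (hL : IsLocalLattice F L)

/-- A lattice as a module over the ring of integers. -/
def toSubmodule (hL : IsLocalLattice F L) : Submodule 𝒪[F] U :=
  { L with smul_mem' := fun a u hu => hL.smul_mem a (mem_primePow_zero.2 a.2) u hu }

lemma isLattice : Submodule.IsLattice F hL.toSubmodule where
  fg := by
    obtain ⟨n, φ, hφ, hb⟩ := hL.bounded
    let g : hL.toSubmodule →ₗ[𝒪[F]] (Fin n → 𝒪[F]) :=
      { toFun := fun u i => ⟨φ u i, mem_primePow_zero.1 (hb u u.2 i)⟩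
        map_add' := fun u v => by ext i; simp
        map_smul' := fun a u => by
          ext i
          have : φ (((a • u : hL.toSubmodule)) : U) = (a : F) • φ u := by
            rw [← map_smul]; rfl
          exact congrFun this i }
    have hg : Function.Injective g := fun u v huv => by
      refine Subtype.ext (hφ (funext fun i => ?_))
      exact congrArg Subtype.val (congrFun huv i)
    have : IsNoetherian 𝒪[F] hL.toSubmodule := isNoetherian_of_injective g hg
    exact Module.Finite.iff_fg.1 inferInstance
  span_eq_top := by
    rw [eq_top_iff]
    intro u _
    obtain ⟨a, ha, hu⟩ := hL.exists_smul_mem u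
    have := Submodule.smul_mem _ a⁻¹
      (Submodule.subset_span (R := F) (s := (hL.toSubmodule : Set U)) hu)
    rwa [inv_smul_smul₀ ha] at this

include hL in
lemma nonempty_basis :
    Nonempty (Module.Basis (Fin (Module.finrank F U)) 𝒪[F] hL.toSubmodule) := by
  have := hL.isLattice
  have : Module.Free 𝒪[F] hL.toSubmodule := Submodule.IsLattice.free F _
  have h1 := Submodule.IsLattice.rank' F hL.toSubmodule
  have h2 : Module.finrank 𝒪[F] hL.toSubmodule = Module.finrank F U := by
    exact Module.finrank_eq_of_rank_eq (by rw [h1, Module.finrank_eq_rank])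
  exact ⟨Module.finBasisOfFinrankEq _ _ h2⟩

include hL in
/-- A lattice `L` of rank `n` satisfies `[L : ϖ L] = q ^ n`. -/
lemma relIndex_eq {ϖ : F} (hϖ : HasOrd ϖ 1) {L' : AddSubgroup U}
    (hL' : ∀ u, ϖ • u ∈ L' ↔ u ∈ L) :
    L'.relIndex L = Nat.card 𝓀[F] ^ Module.finrank F U := by
  obtain ⟨b⟩ := hL.nonempty_basis
  let g : L →+ (Fin (Module.finrank F U) → 𝓀[F]) :=
    { toFun := fun u i => IsLocalRing.residue 𝒪[F] (b.repr (⟨u, u.2⟩ : hL.toSubmodule) i)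
      map_zero' := by
        ext i
        have : (⟨((0 : L) : U), (0 : L).2⟩ : hL.toSubmodule) = 0 := rfl
        rw [this, map_zero, Finsupp.zero_apply, map_zero, Pi.zero_apply]
      map_add' := fun u v => by
        ext i
        have : (⟨((u + v : L) : U), (u + v).2⟩ : hL.toSubmodule) =
          (⟨u, u.2⟩ : hL.toSubmodule) + ⟨v, v.2⟩ := rfl
        rw [this, map_add, Finsupp.add_apply, map_add, Pi.add_apply] }
  have hsurj : Function.Surjective g := by
    intro y
    choose z hz using fun i => IsLocalRing.residue_surjective (y i)
    refine ⟨⟨(b.equivFun.symm z : hL.toSubmodule), (b.equivFun.symm z).2⟩, ?_⟩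
    ext i
    have : b.repr (b.equivFun.symm z) i = z i := by
      rw [← Module.Basis.equivFun_apply, LinearEquiv.apply_symm_apply]
    change IsLocalRing.residue 𝒪[F] (b.repr (b.equivFun.symm z) i) = _
    rw [this, hz]
  have hker : g.ker = L'.addSubgroupOf L := by
    ext u
    rw [AddMonoidHom.mem_ker, AddSubgroup.mem_addSubgroupOf]
    have hmem : valuation F ϖ ≤ 1 := mem_primePow_zero.1 (primePow_antitone zero_le_one hϖ.mem)
    set u' : hL.toSubmodule := ⟨u, u.2⟩
    have hcoe : (u : U) = (u' : U) := rfl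
    constructor
    · intro h0
      have hdiv (i) : ∃ z : 𝒪[F], b.repr u' i = ⟨ϖ, hmem⟩ * z := by
        have h1 := congrFun h0 i
        have h2 : IsLocalRing.residue 𝒪[F] (b.repr u' i) = 0 := h1
        rw [IsLocalRing.residue_eq_zero_iff, mem_maximalIdeal_iff] at h2
        have h3 : ϖ⁻¹ * (b.repr u' i : F) ∈ primePow F 0 := by
          simpa using mul_mem_primePow hϖ.inv.mem h2
        refine ⟨⟨_, mem_primePow_zero.1 h3⟩, Subtype.ext ?_⟩
        exact (mul_inv_cancel_left₀ hϖ.ne_zero _).symm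
      choose z hz using hdiv
      have : u' = (⟨ϖ, hmem⟩ : 𝒪[F]) • b.equivFun.symm z := by
        refine b.equivFun.injective (funext fun i => ?_)
        rw [map_smul, LinearEquiv.apply_symm_apply]
        simpa using hz i
      rw [hcoe, this]
      exact (hL' _).2 (b.equivFun.symm z).2
    · intro hu
      have h1 : ϖ • (ϖ⁻¹ • (u : U)) ∈ L' := by rwa [smul_inv_smul₀ hϖ.ne_zero]
      rw [hL'] at h1
      have : u' = (⟨ϖ, hmem⟩ : 𝒪[F]) • (⟨ϖ⁻¹ • (u : U), h1⟩ : hL.toSubmodule) :=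
        Subtype.ext (smul_inv_smul₀ hϖ.ne_zero _).symm
      ext i
      change IsLocalRing.residue 𝒪[F] (b.repr u' i) = 0
      rw [this, map_smul, Finsupp.smul_apply, smul_eq_mul, map_mul,
        (IsLocalRing.residue_eq_zero_iff (⟨ϖ, hmem⟩ : 𝒪[F])).2 (mem_maximalIdeal_iff.2 hϖ.mem),
        zero_mul]
  rw [AddSubgroup.relIndex, ← hker, AddSubgroup.index_ker, AddMonoidHom.range_eq_top.2 hsurj,
    AddSubgroup.card_top, Nat.card_fun, Nat.card_fin]

include hL in
/-- If an operator maps a lattice to itself, and some power of it maps the lattice to `𝔭_F` times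
itself, then its trace lies in `𝔭_F`: its reduction is nilpotent. -/
lemma trace_mem {X : Module.End F U} (hX : ∀ u ∈ L, X u ∈ L) {ϖ : F} (hϖ : HasOrd ϖ 1) {e : ℕ}
    (hXe : ∀ u ∈ L, ϖ⁻¹ • (X ^ e) u ∈ L) : LinearMap.trace F U X ∈ primePow F 1 := by
  have := hL.isLattice
  obtain ⟨b⟩ := hL.nonempty_basis
  let x : hL.toSubmodule →ₗ[𝒪[F]] hL.toSubmodule :=
    { toFun := fun u => ⟨X u, hX u u.2⟩
      map_add' := fun u v => Subtype.ext (map_add X _ _)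
      map_smul' := fun a u => Subtype.ext (map_smul X (a : F) (u : U)) }
  have hx (m : ℕ) (u : hL.toSubmodule) : ((x ^ m) u : U) = (X ^ m) u := by
    induction m with
    | zero => rfl
    | succ m ih => rw [pow_succ', pow_succ', Module.End.mul_apply, Module.End.mul_apply, ← ih]; rfl
  let bF := b.extendOfIsLattice F
  have hrepr (u : hL.toSubmodule) (i) : bF.repr (u : U) i = (b.repr u i : F) := by
    have h1 : (u : U) = ∑ j, (b.repr u j : F) • bF j := by
      conv_lhs => rw [← b.sum_repr u]
      rw [AddSubmonoidClass.coe_finsetSum]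
      refine Finset.sum_congr rfl fun j _ => ?_
      rw [Module.Basis.extendOfIsLattice_apply]
      rfl
    rw [h1, Module.Basis.repr_sum_self]
  have htr : LinearMap.trace F U X = (LinearMap.trace 𝒪[F] hL.toSubmodule x : F) := by
    rw [LinearMap.trace_eq_matrix_trace F bF, LinearMap.trace_eq_matrix_trace 𝒪[F] b,
      Matrix.trace, Matrix.trace, AddSubmonoidClass.coe_finsetSum]
    refine Finset.sum_congr rfl fun i _ => ?_
    rw [Matrix.diag_apply, Matrix.diag_apply, LinearMap.toMatrix_apply, LinearMap.toMatrix_apply,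
      Module.Basis.extendOfIsLattice_apply, ← hrepr]
    rfl
  have hmem : valuation F ϖ ≤ 1 := mem_primePow_zero.1 (primePow_antitone zero_le_one hϖ.mem)
  rw [htr, ← mem_maximalIdeal_iff, ← IsLocalRing.residue_eq_zero_iff,
    LinearMap.trace_eq_matrix_trace 𝒪[F] b, AddMonoidHom.map_trace]
  refine (Matrix.isNilpotent_trace_of_isNilpotent ⟨e, ?_⟩).eq_zero
  change ((IsLocalRing.residue 𝒪[F]).mapMatrix _) ^ e = 0
  rw [← map_pow, LinearMap.toMatrix_pow]
  ext i j
  rw [RingHom.mapMatrix_apply, Matrix.map_apply, LinearMap.toMatrix_apply]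
  have : (x ^ e) (b j) = (⟨ϖ, hmem⟩ : 𝒪[F]) •
      (⟨ϖ⁻¹ • (X ^ e) (b j), hXe _ (b j).2⟩ : hL.toSubmodule) := by
    refine Subtype.ext ?_
    rw [hx]
    exact (smul_inv_smul₀ hϖ.ne_zero _).symm
  rw [this, map_smul, Finsupp.smul_apply, smul_eq_mul, map_mul,
    (IsLocalRing.residue_eq_zero_iff (⟨ϖ, hmem⟩ : 𝒪[F])).2 (mem_maximalIdeal_iff.2 hϖ.mem),
    zero_mul]
  rfl

end IsLocalLattice

end Lattice

/-! ### Indices of the filtration, and traces -/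

section Index

lemma relIndex_add_eq_pow {A : Type*} [AddCommGroup A] {f : ℤ → AddSubgroup A}
    (hf : ∀ k, f (k + 1) ≤ f k) {N : ℕ} (hN : ∀ k, (f (k + 1)).relIndex (f k) = N) (t : ℕ) :
    (f t).relIndex (f 0) = N ^ t := by
  have hle (t : ℕ) : f t ≤ f 0 := by
    induction t with
    | zero => exact le_rfl
    | succ t ih => exact (hf t).trans ih
  induction t with
  | zero => simp
  | succ t ih =>
    rw [← AddSubgroup.relIndex_mul_relIndex _ (f t) _ (by exact_mod_cast hf t) (hle t), ih,
      pow_succ', Nat.cast_succ, hN]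

lemma relIndex_map_equiv {A B : Type*} [AddCommGroup A] [AddCommGroup B] (φ : A ≃+ B)
    {H K : AddSubgroup A} {H' K' : AddSubgroup B} (hH : ∀ x, φ x ∈ H' ↔ x ∈ H)
    (hK : ∀ x, φ x ∈ K' ↔ x ∈ K) : H'.relIndex K' = H.relIndex K := by
  have e1 : H'.comap φ.toAddMonoidHom = H := by ext x; exact hH x
  have e2 : K.map φ.toAddMonoidHom = K' := by
    ext y
    constructor
    · rintro ⟨x, hx, rfl⟩
      exact (hK x).2 hx
    · intro hy
      refine ⟨φ.symm y, (hK _).1 ?_, φ.apply_symm_apply y⟩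
      rwa [φ.apply_symm_apply]
  rw [← e1, ← e2, AddSubgroup.relIndex_comap]

end Index

section LocalField

variable {F E : Type*} [Field F] [ValuativeRel F] [TopologicalSpace F]
  [IsNonarchimedeanLocalField F] [Field E] [ValuativeRel E] [TopologicalSpace E]
  [IsNonarchimedeanLocalField E] [Algebra F E] [ValuativeExtension F E]

lemma relIndex_primePow (k : ℤ) :
    (primePow E (k + 1)).relIndex (primePow E k) = Nat.card 𝓀[E] := by
  have h0 : (primePow E 1).relIndex (primePow E 0) = Nat.card 𝓀[E] := by
    let g : primePow E 0 →+ 𝓀[E] :=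
      { toFun := fun x => IsLocalRing.residue 𝒪[E] ⟨x, mem_primePow_zero.1 x.2⟩
        map_zero' := map_zero (IsLocalRing.residue 𝒪[E])
        map_add' := fun x y => map_add (IsLocalRing.residue 𝒪[E]) ⟨x, mem_primePow_zero.1 x.2⟩
          ⟨y, mem_primePow_zero.1 y.2⟩ }
    have hsurj : Function.Surjective g := fun a => by
      obtain ⟨x, rfl⟩ := IsLocalRing.residue_surjective a
      exact ⟨⟨x, mem_primePow_zero.2 x.2⟩, rfl⟩
    have hker : g.ker = (primePow E 1).addSubgroupOf (primePow E 0) := by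
      ext x
      rw [AddMonoidHom.mem_ker, AddSubgroup.mem_addSubgroupOf]
      change IsLocalRing.residue 𝒪[E] _ = 0 ↔ _
      rw [IsLocalRing.residue_eq_zero_iff, mem_maximalIdeal_iff]
    rw [AddSubgroup.relIndex, ← hker, AddSubgroup.index_ker, AddMonoidHom.range_eq_top.2 hsurj,
      AddSubgroup.card_top]
  obtain ⟨ϖ, hϖ⟩ := exists_hasOrd (E := E) k
  rw [← h0]
  refine relIndex_map_equiv (AddAut.mulLeft (Units.mk0 ϖ hϖ.ne_zero)) (fun x => ?_) (fun x => ?_)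
  · exact hϖ.mul_mem_iff
  · simpa using hϖ.mul_mem_iff (y := x) (l := 0)

lemma exists_smul_mem_primePow (x : E) (k : ℤ) : ∃ a : F, a ≠ 0 ∧ a • x ∈ primePow E k := by
  by_cases hx : x = 0
  · exact ⟨1, one_ne_zero, by rw [hx, smul_zero]; exact zero_mem _⟩
  obtain ⟨l, hl⟩ := exists_hasOrd_of_ne_zero hx
  obtain ⟨a, ha⟩ := exists_hasOrd (E := F) (|k - l|)
  refine ⟨a, ha.ne_zero, ?_⟩
  rw [Algebra.smul_def]
  refine primePow_antitone ?_ (ha.algebraMap (E := E) |>.mul hl).mem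
  have h1 : (1 : ℤ) ≤ ramificationIndex F E := by
    exact_mod_cast ramificationIndex_pos (F := F) (E := E)
  have h2 := le_abs_self (k - l)
  nlinarith [abs_nonneg (k - l)]

end LocalField

section Chain

variable {F E V : Type*} [Field F] [ValuativeRel F] [TopologicalSpace F]
  [IsNonarchimedeanLocalField F] [Field E] [ValuativeRel E] [TopologicalSpace E]
  [IsNonarchimedeanLocalField E] [Algebra F E] [ValuativeExtension F E]
  [AddCommGroup V] [Module F V] [Module E V] [IsScalarTower F E V] {c : F →+* F}
  {h : V →ₛₗ[c] V →ₗ[F] F} {ε : F} {Λ : ℤ → Submodule 𝒪[E] V} {v₀ : V}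
  [FiniteDimensional F V]

lemma IsChainGenerator.exists_smul_mem (hg : IsChainGenerator Λ v₀) (k : ℤ) (v : V) :
    ∃ a : F, a ≠ 0 ∧ a • v ∈ Λ k := by
  obtain ⟨x, rfl⟩ := hg.exists_smul v
  obtain ⟨a, ha, hx⟩ := exists_smul_mem_primePow (F := F) x k
  refine ⟨a, ha, ?_⟩
  rwa [← smul_assoc, hg.smul_mem_iff]

lemma IsChainGenerator.algebra_smul_mem (hg : IsChainGenerator Λ v₀) {a : F}
    (ha : a ∈ primePow F 0) {k : ℤ} {v : V} (hv : v ∈ Λ k) : a • v ∈ Λ k := by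
  rw [← algebraMap_smul E]
  simpa using hg.smul_mem_chain (algebraMap_mem_primePow_zero.2 ha) hv

lemma IsChainGenerator.ne_zero (hg : IsChainGenerator Λ v₀) : v₀ ≠ 0 := by
  rintro rfl
  have := (hg.smul_mem_iff 1 1).1 (by rw [smul_zero]; exact zero_mem _)
  exact (hasOrd_iff.1 (hasOrd_one (E := E))).2 this

/-- Coordinates in which the duality of the chain bounds the lattice `Λ 0`. -/
lemma exists_coordinates (hh : IsHermitianForm h ε) (hg : IsChainGenerator Λ v₀)
    (hd : IsSelfDual h Λ) :
    ∃ φ : V →ₗ[F] (Fin (Module.finrank F V) → F), Function.Injective φ ∧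
      ∀ u ∈ Λ 0, ∀ i, φ u i ∈ primePow F 0 := by
  obtain ⟨d, hd⟩ := exists_mem_iff hh hg hd
  let b := Module.finBasis F V
  choose a ha hab using fun i => hg.exists_smul_mem (F := F) d (b i)
  refine ⟨LinearMap.pi fun i => h (a i • b i), ?_, fun u hu i => ?_⟩
  · rw [injective_iff_map_eq_zero]
    intro u hu
    have hi (i) : h (b i) u = 0 := by
      have := congrFun hu i
      simp only [LinearMap.pi_apply, map_smulₛₗ, LinearMap.smul_apply, smul_eq_mul,
        Pi.zero_apply] at this
      exact (mul_eq_zero.1 this).resolve_left ((map_ne_zero c).2 (ha i))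
    refine hh.nondegenerate u fun v => ?_
    have hv : h v u = 0 := by
      conv_lhs => rw [← b.sum_repr v, map_sum, LinearMap.sum_apply]
      refine Finset.sum_eq_zero fun i _ => ?_
      rw [map_smulₛₗ, LinearMap.smul_apply, hi, smul_zero]
    rw [hh.symm, hv, map_zero, mul_zero]
  · refine primePow_antitone zero_le_one ((hd 0 u).1 hu _ ?_)
    rw [sub_zero]
    exact hab i

lemma isLocalLattice_chain (hh : IsHermitianForm h ε) (hg : IsChainGenerator Λ v₀)
    (hd : IsSelfDual h Λ) : IsLocalLattice F (Λ 0).toAddSubgroup where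
  smul_mem _ ha _ hu := hg.algebra_smul_mem ha hu
  exists_smul_mem := hg.exists_smul_mem 0
  bounded := ⟨_, exists_coordinates hh hg hd⟩

lemma isLocalLattice_integers (hh : IsHermitianForm h ε) (hg : IsChainGenerator Λ v₀)
    (hd : IsSelfDual h Λ) : IsLocalLattice F (primePow E 0) where
  smul_mem a ha u hu := by
    rw [Algebra.smul_def]
    simpa using mul_mem_primePow (algebraMap_mem_primePow_zero.2 ha) hu
  exists_smul_mem u := exists_smul_mem_primePow u 0
  bounded := by
    obtain ⟨φ, hφ, hb⟩ := exists_coordinates hh hg hd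
    refine ⟨_, φ.comp ((LinearMap.toSpanSingleton E V v₀).restrictScalars F), ?_, fun x hx i => ?_⟩
    · exact hφ.comp (smul_left_injective E hg.ne_zero)
    · exact hb _ ((hg.smul_mem_iff 0 x).2 hx) i

lemma IsChainGenerator.exists_mem (hg : IsChainGenerator Λ v₀) (v : V) : ∃ k, v ∈ Λ k := by
  by_cases hv : v = 0
  · exact ⟨0, hv ▸ zero_mem _⟩
  · obtain ⟨k, hk, -⟩ := hg.exists_mem_notMem v hv
    exact ⟨k, hk⟩

/-- Every operator lies in some step of the filtration, as operators of rank one do. -/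
lemma exists_mem_filtration (hh : IsHermitianForm h ε) (hg : IsChainGenerator Λ v₀)
    (hd : IsSelfDual h Λ) (X : Module.End F V) : ∃ m : ℤ, X ∈ filtration F Λ m := by
  have : Nontrivial V := ⟨v₀, 0, hg.ne_zero⟩
  obtain ⟨d, hd⟩ := exists_mem_iff hh hg hd
  let b := Module.finBasis F V
  choose u hu using fun i => hh.exists_eq_dual (b.coord i)
  have hX : X = ∑ i, (h (u i)).smulRight (X (b i)) := by
    refine b.ext fun j => ?_
    simp [hu, Finsupp.single_apply]
  have hm (i) : ∃ m : ℤ, (h (u i)).smulRight (X (b i)) ∈ filtration F Λ m := by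
    obtain ⟨k, hk⟩ := hg.exists_mem (u i)
    obtain ⟨l, hl⟩ := hg.exists_mem (X (b i))
    refine ⟨k - d + l + 1, smulRight_mem_filtration hg hd hl ?_⟩
    rwa [show d - (l + (1 - (k - d + l + 1))) = k by ring]
  choose m hm using hm
  obtain ⟨M, hM⟩ := (Set.finite_range m).bddBelow
  refine ⟨M, ?_⟩
  rw [hX]
  exact sum_mem fun i _ => hg.filtration_antitone (hM ⟨i, rfl⟩) (hm i)

lemma isLocalLattice_filtration (hh : IsHermitianForm h ε) (hg : IsChainGenerator Λ v₀)
    (hd : IsSelfDual h Λ) : IsLocalLattice F (filtration F Λ 0) where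
  smul_mem a ha X hX m v hv := hg.algebra_smul_mem ha (hX m v hv)
  exists_smul_mem X := by
    obtain ⟨m, hm⟩ := exists_mem_filtration hh hg hd X
    obtain ⟨a, ha, ha'⟩ := exists_smul_mem_primePow (F := F) (1 : E) (-m)
    refine ⟨a, ha, ?_⟩
    rw [Algebra.smul_def, mul_one, ← hg.emb_mem_filtration (F := F), emb_algebraMap] at ha'
    rw [Algebra.smul_def]
    simpa using mul_mem_filtration ha' hm
  bounded := by
    obtain ⟨φ, hφ, hb⟩ := exists_coordinates hh hg hd
    let b := Module.finBasis F V
    choose a ha hab using fun i => hg.exists_smul_mem (F := F) 0 (b i)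
    let e := finProdFinEquiv (m := Module.finrank F V) (n := Module.finrank F V)
    refine ⟨_, LinearMap.pi fun k => (LinearMap.proj (e.symm k).2).comp
      (φ.comp (LinearMap.applyₗ (a (e.symm k).1 • b (e.symm k).1))), ?_, fun X hX k => ?_⟩
    · rw [injective_iff_map_eq_zero]
      intro X hX
      refine b.ext fun i => ?_
      have h1 : φ (X (a i • b i)) = 0 := by
        ext j
        have := congrFun hX (e (i, j))
        simpa using this
      rw [← map_zero φ] at h1
      have h2 := hφ h1
      rw [map_smul, smul_eq_zero] at h2
      exact h2.resolve_left (ha i)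
    · refine hb _ ?_ _
      have := hX 0 _ (hab (e.symm k).1)
      rwa [add_zero] at this

lemma IsChainGenerator.relIndex_filtration (hg : IsChainGenerator Λ v₀) (k : ℤ) :
    (filtration F Λ (k + 1)).relIndex (filtration F Λ k) =
      (filtration F Λ 1).relIndex (filtration F Λ 0) := by
  obtain ⟨ϖ, hϖ⟩ := exists_hasOrd (E := E) k
  have hu : IsUnit (emb F V ϖ) :=
    ⟨⟨_, _, emb_mul_inv hϖ.ne_zero, emb_inv_mul hϖ.ne_zero⟩, rfl⟩
  refine relIndex_map_equiv (AddAut.mulLeft hu.unit) (fun X => ?_) (fun X => ?_)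
  · exact hg.emb_mul_mem_iff hϖ
  · simpa using hg.emb_mul_mem_iff (X := X) (k := 0) hϖ

lemma IsChainGenerator.algebraMap_smul_mem_filtration_iff (hg : IsChainGenerator Λ v₀) {a : F}
    {t k : ℤ} (ha : HasOrd a t) (X : Module.End F V) :
    a • X ∈ filtration F Λ (ramificationIndex F E * t + k) ↔ X ∈ filtration F Λ k := by
  rw [Algebra.smul_def, ← emb_algebraMap (E := E)]
  exact hg.emb_mul_mem_iff ha.algebraMap

/-- The degree is the product of the ramification index and the residue degree: both give the
order of `𝔬_E / 𝔭_F 𝔬_E`. -/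
lemma finrank_eq (hh : IsHermitianForm h ε) (hg : IsChainGenerator Λ v₀)
    (hd : IsSelfDual h Λ) [FiniteDimensional F E] :
    Module.finrank F E = ramificationIndex F E * residueDegree F E := by
  obtain ⟨ϖ, hϖ⟩ := exists_hasOrd (E := F) 1
  have h1 := (isLocalLattice_integers hh hg hd).relIndex_eq hϖ
    (L' := primePow E (ramificationIndex F E)) (fun x => by
      rw [Algebra.smul_def]
      simpa using (hϖ.algebraMap (E := E)).mul_mem_iff (y := x) (l := 0))
  have h2 := relIndex_add_eq_pow (f := primePow E) (fun k => primePow_antitone (by omega))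
    relIndex_primePow (ramificationIndex F E)
  rw [h2, (card_residueField F E).1, ← pow_mul] at h1
  rw [← Nat.pow_right_injective (Finite.one_lt_card (α := 𝓀[F])) h1, mul_comm]

/-- The order of `𝔓^0 / 𝔓^1`. Its `e`-th power is the order of `𝔓^0 / 𝔭_F 𝔓^0`, which is
`q_F ^ (e f) ^ 2`. -/
lemma relIndex_filtration_zero (hh : IsHermitianForm h ε) (hg : IsChainGenerator Λ v₀)
    (hd : IsSelfDual h Λ) [FiniteDimensional F E] (hV : Module.finrank E V = 1) :
    (filtration F Λ 1).relIndex (filtration F Λ 0) =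
      Nat.card 𝓀[E] ^ (ramificationIndex F E * residueDegree F E) := by
  obtain ⟨ϖ, hϖ⟩ := exists_hasOrd (E := F) 1
  have h1 := (isLocalLattice_filtration hh hg hd).relIndex_eq hϖ
    (L' := filtration F Λ (ramificationIndex F E)) (fun X => by
      simpa using hg.algebraMap_smul_mem_filtration_iff (k := 0) hϖ X)
  rw [relIndex_add_eq_pow (fun k => hg.filtration_antitone (by omega)) hg.relIndex_filtration,
    Module.finrank_linearMap, ← Module.finrank_mul_finrank F E V, hV, mul_one,
    finrank_eq hh hg hd] at h1
  refine Nat.pow_left_injective (ramificationIndex_pos (F := F) (E := E)).ne' ?_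
  change _ ^ _ = _ ^ _
  rw [h1, (card_residueField F E).1, ← pow_mul, ← pow_mul]
  congr 1
  ring

/-- The trace maps `𝔓^1` into `𝔭_F`, as the elements of `𝔓^1` act nilpotently modulo `𝔭_F`. -/
lemma trace_mem_primePow_one (hh : IsHermitianForm h ε) (hg : IsChainGenerator Λ v₀)
    (hd : IsSelfDual h Λ) {X : Module.End F V} (hX : X ∈ filtration F Λ 1) :
    LinearMap.trace F V X ∈ primePow F 1 := by
  obtain ⟨ϖ, hϖ⟩ := exists_hasOrd (E := F) 1
  have hpow (m : ℕ) : X ^ m ∈ filtration F Λ m := by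
    induction m with
    | zero => intro k v hv; simpa using hv
    | succ m ih => rw [pow_succ]; simpa using mul_mem_filtration ih hX
  refine (isLocalLattice_chain hh hg hd).trace_mem (fun u hu => ?_) hϖ
    (e := ramificationIndex F E) (fun u hu => ?_)
  · have := hX 0 u hu
    exact hg.antitone (by omega) this
  · have h1 := hpow (ramificationIndex F E) 0 u hu
    have h2 := (hϖ.algebraMap (E := E)).inv
    have h3 := (hg.smul_mem_chain_iff h2 _ _).2 h1
    rw [← map_inv₀, algebraMap_smul] at h3
    simpa using h3

end Chain

/-! ### Conjugation and orders -/

section Ramified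

variable {F E V : Type*} [Field F] [ValuativeRel F] [TopologicalSpace F]
  [IsNonarchimedeanLocalField F] [Field E] [ValuativeRel E] [TopologicalSpace E]
  [IsNonarchimedeanLocalField E] [Algebra F E] [ValuativeExtension F E]
  [AddCommGroup V] [Module F V] [Module E V] [IsScalarTower F E V] {c : F →+* F}
  {h : V →ₛₗ[c] V →ₗ[F] F} {ε : F} {Λ : ℤ → Submodule 𝒪[E] V} {v₀ : V}

lemma mem_primePow_succ {x : E} {k : ℤ} (hx : x ∈ primePow E k) (hx' : ¬ HasOrd x k) :
    x ∈ primePow E (k + 1) := by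
  by_contra h
  exact hx' (hasOrd_iff.2 ⟨hx, h⟩)

section
variable (hh : IsHermitianForm h ε) (hg : IsChainGenerator Λ v₀) (hd : IsSelfDual h Λ)
  (hconj : ∀ x : E, ∃ y, IsConj h x y) (hE : ∀ x ∈ fixedSubfield E h, ¬ IsUniformizer x)
include hh hg hd hE

/-- If the fixed field contains no uniformizer, conjugation is `-1` on `𝔭_E / 𝔭_E ^ 2`: the sum
of a uniformizer and its conjugate is fixed. -/
lemma IsConj.add_mem_of_hasOrd_one {x y : E} (H : IsConj h x y) (hx : HasOrd x 1) :
    y + x ∈ primePow E 2 := by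
  have hy := (H.hasOrd_iff hh hg hd).2 hx
  have h1 : y + x ∈ fixedSubfield E h := by
    have := (H.symm hh).add H
    rwa [add_comm x y] at this
  exact mem_primePow_succ (add_mem hy.mem hx.mem) fun h2 => hE _ h1 (isUniformizer_iff.2 h2)

include hconj

/-- Conjugation is the identity on `k_E`: compare its action on a uniformizer and on the product
of that uniformizer with a unit. -/
lemma IsConj.sub_mem_of_hasOrd_zero {x y : E} (H : IsConj h x y) (hx : HasOrd x 0) :
    y - x ∈ primePow E 1 := by
  obtain ⟨ϖ, hϖ⟩ := exists_hasOrd (E := E) 1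
  obtain ⟨ϖ', H'⟩ := hconj ϖ
  have hy := (H.hasOrd_iff hh hg hd).2 hx
  have h1 := (H.mul H').add_mem_of_hasOrd_one hh hg hd hE (by simpa using hx.mul hϖ)
  have h2 := mul_mem_primePow hy.mem (H'.add_mem_of_hasOrd_one hh hg hd hE hϖ)
  rw [zero_add] at h2
  have h3 : ϖ * (y - x) ∈ primePow E (1 + 1) := by
    have := sub_mem h2 h1
    rwa [show y * (ϖ' + ϖ) - (y * ϖ' + x * ϖ) = ϖ * (y - x) by ring] at this
  exact hϖ.mul_mem_iff.1 h3

/-- Norms of powers of a uniformizer are fixed elements of every even order. -/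
lemma exists_fixed_hasOrd (m : ℤ) : ∃ z : E, IsConj h z z ∧ HasOrd z (2 * m) := by
  obtain ⟨ϖ, hϖ⟩ := exists_hasOrd (E := E) 1
  obtain ⟨ϖ', H'⟩ := hconj ϖ
  have h1 : ϖ * ϖ' ∈ fixedSubfield E h := by
    have := H'.mul (H'.symm hh)
    rwa [mul_comm ϖ' ϖ] at this
  refine ⟨(ϖ * ϖ') ^ m, zpow_mem h1 m, ?_⟩
  have := (hϖ.mul ((H'.hasOrd_iff hh hg hd).2 hϖ)).zpow m
  rwa [show m * (1 + 1) = 2 * m by ring] at this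

lemma IsConj.sub_mem_of_even {x y : E} (H : IsConj h x y) {k : ℤ} (hx : HasOrd x k)
    (hk : Even k) : y - x ∈ primePow E (k + 1) := by
  obtain ⟨m, rfl⟩ := hk
  obtain ⟨z, hz, hz'⟩ := exists_fixed_hasOrd hh hg hd hconj hE m
  have hzi : IsConj h z⁻¹ z⁻¹ := (fixedSubfield E h).inv_mem hz
  have h1 := (H.mul hzi).sub_mem_of_hasOrd_zero hh hg hd hconj hE
    (by simpa [two_mul] using hx.mul hz'.inv)
  have h2 := mul_mem_primePow hz'.mem h1
  rw [← sub_mul, mul_comm z, inv_mul_cancel_right₀ hz'.ne_zero, two_mul] at h2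
  exact h2

variable (hp : ringChar 𝓀[E] ≠ 2)
include hp

omit [IsScalarTower F E V] [Algebra F E] [ValuativeExtension F E] hE hconj hh hg hd in
lemma two_mul_mem_iff {x : E} {k : ℤ} : 2 * x ∈ primePow E k ↔ x ∈ primePow E k := by
  have h2 : HasOrd (2 : E) 0 := by
    have h0 : (2 : E) ∈ primePow E 0 := mem_primePow_zero.2 (2 : 𝒪[E]).2
    rw [← res_ne_zero_iff h0]
    have : res (2 : E) = 2 := by
      rw [← map_ofNat (IsLocalRing.residue 𝒪[E]) 2, ← res_coe]; rfl
    rw [this]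
    exact Ring.two_ne_zero hp
  simpa using h2.mul_mem_iff (y := x) (l := k)

/-- Skew elements have odd order. -/
lemma odd_of_isConj_neg {x : E} (H : IsConj h x (-x)) {k : ℤ} (hx : HasOrd x k) : Odd k := by
  by_contra hk
  have h1 := H.sub_mem_of_even hh hg hd hconj hE hx (Int.not_odd_iff_even.1 hk)
  have h2 : 2 * x ∈ primePow E (k + 1) := by
    have := neg_mem h1
    convert this using 1
    ring
  exact (hasOrd_iff.1 hx).2 ((two_mul_mem_iff hp).1 h2)

/-- If `F` contains an element of odd order which is skew up to higher order, the ramification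
index is odd. -/
lemma odd_ramificationIndex {π : F} (hπ : HasOrd π 1) (hπ' : c π + π ∈ primePow F 2) :
    Odd (ramificationIndex F E) := by
  set e := ramificationIndex F E with he
  by_contra hodd
  have hord : HasOrd (algebraMap F E π) e := by simpa using hπ.algebraMap (E := E)
  have h1 := (IsConj.algebraMap h π).sub_mem_of_even hh hg hd hconj hE hord
    (by exact_mod_cast Nat.not_odd_iff_even.1 hodd)
  have hepos : 0 < e := ramificationIndex_pos
  have h2 : algebraMap F E (c π + π) ∈ primePow E (e + 1) := by
    by_cases h0 : c π + π = 0
    · rw [h0, map_zero]; exact zero_mem _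
    obtain ⟨k, hk⟩ := exists_hasOrd_of_ne_zero h0
    have hk2 : 2 ≤ k := by
      by_contra hlt
      exact (hasOrd_iff.1 hk).2 (primePow_antitone (by omega) hπ')
    refine primePow_antitone ?_ (hk.algebraMap (E := E)).mem
    rw [← he]
    have : (1 : ℤ) ≤ e := by exact_mod_cast hepos
    nlinarith
  have h3 : 2 * algebraMap F E π ∈ primePow E (e + 1) := by
    have := sub_mem h2 h1
    rw [map_add] at this
    convert this using 1
    ring
  exact (hasOrd_iff.1 hord).2 ((two_mul_mem_iff hp).1 h3)

end

/-- If `F / F₀` is quadratic and ramified with non-trivial automorphism `c`, then `c` is `-1` on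
`𝔭_F / 𝔭_F ^ 2`, since elements of `F₀` have even order. -/
lemma map_add_mem {F₀ : Type*} [Field F₀] [ValuativeRel F₀] [TopologicalSpace F₀]
    [IsNonarchimedeanLocalField F₀] [Algebra F₀ F] [ValuativeExtension F₀ F]
    (hquad : Module.finrank F₀ F = 2) (hram : ramificationIndex F₀ F = 2)
    {σ : F ≃ₐ[F₀] F} (hσ : σ ≠ AlgEquiv.refl) (hinv : ∀ x, σ (σ x) = x) {π : F}
    (hπ : π ∈ primePow F 1) (hπ' : σ π ∈ primePow F 1) : σ π + π ∈ primePow F 2 := by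
  have : FiniteDimensional F₀ F := Module.finite_of_finrank_pos (by omega)
  have hfix (x : F) (hx : σ x = x) : ∃ y, algebraMap F₀ F y = x := by
    by_contra hne
    have hprime : (Module.finrank F₀ F).Prime := hquad ▸ Nat.prime_two
    have hsimple := IntermediateField.isSimpleOrder_of_finrank_prime F₀ F hprime
    have htop : IntermediateField.adjoin F₀ {x} = ⊤ := by
      refine (eq_bot_or_eq_top _).resolve_left fun hbot => hne ?_
      have hx : x ∈ IntermediateField.adjoin F₀ {x} := IntermediateField.mem_adjoin_simple_self _ _
      rw [hbot] at hx
      exact IntermediateField.mem_bot.1 hx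
    refine hσ (AlgEquiv.ext fun y => ?_)
    have hle : IntermediateField.adjoin F₀ {x} ≤
        IntermediateField.fixedField (Subgroup.zpowers σ) := by
      rw [IntermediateField.adjoin_simple_le_iff, IntermediateField.mem_fixedField_iff]
      intro g hg
      obtain ⟨n, rfl⟩ := Subgroup.mem_zpowers_iff.1 hg
      have : σ ∈ MulAction.stabilizer (F ≃ₐ[F₀] F) x := hx
      exact zpow_mem this n
    rw [htop] at hle
    have := hle (IntermediateField.mem_top (x := y))
    rw [IntermediateField.mem_fixedField_iff] at this
    exact this σ (Subgroup.mem_zpowers σ)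
  obtain ⟨y, hy⟩ := hfix (σ π + π) (by rw [map_add, hinv, add_comm])
  have hmem := add_mem hπ' hπ
  rw [← hy] at hmem ⊢
  by_cases h0 : y = 0
  · rw [h0, map_zero]; exact zero_mem _
  obtain ⟨k, hk⟩ := exists_hasOrd_of_ne_zero h0
  have hk1 : 1 ≤ k := by
    by_contra hlt
    exact (hasOrd_iff.1 hk).2 (primePow_antitone (by omega) (algebraMap_mem_primePow_one.1 hmem))
  refine primePow_antitone ?_ (hk.algebraMap (E := F)).mem
  rw [hram]
  push_cast
  omega

end Ramified

/-! ### Centralizers of the approximating elements -/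

section Strata

variable {F E V : Type*} [Field F] [ValuativeRel F] [TopologicalSpace F]
  [IsNonarchimedeanLocalField F] [Field E] [ValuativeRel E] [TopologicalSpace E]
  [IsNonarchimedeanLocalField E] [Algebra F E] [ValuativeExtension F E]
  [AddCommGroup V] [Module F V] [Module E V] [IsScalarTower F E V] {c : F →+* F}
  {h : V →ₛₗ[c] V →ₗ[F] F} {ε : F} {v₀ : V}

namespace SkewStratum

variable (s : SkewStratum E h)

/-- `𝔓_{E_j}^k`, the elements of `𝔓^k` which commute with `γ_j`. -/
abbrev level (j : ℕ) (k : ℤ) : AddSubgroup (Module.End F V) :=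
  centralizerFiltration s.Λ (emb F V (s.γ j)) k

/-- The difference `c_j = γ_j - γ_{j+1}`. -/
def diff (j : ℕ) : E := s.γ j - s.γ (j + 1)

variable {s}

lemma isConj_γ {j : ℕ} (hj : j ≤ s.len) : IsConj h (s.γ j) (-s.γ j) := fun v w => by
  rw [s.skew j hj, neg_smul, map_neg]

lemma isConj_diff {j : ℕ} (hj : j < s.len) : IsConj h (s.diff j) (-s.diff j) := by
  have := (isConj_γ hj.le).sub (isConj_γ (s := s) (j := j + 1) hj)
  rwa [show -s.γ j - -s.γ (j + 1) = -s.diff j by rw [diff]; ring] at this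

/-- The difference `c_j` has order `- r_j`, since the derived stratum is equivalent to a simple
one. -/
lemma hasOrd_diff (hg : IsChainGenerator s.Λ v₀) {j : ℕ} (hj : j < s.len) :
    HasOrd (s.diff j) (-s.r j) := by
  refine hasOrd_iff.2 ⟨hg.emb_mem_filtration.1 (s.equivalent j hj), fun hc => ?_⟩
  obtain ⟨δ, hδ, hδ'⟩ := s.derived j hj
  refine hδ.notMem ?_
  have h1 := hg.emb_mem_filtration (F := F).2 hc
  rw [show -(s.r j - 1) = -s.r j + 1 by ring] at hδ'
  have := sub_mem h1 hδ'
  rwa [diff, sub_sub_cancel] at this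

lemma le_of_mem_criticalSet {j : ℕ} (hj : j < s.len) {k : ℤ}
    (hk : k ∈ criticalSet s.Λ 0 (emb F V (s.γ j))) : k ≤ -s.r j := by
  by_cases hj' : j + 1 < s.len
  · exact (s.critical j hj').2 hk
  · exact s.critical_last j (by omega) k hk

lemma commute_succ {j : ℕ} (hj : j < s.len) {X : Module.End F V}
    (hX : emb F V (s.γ j) * X = X * emb F V (s.γ j)) :
    emb F V (s.γ (j + 1)) * X = X * emb F V (s.γ (j + 1)) :=
  emb_commute_of_mem_adjoin (s.tower j hj) hX

lemma level_le_succ {j : ℕ} (hj : j < s.len) (k : ℤ) : s.level j k ≤ s.level (j + 1) k := by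
  intro X hX
  rw [mem_centralizerFiltration] at hX ⊢
  exact ⟨hX.1, commute_succ hj hX.2⟩

lemma level_antitone (hg : IsChainGenerator s.Λ v₀) (j : ℕ) {k l : ℤ} (hkl : k ≤ l) :
    s.level j l ≤ s.level j k := by
  intro X hX
  rw [mem_centralizerFiltration] at hX ⊢
  exact ⟨hg.filtration_antitone hkl hX.1, hX.2⟩

lemma mem_level_len {X : Module.End F V} {k : ℤ} :
    X ∈ s.level s.len k ↔ X ∈ filtration F s.Λ k := by
  rw [mem_centralizerFiltration, s.γ_len]
  have : emb F V (0 : E) = 0 := map_zero (Algebra.lsmul F F V)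
  simp [this]

lemma emb_mul_mem_level (hg : IsChainGenerator s.Λ v₀) {x : E} {a : ℤ} (hx : x ∈ primePow E a)
    {j : ℕ} {k : ℤ} {X : Module.End F V} (hX : X ∈ s.level j k) :
    emb F V x * X ∈ s.level j (a + k) := by
  rw [mem_centralizerFiltration] at hX ⊢
  refine ⟨mul_mem_filtration (hg.emb_mem_filtration.2 hx) hX.1, ?_⟩
  rw [← mul_assoc, emb_commute, mul_assoc, hX.2, mul_assoc]

lemma mul_emb_mem_level (hg : IsChainGenerator s.Λ v₀) {x : E} {a : ℤ} (hx : x ∈ primePow E a)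
    {j : ℕ} {k : ℤ} {X : Module.End F V} (hX : X ∈ s.level j k) :
    X * emb F V x ∈ s.level j (k + a) := by
  rw [mem_centralizerFiltration] at hX ⊢
  refine ⟨mul_mem_filtration hX.1 (hg.emb_mem_filtration.2 hx), ?_⟩
  rw [← mul_assoc, hX.2, mul_assoc, emb_commute, mul_assoc]

lemma emb_mul_mem_level_iff (hg : IsChainGenerator s.Λ v₀) {x : E} {a : ℤ} (hx : HasOrd x a)
    {j : ℕ} {k : ℤ} {X : Module.End F V} :
    emb F V x * X ∈ s.level j (a + k) ↔ X ∈ s.level j k := by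
  refine ⟨fun hX => ?_, emb_mul_mem_level hg hx.mem⟩
  have := emb_mul_mem_level hg hx.inv.mem hX
  rwa [← mul_assoc, emb_inv_mul hx.ne_zero, one_mul, neg_add_cancel_left] at this

lemma commutator_eq {j : ℕ} {X : Module.End F V} {k : ℤ} (hX : X ∈ s.level (j + 1) k) :
    emb F V (s.diff j) * X - X * emb F V (s.diff j) =
      emb F V (s.γ j) * X - X * emb F V (s.γ j) := by
  rw [mem_centralizerFiltration] at hX
  rw [diff, emb_sub, sub_mul, mul_sub, hX.2]
  abel

lemma commute_diff {j : ℕ} (hj : j < s.len) {X : Module.End F V} {k : ℤ} (hX : X ∈ s.level j k) :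
    emb F V (s.diff j) * X = X * emb F V (s.diff j) := by
  rw [← sub_eq_zero, commutator_eq (level_le_succ hj k hX), sub_eq_zero]
  exact (mem_centralizerFiltration.1 hX).2

/-- The defining property of the critical exponent `- r_j`: an element of the centralizer of
`γ_{j+1}` which commutes with `c_j` to one order more than expected is, up to elements of higher
order, in the centralizer of `γ_j`. -/
lemma mem_sup_of_commutator_mem (hg : IsChainGenerator s.Λ v₀) {j : ℕ} (hj : j < s.len) {m : ℤ}
    {X : Module.End F V} (hX : X ∈ s.level (j + 1) m)
    (hc : emb F V (s.diff j) * X - X * emb F V (s.diff j) ∈ filtration F s.Λ (m - s.r j + 1)) :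
    X ∈ s.level j m ⊔ s.level (j + 1) (m + 1) := by
  obtain ⟨z, hz⟩ := exists_hasOrd (E := E) m
  set Y := emb F V z⁻¹ * X with hY
  have hXY : X = emb F V z * Y := by rw [hY, ← mul_assoc, emb_mul_inv hz.ne_zero, one_mul]
  have hYm : Y ∈ s.level (j + 1) 0 := by
    have := emb_mul_mem_level hg hz.inv.mem hX
    rwa [neg_add_cancel] at this
  clear_value Y
  have hcY : emb F V (s.γ j) * Y - Y * emb F V (s.γ j) ∈ filtration F s.Λ (-s.r j + 1) := by
    rw [← commutator_eq hYm, ← hg.emb_mul_mem_iff hz]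
    convert hc using 1
    · rw [show m + (-s.r j + 1) = m - s.r j + 1 by ring]
    · rw [hXY, mul_sub, ← mul_assoc, emb_commute, mul_assoc, mul_assoc]
  have hnot : -s.r j + 1 ∉ criticalSet s.Λ 0 (emb F V (s.γ j)) := fun hmem => by
    have := le_of_mem_criticalSet hj hmem
    omega
  rw [criticalSet, Set.mem_ofPred_eq, not_not] at hnot
  have hYm' := mem_centralizerFiltration.1 hYm
  have := hnot Y (mem_centralizerFiltration.2 ⟨hYm'.1, by simp⟩) hcY
  obtain ⟨y, hy, w, hw, hyw⟩ := AddSubgroup.mem_sup.1 this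
  have hy' : y ∈ s.level j 0 := by
    rw [AddSubgroup.mem_inf] at hy
    refine mem_centralizerFiltration.2 ⟨(mem_centralizerFiltration.1 hy.1).1, ?_⟩
    have := hy.2
    rw [Subring.mem_toAddSubgroup, Subring.mem_centralizer_iff] at this
    simpa using this
  have hw' : w ∈ s.level (j + 1) 1 := by
    refine mem_centralizerFiltration.2 ⟨(mem_centralizerFiltration.1 hw).1, ?_⟩
    have h1 := commute_succ hj (mem_centralizerFiltration.1 hy').2
    rw [show w = Y - y by rw [← hyw]; abel, mul_sub, sub_mul, hYm'.2, h1]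
  rw [hXY, ← hyw, mul_add]
  refine AddSubgroup.add_mem_sup ?_ (emb_mul_mem_level hg hz.mem hw')
  have := emb_mul_mem_level hg hz.mem hy'
  rwa [add_zero] at this

section Nondegenerate

variable (hh : IsHermitianForm h ε) (hg : IsChainGenerator s.Λ v₀) [FiniteDimensional F V]
  (htame : (ramificationIndex F E).Coprime (ringChar 𝓀[F]))
include hh hg htame

/-- Averaging over the powers of `c_j` moves an element of the centralizer of `γ_{j+1}` into the
centralizer of `γ_j` up to higher order, because in the tame case a power of `c_j` of order prime
to `p` is central up to a principal unit. -/
lemma trace_mem_of_forall_level {j : ℕ} (hj : j < s.len) {Z : Module.End F V}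
    (hZ : Z ∈ s.level j 0)
    (H : ∀ Y ∈ s.level j 0, LinearMap.trace F V (Z * Y) ∈ primePow F 1)
    {X : Module.End F V} (hX : X ∈ s.level (j + 1) 0) :
    LinearMap.trace F V (Z * X) ∈ primePow F 1 := by
  have hd := s.isSelfDual
  have hc := hasOrd_diff hg hj
  obtain ⟨N, a, u, hN, ha, hu, hpow⟩ := exists_pow_eq htame hc
  set x := s.diff j
  have hx0 : x ≠ 0 := hc.ne_zero
  -- The conjugates of `X` by the powers of `c_j`; their sum over `i < N` commutes with `c_j` up to
  -- higher order, since conjugation by `c_j` shifts the index and `T N` is close to `T 0 = X`.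
  let T : ℕ → Module.End F V := fun i => emb F V (x ^ i) * X * emb F V (x ^ i)⁻¹
  have hT (i : ℕ) : T i ∈ s.level (j + 1) 0 := by
    have := mul_emb_mem_level hg (hc.pow i).inv.mem (emb_mul_mem_level hg (hc.pow i).mem hX)
    simpa using this
  have hstep (i : ℕ) : emb F V x * T i = T (i + 1) * emb F V x := by
    simp only [T]
    rw [pow_succ', mul_inv_rev, emb_mul x, emb_mul _ x⁻¹]
    simp only [mul_assoc]
    rw [emb_inv_mul hx0, mul_one]
  have hu0 : HasOrd u 0 := hasOrd_one.of_sub_mem (by simpa using hu)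
  have hlast : T N - X ∈ filtration F s.Λ 1 := by
    have h1 : T N = emb F V u * X * emb F V u⁻¹ := by
      have haE : algebraMap F E a ≠ 0 := by simpa using ha
      have h2 : emb F V (x ^ N)⁻¹ = emb F V (algebraMap F E a)⁻¹ * emb F V u⁻¹ := by
        rw [hpow, mul_inv, emb_mul]
      simp only [T]
      rw [h2, hpow, mul_comm, emb_mul, emb_algebraMap, mul_assoc (emb F V u),
        Algebra.commutes a X, mul_assoc, mul_assoc, mul_assoc,
        ← mul_assoc (algebraMap F (Module.End F V) a), ← emb_algebraMap (E := E),
        emb_mul_inv haE, one_mul]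
    have h2 : T N - X = (emb F V (u - 1) * X - X * emb F V (u - 1)) * emb F V u⁻¹ := by
      have h3 := emb_mul_inv (F := F) (V := V) hu0.ne_zero
      rw [h1, emb_sub, emb_one]
      simp only [sub_mul, mul_sub, one_mul, mul_one, mul_assoc, h3]
      abel
    have hX0 := (mem_centralizerFiltration.1 hX).1
    have hu1 := hg.emb_mem_filtration (F := F).2 hu
    have h4 : emb F V (u - 1) * X - X * emb F V (u - 1) ∈ filtration F s.Λ 1 :=
      sub_mem (by simpa using mul_mem_filtration hu1 hX0)
        (by simpa using mul_mem_filtration hX0 hu1)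
    rw [h2]
    simpa using mul_mem_filtration h4 (hg.emb_mem_filtration.2 hu0.inv.mem)
  have hsum : ∑ i ∈ Finset.range N, T i ∈ s.level (j + 1) 0 := sum_mem fun i _ => hT i
  have hcomm : emb F V x * (∑ i ∈ Finset.range N, T i) - (∑ i ∈ Finset.range N, T i) * emb F V x ∈
      filtration F s.Λ (0 - s.r j + 1) := by
    have h5 : emb F V x * (∑ i ∈ Finset.range N, T i) - (∑ i ∈ Finset.range N, T i) * emb F V x =
        (T N - X) * emb F V x := by
      have hT0 : T 0 = X := by simp [T, emb_one]
      rw [← hT0, ← Finset.sum_range_sub, Finset.mul_sum, Finset.sum_mul, Finset.sum_mul,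
        ← Finset.sum_sub_distrib]
      exact Finset.sum_congr rfl fun i _ => by rw [hstep, sub_mul]
    rw [h5, show 0 - s.r j + 1 = 1 + -s.r j by ring]
    exact mul_mem_filtration hlast (hg.emb_mem_filtration.2 hc.mem)
  obtain ⟨y, hy, w, hw, hyw⟩ := AddSubgroup.mem_sup.1 (mem_sup_of_commutator_mem hg hj hsum hcomm)
  have htr : LinearMap.trace F V (Z * ∑ i ∈ Finset.range N, T i) ∈ primePow F 1 := by
    rw [← hyw, mul_add, map_add]
    refine add_mem (H y hy) (trace_mem_primePow_one hh hg hd ?_)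
    simpa using mul_mem_filtration (mem_centralizerFiltration.1 hZ).1
      (mem_centralizerFiltration.1 hw).1
  have hZc (i : ℕ) : emb F V (x ^ i)⁻¹ * Z = Z * emb F V (x ^ i)⁻¹ := by
    refine emb_commute_of_mem_adjoin (x := (x ^ i)⁻¹) (Algebra.self_mem_adjoin_singleton F _) ?_
    have h1 : emb F V (x ^ i) * Z = Z * emb F V (x ^ i) :=
      emb_commute_of_mem_adjoin (pow_mem (Algebra.self_mem_adjoin_singleton F _) i)
        (commute_diff hj hZ)
    have hne := pow_ne_zero i hx0
    calc emb F V (x ^ i)⁻¹ * Z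
        = emb F V (x ^ i)⁻¹ * (Z * (emb F V (x ^ i) * emb F V (x ^ i)⁻¹)) := by
          rw [emb_mul_inv hne, mul_one]
      _ = (emb F V (x ^ i)⁻¹ * emb F V (x ^ i)) * Z * emb F V (x ^ i)⁻¹ := by
          rw [← mul_assoc Z, ← h1]; simp only [mul_assoc]
      _ = _ := by rw [emb_inv_mul hne, one_mul]
  -- `Z` commutes with `c_j`, so that all `N` conjugates contribute equally, and `N` is a unit.
  have hterm (i : ℕ) : LinearMap.trace F V (Z * T i) = LinearMap.trace F V (Z * X) := by
    simp only [T]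
    rw [← mul_assoc, LinearMap.trace_mul_comm, ← mul_assoc, ← mul_assoc, hZc, mul_assoc Z,
      emb_inv_mul (pow_ne_zero i hx0), mul_one]
  rw [Finset.mul_sum, map_sum, Finset.sum_congr rfl fun i _ => hterm i, Finset.sum_const,
    Finset.card_range, nsmul_eq_mul] at htr
  exact hN.mul_mem_iff.1 (by simpa using htr)

/-- The trace pairing on the centralizer of `γ_j` is non-degenerate modulo `𝔭_F`, by descending
induction on `j` from the case `γ = 0`. -/
lemma mem_filtration_one_of_trace {j : ℕ} (hj : j ≤ s.len) {Z : Module.End F V}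
    (hZ : Z ∈ s.level j 0)
    (H : ∀ Y ∈ s.level j 0, LinearMap.trace F V (Z * Y) ∈ primePow F 1) :
    Z ∈ filtration F s.Λ 1 := by
  induction hj using Nat.decreasingInduction with
  | self =>
    have := mem_filtration_of_trace hh hg s.isSelfDual (Z := Z) (m := 0)
      fun Y hY => H Y (mem_level_len.2 hY)
    simpa using this
  | of_succ k hk ih =>
    exact ih (level_le_succ hk 0 hZ) fun Y hY => trace_mem_of_forall_level hh hg htame hk hZ H hY

/-- The shift of `mem_filtration_one_of_trace` to arbitrary steps of the filtration. -/
lemma mem_level_succ_of_trace {j : ℕ} (hj : j ≤ s.len) {m : ℤ} {Z : Module.End F V}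
    (hZ : Z ∈ s.level j m)
    (H : ∀ Y ∈ s.level j (-m), LinearMap.trace F V (Z * Y) ∈ primePow F 1) :
    Z ∈ s.level j (m + 1) := by
  obtain ⟨z, hz⟩ := exists_hasOrd (E := E) (-m)
  have h0 : emb F V z * Z ∈ s.level j 0 := by
    simpa using emb_mul_mem_level hg hz.mem hZ
  have h1 := mem_filtration_one_of_trace hh hg htame hj h0 fun Y hY => by
    have := H (Y * emb F V z) (by simpa using mul_emb_mem_level hg hz.mem hY)
    rwa [← mul_assoc, LinearMap.trace_mul_comm, ← mul_assoc] at this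
  refine mem_centralizerFiltration.2 ⟨?_, (mem_centralizerFiltration.1 hZ).2⟩
  rw [← hg.emb_mul_mem_iff hz]
  simpa using h1

end Nondegenerate

end SkewStratum

end Strata

/-! ### The pairing on the summands -/

section Pairing

variable {F E V : Type*} [Field F] [ValuativeRel F] [TopologicalSpace F]
  [IsNonarchimedeanLocalField F] [Field E] [ValuativeRel E] [TopologicalSpace E]
  [IsNonarchimedeanLocalField E] [Algebra F E] [ValuativeExtension F E]
  [AddCommGroup V] [Module F V] [Module E V] [IsScalarTower F E V] {c : F →+* F}
  {h : V →ₛₗ[c] V →ₗ[F] F} {ε : F} {v₀ : V}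

lemma IsHermitianForm.adjoint_neg [FiniteDimensional F V] [Nontrivial V]
    (hh : IsHermitianForm h ε) (X : Module.End F V) : adjoint h (-X) = -adjoint h X :=
  hh.eq_adjoint fun v w => by
    simp only [LinearMap.neg_apply, map_neg, hh.apply_adjoint]

namespace SkewStratum

variable (s : SkewStratum E h)

/-- The sesquilinear form `tr (ϖ (c_j X - X c_j) (α Y))` whose diagonal is `quadraticForm`. -/
def pairing (ϖ : E) (j : ℕ) (X Y : Module.End F V) : F :=
  LinearMap.trace F V (emb F V ϖ *
    (emb F V (s.diff j) * X - X * emb F V (s.diff j)) * alpha h Y)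

variable {s}

lemma pairing_self (ϖ : E) (j : ℕ) (X : Module.End F V) :
    s.pairing ϖ j X X = s.quadraticForm ϖ j X := rfl

lemma pairing_add_left (ϖ : E) (j : ℕ) (X X' Y : Module.End F V) :
    s.pairing ϖ j (X + X') Y = s.pairing ϖ j X Y + s.pairing ϖ j X' Y := by
  simp only [pairing]
  rw [← map_add, ← add_mul, ← mul_add, mul_add, add_mul]
  congr 4
  abel

lemma pairing_emb_mul_left (ϖ x : E) (j : ℕ) (X Y : Module.End F V) :
    s.pairing ϖ j (emb F V x * X) Y = s.pairing (ϖ * x) j X Y := by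
  simp only [pairing]
  rw [emb_mul, mul_assoc (emb F V ϖ) (emb F V x), mul_sub (emb F V x), ← mul_assoc (emb F V x),
    emb_commute x, ← mul_assoc, ← mul_assoc]

lemma pairing_algebraMap_mul (ϖ : E) (a : F) (j : ℕ) (X Y : Module.End F V) :
    s.pairing (ϖ * algebraMap F E a) j X Y = a * s.pairing ϖ j X Y := by
  simp only [pairing]
  rw [mul_comm, emb_mul, emb_algebraMap, mul_assoc, mul_assoc, ← Algebra.smul_def, map_smul,
    smul_eq_mul, mul_assoc]

lemma mem_numerator {j : ℕ} {X : Module.End F V} :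
    X ∈ s.numerator j ↔ X ∈ s.level (j + 1) (s.r j / 2) := by
  rw [numerator, show -1 + (s.r j / 2 + 1) = s.r j / 2 by ring]

section
variable (hh : IsHermitianForm h ε) (hg : IsChainGenerator s.Λ v₀) [FiniteDimensional F V]
  [Nontrivial V]
include hh hg

lemma trace_mem_primePow_zero {X : Module.End F V} (hX : X ∈ filtration F s.Λ 0) :
    LinearMap.trace F V X ∈ primePow F 0 := by
  obtain ⟨π, hπ⟩ := exists_hasOrd (E := F) 1
  have hpos : 0 < ramificationIndex F E := ramificationIndex_pos
  have h1 : π • X ∈ filtration F s.Λ (ramificationIndex F E * 1 + 0) :=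
    (hg.algebraMap_smul_mem_filtration_iff hπ X).2 hX
  have h2 := trace_mem_primePow_one hh hg s.isSelfDual
    (hg.filtration_antitone (k := 1) (by omega) h1)
  rw [map_smul, smul_eq_mul] at h2
  exact hπ.mul_mem_iff.1 (by simpa using h2)

lemma alpha_mem_level {j : ℕ} (hj : j ≤ s.len) {k : ℤ} {X : Module.End F V}
    (hX : X ∈ s.level j k) : alpha h X ∈ s.level j k := by
  rw [mem_centralizerFiltration] at hX
  refine neg_mem (mem_centralizerFiltration.2
    ⟨hh.adjoint_mem_filtration hg s.isSelfDual hX.1, ?_⟩)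
  have hγ := (isConj_γ hj).adjoint_emb hh
  have h0 : emb F V (-s.γ j) = -emb F V (s.γ j) := map_neg (Algebra.lsmul F F V) _
  have := congrArg (adjoint h) hX.2
  rw [hh.adjoint_mul, hh.adjoint_mul, hγ, h0, mul_neg, neg_mul, neg_inj] at this
  exact this.symm

omit [Nontrivial V] hh [FiniteDimensional F V] in
lemma commutator_mem {j : ℕ} (hj : j < s.len) {k : ℤ} {X : Module.End F V}
    (hX : X ∈ s.level (j + 1) k) :
    emb F V (s.diff j) * X - X * emb F V (s.diff j) ∈ s.level (j + 1) (k - s.r j) := by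
  have hc := (hasOrd_diff hg hj).mem
  refine sub_mem ?_ ?_
  · have := emb_mul_mem_level hg hc hX
    rwa [neg_add_eq_sub] at this
  · exact mul_emb_mem_level hg hc hX

/-- The operator whose trace is the pairing lies in the step of the filtration obtained by adding
up the degrees of its factors. -/
lemma pairing_argument_mem {j : ℕ} (hj : j < s.len) {ϖ : E} {a k l : ℤ} (hϖ : ϖ ∈ primePow E a)
    {X Y : Module.End F V} (hX : X ∈ s.level (j + 1) k) (hY : Y ∈ s.level (j + 1) l) :
    emb F V ϖ * (emb F V (s.diff j) * X - X * emb F V (s.diff j)) * alpha h Y ∈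
      filtration F s.Λ (a + (k - s.r j) + l) :=
  mul_mem_filtration (mul_mem_filtration (hg.emb_mem_filtration.2 hϖ)
    (mem_centralizerFiltration.1 (commutator_mem hg hj hX)).1)
    (mem_centralizerFiltration.1 (alpha_mem_level hh hg hj hY)).1

variable (hconj : ∀ x : E, ∃ y, IsConj h x y) (hE : ∀ x ∈ fixedSubfield E h, ¬ IsUniformizer x)
  (hp : ringChar 𝓀[E] ≠ 2)

include hconj hE hp in
omit [FiniteDimensional F V] [Nontrivial V] in
lemma odd_r {j : ℕ} (hj : j < s.len) : Odd (s.r j) := by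
  have := odd_of_isConj_neg hh hg s.isSelfDual hconj hE hp (isConj_diff hj) (hasOrd_diff hg hj)
  simpa using this

variable {j : ℕ} (hj : j < s.len) (hr : Odd (s.r j)) {ϖ : E} (hϖ : ϖ ∈ primePow E 1)

omit [FiniteDimensional F V] [Nontrivial V] hh hg in
include hr in
/-- As `r_j` is odd, `⌈r_j/2⌉ = ⌊r_j/2⌋ + 1`. -/
lemma mem_denominator {X : Module.End F V} : X ∈ s.denominator j ↔
    X ∈ s.level j (s.r j / 2) ⊔ s.level (j + 1) (s.r j / 2 + 1) := by
  obtain ⟨m, hm⟩ := hr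
  rw [denominator, show -1 + (s.r j / 2 + 1) = s.r j / 2 by ring,
    show (s.r j + 1) / 2 = s.r j / 2 + 1 by omega]

include hj hr hϖ

/-- The pairing is integral on the numerator, the total degree of its argument being
`1 - r_j + 2 ⌊r_j/2⌋ = 0`. -/
lemma pairing_mem_zero {X Y : Module.End F V} (hX : X ∈ s.numerator j)
    (hY : Y ∈ s.numerator j) : s.pairing ϖ j X Y ∈ primePow F 0 := by
  rw [mem_numerator] at hX hY
  obtain ⟨m, hm⟩ := hr
  refine trace_mem_primePow_zero hh hg ?_
  have := pairing_argument_mem hh hg hj hϖ hX hY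
  rwa [show 1 + (s.r j / 2 - s.r j) + s.r j / 2 = 0 by omega] at this

lemma pairing_mem_one_of_mem_denominator {X Y : Module.End F V} (hX : X ∈ s.denominator j)
    (hY : Y ∈ s.numerator j) : s.pairing ϖ j X Y ∈ primePow F 1 := by
  rw [mem_denominator hr] at hX
  rw [mem_numerator] at hY
  obtain ⟨m, hm⟩ := hr
  obtain ⟨y, hy, w, hw, rfl⟩ := AddSubgroup.mem_sup.1 hX
  rw [pairing_add_left]
  have h1 : s.pairing ϖ j y Y = 0 := by
    rw [pairing, commute_diff hj hy]
    simp
  rw [h1, zero_add]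
  refine trace_mem_primePow_one hh hg s.isSelfDual ?_
  have := pairing_argument_mem hh hg hj hϖ hw hY
  rwa [show 1 + (s.r j / 2 + 1 - s.r j) + s.r j / 2 = 1 by omega] at this

include hconj hE

omit [FiniteDimensional F V] [Nontrivial V] hj hr hϖ in
lemma map_sub_mem_primePow_one {a : F} (ha : a ∈ primePow F 0) : c a - a ∈ primePow F 1 := by
  by_cases h0 : HasOrd a 0
  · have h1 := (IsConj.algebraMap h a).sub_mem_of_hasOrd_zero hh hg s.isSelfDual hconj hE
      (by simpa using h0.algebraMap (E := E))
    rwa [← map_sub, algebraMap_mem_primePow_one] at h1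
  · have h1 := mem_primePow_succ ha h0
    rw [zero_add] at h1
    exact sub_mem ((map_mem_primePow_one_iff (E := E) hh hg s.isSelfDual).2 h1) h1

/-- The pairing is symmetric modulo `𝔭_F`, since taking adjoints inverts the sign of both `c_j`
and, up to higher order, of `ϖ`. -/
lemma pairing_symm {X Y : Module.End F V} (hX : X ∈ s.numerator j) (hY : Y ∈ s.numerator j) :
    s.pairing ϖ j X Y - s.pairing ϖ j Y X ∈ primePow F 1 := by
  have h0 := pairing_mem_zero hh hg hj hr hϖ hX hY
  have h1 := map_sub_mem_primePow_one hh hg hconj hE h0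
  obtain ⟨ϖ', hϖ'⟩ := hconj ϖ
  have h2 : ϖ' + ϖ ∈ primePow E 2 := by
    by_cases hord : HasOrd ϖ 1
    · exact hϖ'.add_mem_of_hasOrd_one hh hg s.isSelfDual hE hord
    · have := mem_primePow_succ hϖ hord
      exact add_mem ((hϖ'.mem_primePow_iff hh hg s.isSelfDual).2 this) this
  rw [mem_numerator] at hX hY
  obtain ⟨m, hm⟩ := hr
  set x := s.diff j with hx
  have hxn : emb F V (-x) = -emb F V x := map_neg (Algebra.lsmul F F V) _
  have h3 : c (s.pairing ϖ j X Y) = LinearMap.trace F V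
      (-(Y * ((emb F V x * adjoint h X - adjoint h X * emb F V x) * emb F V ϖ'))) := by
    rw [pairing, ← hh.trace_adjoint]
    congr 1
    rw [hh.adjoint_mul, hh.adjoint_mul, hh.adjoint_sub, hh.adjoint_mul, hh.adjoint_mul,
      (isConj_diff hj).adjoint_emb hh, hϖ'.adjoint_emb hh, hxn, alpha]
    rw [hh.adjoint_neg, hh.adjoint_adjoint]
    noncomm_ring
  have h4 : s.pairing ϖ j Y X = LinearMap.trace F V
      (Y * ((emb F V x * adjoint h X - adjoint h X * emb F V x) * emb F V ϖ)) := by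
    have e1 : LinearMap.trace F V (emb F V ϖ * emb F V x * Y * adjoint h X) =
        LinearMap.trace F V (Y * adjoint h X * emb F V x * emb F V ϖ) := by
      rw [mul_assoc, LinearMap.trace_mul_comm, emb_commute]
      simp only [mul_assoc]
    have e2 : LinearMap.trace F V (emb F V ϖ * (Y * emb F V x * adjoint h X)) =
        LinearMap.trace F V (Y * emb F V x * adjoint h X * emb F V ϖ) :=
      LinearMap.trace_mul_comm F _ _
    rw [pairing, alpha, ← hx]
    have e3 : emb F V ϖ * (emb F V x * Y - Y * emb F V x) * -adjoint h X =
        emb F V ϖ * (Y * emb F V x * adjoint h X) - emb F V ϖ * emb F V x * Y * adjoint h X := by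
      noncomm_ring
    rw [e3, map_sub, e1, e2, ← map_sub]
    congr 1
    noncomm_ring
  have h5 : c (s.pairing ϖ j X Y) - s.pairing ϖ j Y X ∈ primePow F 1 := by
    rw [h3, h4, ← map_sub]
    refine trace_mem_primePow_one hh hg s.isSelfDual ?_
    have e4 : -(Y * ((emb F V x * adjoint h X - adjoint h X * emb F V x) * emb F V ϖ')) -
        Y * ((emb F V x * adjoint h X - adjoint h X * emb F V x) * emb F V ϖ) =
        Y * ((emb F V x * alpha h X - alpha h X * emb F V x) * emb F V (ϖ' + ϖ)) := by
      rw [emb_add, alpha]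
      noncomm_ring
    rw [e4]
    have := mul_mem_filtration (mem_centralizerFiltration.1 hY).1 (mul_mem_filtration
      (mem_centralizerFiltration.1 (commutator_mem hg hj (alpha_mem_level hh hg hj hX))).1
      (hg.emb_mem_filtration (F := F).2 h2))
    rwa [show s.r j / 2 + (s.r j / 2 - s.r j + 2) = 1 by omega] at this
  have := sub_mem h5 h1
  rwa [sub_sub_sub_cancel_left] at this

omit hϖ in
/-- The pairing has no kernel on `𝔚_{z,j}`: by duality in the centralizer of `γ_{j+1}`, an element
of the kernel commutes with `c_j` to one order more than expected. -/
lemma pairing_nondegenerate (htame : (ramificationIndex F E).Coprime (ringChar 𝓀[F]))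
    (hϖ : HasOrd ϖ 1) {X : Module.End F V} (hX : X ∈ s.numerator j)
    (H : ∀ Y ∈ s.numerator j, s.pairing ϖ j X Y ∈ primePow F 1) : X ∈ s.denominator j := by
  rw [mem_denominator hr]
  have hX' := mem_numerator.1 hX
  obtain ⟨m, hm⟩ := hr
  refine mem_sup_of_commutator_mem hg hj hX' ?_
  have h1 := emb_mul_mem_level hg hϖ.mem (commutator_mem hg hj hX')
  have e1 : 1 + (s.r j / 2 - s.r j) = -(s.r j / 2) := by omega
  rw [e1] at h1
  have h2 := mem_level_succ_of_trace hh hg htame hj h1 fun Y hY => by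
    rw [neg_neg] at hY
    have h3 := H (alpha h Y) (mem_numerator.2 (alpha_mem_level hh hg hj hY))
    rwa [pairing, alpha, alpha, hh.adjoint_neg, hh.adjoint_adjoint, neg_neg] at h3
  have h3 := (mem_centralizerFiltration.1 h2).1
  rw [← hg.emb_mul_mem_iff hϖ]
  rwa [show 1 + (s.r j / 2 - s.r j + 1) = -(s.r j / 2) + 1 by omega]

end

end SkewStratum

end Pairing

/-! ### The residue field action and the bicharacter -/

section PiBicharacter

variable {K : Type*} [Field K] {ι : Type*} [Fintype ι] {W : ι → Type*}
  [∀ i, AddCommGroup (W i)] [∀ i, Module K (W i)] {b : ∀ i, W i → W i → ℂ}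

lemma IsSymmetricBicharacter.zero_right {W : Type*} [AddCommGroup W] [Module K W] {b : W → W → ℂ}
    (hb : IsSymmetricBicharacter K b) (x : W) : b x 0 = 1 := by
  rw [hb.symm, hb.zero_left]

/-- The orthogonal direct sum of bicharacters. -/
lemma IsSymmetricBicharacter.pi (hb : ∀ i, IsSymmetricBicharacter K (b i)) :
    IsSymmetricBicharacter K (fun x y : ∀ i, W i => ∏ i, b i (x i) (y i)) where
  zero_left y := Finset.prod_eq_one fun i _ => (hb i).zero_left _
  add_left x x' y := by
    rw [← Finset.prod_mul_distrib]
    exact Finset.prod_congr rfl fun i _ => (hb i).add_left _ _ _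
  symm x y := Finset.prod_congr rfl fun i _ => (hb i).symm _ _
  smul_left a x y := Finset.prod_congr rfl fun i _ => (hb i).smul_left _ _ _
  nondegenerate x hx := by
    classical
    funext i
    refine (hb i).nondegenerate _ fun t => ?_
    have := hx (Pi.single i t)
    rwa [Finset.prod_eq_single i, Pi.single_eq_same] at this
    · intro k _ hk
      rw [Pi.single_eq_of_ne hk, (hb k).zero_right]
    · simp

end PiBicharacter

section Conductor

variable {F : Type*} [Field F] [ValuativeRel F] [TopologicalSpace F]
  [IsNonarchimedeanLocalField F] {ψ : AddChar F ℂ}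

lemma HasConductorOne.eq_one (hψ : HasConductorOne ψ) {a : F} (ha : a ∈ primePow F 1) : ψ a = 1 :=
  hψ.1 a (mem_primePow_one.1 ha)

lemma HasConductorOne.congr (hψ : HasConductorOne ψ) {a b : F} (hab : a - b ∈ primePow F 1) :
    ψ a = ψ b := by
  rw [← sub_add_cancel a b, AddChar.map_add_eq_mul, hψ.eq_one hab, one_mul]

/-- An integral element is in `𝔭_F` if `ψ` is trivial on all of its integral multiples. -/
lemma HasConductorOne.mem_primePow_one (hψ : HasConductorOne ψ) {a : F} (ha : a ∈ primePow F 0)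
    (H : ∀ t ∈ primePow F 0, ψ (t * a) = 1) : a ∈ primePow F 1 := by
  by_contra h1
  have h0 : HasOrd a 0 := hasOrd_iff.2 ⟨ha, by simpa using h1⟩
  obtain ⟨x, hx, hx'⟩ := hψ.2
  refine hx' ?_
  have := H (x * a⁻¹) (by simpa using mul_mem_primePow (mem_primePow_zero.2 hx) h0.inv.mem)
  rwa [inv_mul_cancel_right₀ h0.ne_zero] at this

end Conductor

section ResidueModule

variable {F E V : Type*} [Field F] [ValuativeRel F] [TopologicalSpace F]
  [IsNonarchimedeanLocalField F] [Field E] [ValuativeRel E] [TopologicalSpace E]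
  [IsNonarchimedeanLocalField E] [Algebra F E] [ValuativeExtension F E]
  [AddCommGroup V] [Module F V] [Module E V] [IsScalarTower F E V] {c : F →+* F}
  {h : V →ₛₗ[c] V →ₗ[F] F} {ε : F} {v₀ : V}

namespace SkewStratum

variable {s : SkewStratum E h} (hg : IsChainGenerator s.Λ v₀)
include hg

lemma emb_mul_mem_numerator {j : ℕ} {x : E} (hx : x ∈ primePow E 0) {X : Module.End F V}
    (hX : X ∈ s.numerator j) : emb F V x * X ∈ s.numerator j := by
  have := emb_mul_mem_level hg hx hX
  rwa [zero_add] at this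

lemma emb_mul_mem_denominator {j : ℕ} {x : E} (hx : x ∈ primePow E 0) {X : Module.End F V}
    (hX : X ∈ s.denominator j) : emb F V x * X ∈ s.denominator j := by
  obtain ⟨y, hy, w, hw, rfl⟩ := AddSubgroup.mem_sup.1 hX
  have h1 := emb_mul_mem_level hg hx hy
  have h2 := emb_mul_mem_level hg hx hw
  rw [zero_add] at h1 h2
  rw [mul_add]
  exact AddSubgroup.add_mem_sup h1 h2

lemma emb_mul_mem_denominator_of_mem_one {j : ℕ} {x : E} (hx : x ∈ primePow E 1)
    {X : Module.End F V} (hX : X ∈ s.numerator j) : emb F V x * X ∈ s.denominator j :=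
  AddSubgroup.mem_sup_right
    (level_antitone hg (j + 1) (by omega) (emb_mul_mem_level hg hx hX))

/-- The action of `𝔬_E` on `𝔚_{z,j}` by multiplication from the left. -/
def integerAction (j : ℕ) : 𝒪[E] →+* AddMonoid.End (s.W j) where
  toFun x := QuotientAddGroup.map _ _
    ({ toFun := fun X => ⟨emb F V (x : E) * X,
          emb_mul_mem_numerator hg (mem_primePow_zero.2 x.2) X.2⟩
       map_zero' := by simp
       map_add' := fun X Y => by simp [mul_add] } : s.numerator j →+ s.numerator j)
    fun X hX => emb_mul_mem_denominator hg (mem_primePow_zero.2 x.2) hX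
  map_one' := by
    ext X
    induction X using QuotientAddGroup.induction_on with
    | H X => exact congrArg _ (Subtype.ext (by simp [emb_one]))
  map_zero' := by
    ext X
    induction X using QuotientAddGroup.induction_on with
    | H X =>
      have h0 : emb F V (0 : E) = 0 := map_zero (Algebra.lsmul F F V)
      exact congrArg _ (Subtype.ext (by simp [h0]))
  map_mul' x y := by
    ext X
    induction X using QuotientAddGroup.induction_on with
    | H X => exact congrArg _ (Subtype.ext (by simp [emb_mul, mul_assoc]))
  map_add' x y := by
    ext X
    induction X using QuotientAddGroup.induction_on with
    | H X => exact congrArg _ (Subtype.ext (by simp [emb_add, add_mul]))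

/-- `𝔚_{z,j}` as a vector space over `k_E`, by multiplication from the left. -/
@[reducible] def residueModule (j : ℕ) : Module 𝓀[E] (s.W j) :=
  Module.compHom (s.W j) (Ideal.Quotient.lift 𝓂[E] (integerAction hg j) fun x hx => by
    ext X
    induction X using QuotientAddGroup.induction_on with
    | H X =>
      refine (QuotientAddGroup.eq_zero_iff _).2 ?_
      exact emb_mul_mem_denominator_of_mem_one hg (mem_maximalIdeal_iff.1 hx) X.2)

lemma res_smul_mk (j : ℕ) {x : E} (hx : x ∈ primePow E 0) (X : s.numerator j) :
    letI := residueModule hg j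
    res x • (QuotientAddGroup.mk X : s.W j) =
      QuotientAddGroup.mk (⟨emb F V x * X, emb_mul_mem_numerator hg hx X.2⟩ : s.numerator j) := by
  lift x to 𝒪[E] using mem_primePow_zero.1 hx
  rw [res_coe]
  rfl

omit hg in
lemma rep_mem {j : ℕ} (X : s.W j) : s.rep X ∈ s.numerator j := SetLike.coe_mem _

omit hg in
lemma rep_sub_mem {j : ℕ} (X : s.numerator j) :
    s.rep (QuotientAddGroup.mk X : s.W j) - X ∈ s.denominator j := by
  have h1 : (QuotientAddGroup.mk X : s.W j) =
      QuotientAddGroup.mk (Quotient.out (QuotientAddGroup.mk X : s.W j)) :=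
    (Quotient.out_eq' _).symm
  have h2 := AddSubgroup.mem_addSubgroupOf.1 (QuotientAddGroup.eq.1 h1)
  rwa [AddSubgroup.coe_add, AddSubgroup.coe_neg, neg_add_eq_sub] at h2

variable (hh : IsHermitianForm h ε) [FiniteDimensional F V] [Nontrivial V]
  (hconj : ∀ x : E, ∃ y, IsConj h x y) (hE : ∀ x ∈ fixedSubfield E h, ¬ IsUniformizer x)
  {j : ℕ} (hj : j < s.len) (hr : Odd (s.r j)) {ψ : AddChar F ℂ} (hψ : HasConductorOne ψ)
include hh hconj hE hj hr hψ

lemma ψ_pairing_comm {ϖ : E} (hϖ : ϖ ∈ primePow E 1) {X Y : Module.End F V}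
    (hX : X ∈ s.numerator j) (hY : Y ∈ s.numerator j) :
    ψ (s.pairing ϖ j X Y) = ψ (s.pairing ϖ j Y X) :=
  hψ.congr (pairing_symm hh hg hconj hE hj hr hϖ hX hY)

/-- The character values of the pairing depend only on the classes in `𝔚_{z,j}`. -/
lemma ψ_pairing_congr {ϖ : E} (hϖ : ϖ ∈ primePow E 1) {X X' Y Y' : Module.End F V}
    (hX : X ∈ s.numerator j) (hY : Y ∈ s.numerator j)
    (hX' : X' - X ∈ s.denominator j) (hY' : Y' - Y ∈ s.denominator j)
    (hYn : Y' ∈ s.numerator j) :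
    ψ (s.pairing ϖ j X' Y') = ψ (s.pairing ϖ j X Y) := by
  have key {A A' B : Module.End F V} (hA : A' - A ∈ s.denominator j) (hB : B ∈ s.numerator j) :
      ψ (s.pairing ϖ j A' B) = ψ (s.pairing ϖ j A B) := by
    refine hψ.congr ?_
    have := pairing_mem_one_of_mem_denominator hh hg hj hr hϖ hA hB
    have h1 := pairing_add_left (s := s) ϖ j (A' - A) A B
    rw [sub_add_cancel] at h1
    rwa [h1, add_sub_cancel_right]
  rw [key hX' hYn, ψ_pairing_comm hg hh hconj hE hj hr hψ hϖ hX hYn, key hY' hX,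
    ψ_pairing_comm hg hh hconj hE hj hr hψ hϖ hY hX]

lemma ψ_pairing_rep {ϖ : E} (hϖ : ϖ ∈ primePow E 1) (X Y : s.numerator j) :
    ψ (s.pairing ϖ j (s.rep (QuotientAddGroup.mk X : s.W j))
      (s.rep (QuotientAddGroup.mk Y : s.W j))) = ψ (s.pairing ϖ j X Y) :=
  ψ_pairing_congr hg hh hconj hE hj hr hψ hϖ X.2 Y.2 (rep_sub_mem X) (rep_sub_mem Y)
    (rep_mem _)

lemma ψ_pairing_rep_smul {ϖ x : E} (hϖ : ϖ ∈ primePow E 1) (hx : x ∈ primePow E 0) (X Y : s.W j) :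
    letI := residueModule hg j
    ψ (s.pairing ϖ j (s.rep (res x • X)) (s.rep Y)) =
      ψ (s.pairing (ϖ * x) j (s.rep X) (s.rep Y)) := by
  have hϖx : ϖ * x ∈ primePow E 1 := by simpa using mul_mem_primePow hϖ hx
  induction X using QuotientAddGroup.induction_on with
  | H X =>
    induction Y using QuotientAddGroup.induction_on with
    | H Y =>
      rw [res_smul_mk hg j hx, ψ_pairing_rep hg hh hconj hE hj hr hψ hϖ,
        ψ_pairing_rep hg hh hconj hE hj hr hψ hϖx, pairing_emb_mul_left]

lemma isSymmetricBicharacter (htame : (ramificationIndex F E).Coprime (ringChar 𝓀[F])) {ϖ : E}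
    (hϖ : HasOrd ϖ 1) :
    letI := residueModule hg j
    IsSymmetricBicharacter 𝓀[E] fun X Y : s.W j => ψ (s.pairing ϖ j (s.rep X) (s.rep Y)) := by
  let _ := residueModule hg j
  have hrep := fun X Y => ψ_pairing_rep hg hh hconj hE hj hr hψ hϖ.mem X Y
  have hzero (Y : s.W j) : ψ (s.pairing ϖ j (s.rep (0 : s.W j)) (s.rep Y)) = 1 := by
    induction Y using QuotientAddGroup.induction_on with
    | H Y =>
      refine (hrep 0 Y).trans ?_
      simp [pairing]
  have hsymm (X Y : s.W j) : ψ (s.pairing ϖ j (s.rep X) (s.rep Y)) =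
      ψ (s.pairing ϖ j (s.rep Y) (s.rep X)) :=
    ψ_pairing_comm hg hh hconj hE hj hr hψ hϖ.mem (rep_mem X) (rep_mem Y)
  refine ⟨hzero, fun X X' Y => ?_, hsymm, fun a X Y => ?_, fun X H => ?_⟩
  · induction X using QuotientAddGroup.induction_on with
    | H X =>
      induction X' using QuotientAddGroup.induction_on with
      | H X' =>
        induction Y using QuotientAddGroup.induction_on with
        | H Y =>
          rw [hrep X Y, hrep X' Y, ← AddChar.map_add_eq_mul, ← pairing_add_left]
          exact hrep (X + X') Y
  · obtain ⟨x, hx, rfl⟩ := exists_res_eq a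
    have hϖx : ϖ * x ∈ primePow E 1 := by simpa using mul_mem_primePow hϖ.mem hx
    rw [hsymm X, ψ_pairing_rep_smul hg hh hconj hE hj hr hψ hϖ.mem hx,
      ψ_pairing_rep_smul hg hh hconj hE hj hr hψ hϖ.mem hx]
    exact ψ_pairing_comm hg hh hconj hE hj hr hψ hϖx (rep_mem X) (rep_mem Y)
  · induction X using QuotientAddGroup.induction_on with
    | H X =>
      refine (QuotientAddGroup.eq_zero_iff _).2 ?_
      refine AddSubgroup.mem_addSubgroupOf.2
        (pairing_nondegenerate hh hg hconj hE hj hr htame hϖ X.2 fun Y hY => ?_)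
      -- As `ψ` of the pairing is trivial on all integral multiples of `Y`, the pairing itself
      -- lies in `𝔭_F`.
      refine hψ.mem_primePow_one (pairing_mem_zero hh hg hj hr hϖ.mem X.2 hY) fun t ht => ?_
      have htE := algebraMap_mem_primePow_zero (E := E).2 ht
      have hϖt : ϖ * algebraMap F E t ∈ primePow E 1 := by simpa using mul_mem_primePow hϖ.mem htE
      rw [← pairing_algebraMap_mul, ψ_pairing_comm hg hh hconj hE hj hr hψ hϖt X.2 hY,
        ← pairing_emb_mul_left,
        ψ_pairing_comm hg hh hconj hE hj hr hψ hϖ.mem (emb_mul_mem_numerator hg htE hY) X.2]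
      have := H (QuotientAddGroup.mk ⟨_, emb_mul_mem_numerator hg htE hY⟩)
      rwa [hrep] at this

end SkewStratum

end ResidueModule

/-! ### The order of the sum of the summands -/

section Counting

variable {F E V : Type*} [Field F] [ValuativeRel F] [TopologicalSpace F]
  [IsNonarchimedeanLocalField F] [Field E] [ValuativeRel E] [TopologicalSpace E]
  [IsNonarchimedeanLocalField E] [Algebra F E] [ValuativeExtension F E]
  [AddCommGroup V] [Module F V] [Module E V] [IsScalarTower F E V] {c : F →+* F}
  {h : V →ₛₗ[c] V →ₗ[F] F} {ε : F} {v₀ : V}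

/-- An instance of the second isomorphism theorem, by the modular law. -/
lemma relIndex_sup_inf {A : Type*} [AddCommGroup A] {H K : AddSubgroup A} (P : AddSubgroup A)
    (hHK : H ≤ K) : (H ⊔ P ⊓ K).relIndex K = (H ⊔ P).relIndex (K ⊔ P) := by
  rw [← sup_inf_assoc_of_le P hHK, AddSubgroup.inf_relIndex_right,
    ← AddSubgroup.relIndex_sup_right (H := K) (K := H ⊔ P)]
  congr 1
  rw [← sup_assoc, sup_eq_left.2 hHK]

lemma prod_relIndex {A : Type*} [AddCommGroup A] {G : ℕ → AddSubgroup A} {n : ℕ}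
    (hG : ∀ j < n, G j ≤ G (j + 1)) :
    ∏ j ∈ Finset.range n, (G j).relIndex (G (j + 1)) = (G 0).relIndex (G n) ∧ G 0 ≤ G n := by
  induction n with
  | zero => simp
  | succ n ih =>
    obtain ⟨h1, h2⟩ := ih fun j hj => hG j (by omega)
    have h3 := hG n (by omega)
    rw [Finset.prod_range_succ, h1]
    exact ⟨AddSubgroup.relIndex_mul_relIndex _ _ _ h2 h3, h2.trans h3⟩

namespace SkewStratum

variable {s : SkewStratum E h} (hg : IsChainGenerator s.Λ v₀)
include hg

lemma emb_mul_mem_sup {x : E} {a : ℤ} (hx : x ∈ primePow E a) {j : ℕ} {k : ℤ}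
    {X : Module.End F V} (hX : X ∈ s.level j k ⊔ s.level (j + 1) (k + 1)) :
    emb F V x * X ∈ s.level j (a + k) ⊔ s.level (j + 1) (a + k + 1) := by
  obtain ⟨y, hy, w, hw, rfl⟩ := AddSubgroup.mem_sup.1 hX
  rw [mul_add, add_assoc a]
  exact AddSubgroup.add_mem_sup (emb_mul_mem_level hg hx hy) (emb_mul_mem_level hg hx hw)

lemma emb_mul_mem_sup_iff {x : E} {a : ℤ} (hx : HasOrd x a) {j : ℕ} {k : ℤ}
    {X : Module.End F V} : emb F V x * X ∈ s.level j (a + k) ⊔ s.level (j + 1) (a + k + 1) ↔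
      X ∈ s.level j k ⊔ s.level (j + 1) (k + 1) := by
  refine ⟨fun hX => ?_, emb_mul_mem_sup hg hx.mem⟩
  have := emb_mul_mem_sup hg hx.inv.mem hX
  rwa [← mul_assoc, emb_inv_mul hx.ne_zero, one_mul, neg_add_cancel_left] at this

/-- The order of `𝔚_{z,j}`, after a shift to step zero and the second isomorphism theorem, in a form
in which the product over `j` telescopes. -/
lemma relIndex_denominator {j : ℕ} (hj : j < s.len) (hr : Odd (s.r j)) :
    (s.denominator j).relIndex (s.numerator j) =
      (s.level j 0 ⊔ filtration F s.Λ 1).relIndex (s.level (j + 1) 0 ⊔ filtration F s.Λ 1) := by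
  obtain ⟨z, hz⟩ := exists_hasOrd (E := E) (s.r j / 2)
  have hu : IsUnit (emb F V z) :=
    ⟨⟨_, _, emb_mul_inv hz.ne_zero, emb_inv_mul hz.ne_zero⟩, rfl⟩
  have h1 := relIndex_map_equiv (AddAut.mulLeft hu.unit) (H := s.level j 0 ⊔ s.level (j + 1) (0 + 1))
    (K := s.level (j + 1) 0) (H' := s.denominator j) (K' := s.numerator j)
    (fun X => by
      rw [mem_denominator hr]
      have := emb_mul_mem_sup_iff hg hz (j := j) (k := 0) (X := X)
      rwa [add_zero] at this)
    (fun X => by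
      rw [mem_numerator]
      have := emb_mul_mem_level_iff hg hz (j := j + 1) (k := 0) (X := X)
      rwa [add_zero] at this)
  rw [h1, ← relIndex_sup_inf _ (level_le_succ hj 0), zero_add]
  congr 2
  ext X
  rw [AddSubgroup.mem_inf, mem_centralizerFiltration, mem_centralizerFiltration]
  exact ⟨fun hX => ⟨hX.1, hg.filtration_antitone zero_le_one hX.1, hX.2⟩, fun hX => ⟨hX.1, hX.2.2⟩⟩

/-- The centralizer of `γ_0 = β` in `End_F(V)` is `E`, as `E = F[β]` and `V` is a line. -/
lemma level_zero_eq_map (k : ℤ) :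
    s.level 0 k = (primePow E k).map
      (Algebra.lsmul F F V : E →ₐ[F] Module.End F V).toLinearMap.toAddMonoidHom := by
  ext X
  rw [mem_centralizerFiltration, AddSubgroup.mem_map]
  constructor
  · rintro ⟨h1, h2⟩
    obtain ⟨x, hx⟩ := hg.exists_smul (X v₀)
    have hX : emb F V x = X := by
      ext v
      obtain ⟨y, rfl⟩ := hg.exists_smul v
      have hy : y ∈ Algebra.adjoin F {s.γ 0} := by
        rw [s.γ_zero, s.adjoin_eq_top]; trivial
      have := LinearMap.congr_fun (emb_commute_of_mem_adjoin hy h2) v₀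
      simp only [Module.End.mul_apply, emb_apply] at this ⊢
      rw [← this, hx, smul_comm]
    exact ⟨x, hg.emb_mem_filtration.1 (hX ▸ h1), hX⟩
  · rintro ⟨x, hx, rfl⟩
    exact ⟨hg.emb_mem_filtration.2 hx, emb_commute _ _⟩

lemma relIndex_level_zero :
    (filtration F s.Λ 1).relIndex (s.level 0 0 ⊔ filtration F s.Λ 1) = Nat.card 𝓀[E] := by
  rw [AddSubgroup.relIndex_sup_right, level_zero_eq_map hg, ← AddSubgroup.relIndex_comap]
  have : (filtration F s.Λ 1).comap
      (Algebra.lsmul F F V : E →ₐ[F] Module.End F V).toLinearMap.toAddMonoidHom = primePow E 1 := by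
    ext x
    exact hg.emb_mem_filtration
  rw [this]
  simpa using relIndex_primePow (E := E) 0

/-- The order of `𝔚_z`: the orders of the summands multiply up to the index of
`𝔬_E + 𝔓^1` in `𝔓^0`. -/
lemma card_Wz (hh : IsHermitianForm h ε) [FiniteDimensional F V] [FiniteDimensional F E]
    (hV : Module.finrank E V = 1) (hr : ∀ j < s.len, Odd (s.r j)) :
    Nat.card 𝓀[E] * Nat.card s.Wz =
      Nat.card 𝓀[E] ^ (ramificationIndex F E * residueDegree F E) := by
  let G : ℕ → AddSubgroup (Module.End F V) := fun j => s.level j 0 ⊔ filtration F s.Λ 1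
  have hcard : Nat.card s.Wz = ∏ j ∈ Finset.range s.len, (G j).relIndex (G (j + 1)) := by
    rw [Nat.card_pi, Finset.prod_range]
    exact Finset.prod_congr rfl fun j _ => relIndex_denominator hg j.2 (hr j j.2)
  have hG : G s.len = filtration F s.Λ 0 := by
    have : s.level s.len 0 = filtration F s.Λ 0 := by
      ext X
      exact mem_level_len
    change s.level s.len 0 ⊔ _ = _
    rw [this]
    exact sup_eq_left.2 (hg.filtration_antitone zero_le_one)
  obtain ⟨h1, h2⟩ := prod_relIndex (G := G) (n := s.len)
    fun j hj => sup_le_sup_right (level_le_succ hj 0) _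
  rw [hcard, h1, ← relIndex_level_zero hg, AddSubgroup.relIndex_mul_relIndex _ _ _ le_sup_right h2,
    hG, relIndex_level_zero hg]
  exact relIndex_filtration_zero hh hg s.isSelfDual hV

end SkewStratum

end Counting

/-! ### Signs of units and the evaluation of the Gauss sum -/

section UnitSign

variable {F E : Type*} [Field F] [ValuativeRel F] [TopologicalSpace F]
  [IsNonarchimedeanLocalField F] [Field E] [ValuativeRel E] [TopologicalSpace E]
  [IsNonarchimedeanLocalField E] [Algebra F E] [ValuativeExtension F E]

open Classical in
/-- The quadratic character of `k_E` at the residue class of `x`, as a sign (used at units of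
`𝔬_E` only). -/
def unitSign (x : E) : ℤˣ := if IsSquare (res x) then 1 else -1

lemma coe_unitSign [Fintype 𝓀[E]] [DecidableEq 𝓀[E]] {x : E}
    (hx : HasOrd x 0) : ((unitSign x : ℤˣ) : ℤ) = quadraticChar 𝓀[E] (res x) := by
  have h0 := (res_ne_zero_iff hx.mem).2 hx
  rw [unitSign]
  split_ifs with hs
  · exact ((quadraticChar_one_iff_isSquare h0).2 hs).symm
  · exact (quadraticChar_neg_one_iff_not_isSquare.2 hs).symm

lemma unitSign_mul {x y : E} (hx : HasOrd x 0) (hy : HasOrd y 0) :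
    unitSign (x * y) = unitSign x * unitSign y := by
  classical
  have : Fintype 𝓀[E] := Fintype.ofFinite _
  refine Units.ext ?_
  rw [Units.val_mul, coe_unitSign hx, coe_unitSign hy,
    coe_unitSign (by simpa using hx.mul hy), res_mul hx.mem hy.mem, map_mul]

lemma unitSign_algebraMap (hp : ringChar 𝓀[F] ≠ 2) (hf : Even (residueDegree F E)) {x : F}
    (hx : HasOrd x 0) : unitSign (algebraMap F E x) = 1 := by
  classical
  have : Fintype 𝓀[E] := Fintype.ofFinite _
  refine Units.ext ?_
  rw [coe_unitSign (by simpa using hx.algebraMap (E := E)), quadraticChar_algebraMap hp hf hx]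
  rfl

lemma quadraticCharacter_eq_unitSign {ζ : Eˣ}
    (hζ : ζ ∈ rootsOfUnityPrimeToP E) :
    quadraticCharacter ζ = ((unitSign (ζ : E) : ℤ) : ℂ) := by
  classical
  have : Fintype 𝓀[E] := Fintype.ofFinite _
  rw [quadraticCharacter_eq hζ, coe_unitSign (hasOrd_rootsOfUnity hζ)]

/-- The values at units of a tamely ramified character of `E^×` which is a power of the quadratic
character on the roots of unity. -/
lemma IsTamelyRamified.apply_unit {χ : Eˣ →* ℂˣ} (hχ : IsTamelyRamified χ)
    {n : ℕ} (hroots : ∀ ζ ∈ rootsOfUnityPrimeToP E, (χ ζ : ℂ) = quadraticCharacter ζ ^ n) {u : Eˣ}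
    (hu : HasOrd (u : E) 0) : (χ u : ℂ) = ((unitSign (u : E) : ℤ) : ℂ) ^ n := by
  obtain ⟨ζ, hζ, hζu⟩ := exists_rootsOfUnity hu
  have hζ0 := hasOrd_rootsOfUnity hζ
  have hres : res (ζ : E) = res (u : E) := (res_eq_res_iff hζ0.mem hu.mem).2 hζu
  have h1 : χ (u⁻¹ * ζ) = 1 := by
    refine hχ _ (mem_primePow_one.1 ?_)
    have := mul_mem_primePow hu.inv.mem hζu
    rw [mul_sub, inv_mul_cancel₀ hu.ne_zero, neg_zero, zero_add] at this
    rwa [Units.val_mul, Units.val_inv_eq_inv_val]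
  rw [map_mul, map_inv, inv_mul_eq_one] at h1
  rw [h1, hroots ζ hζ, quadraticCharacter_eq_unitSign hζ, unitSign, unitSign, hres]

end UnitSign

section AdditiveCharacters

variable {F : Type*} [Field F] [ValuativeRel F] [TopologicalSpace F]
  [IsNonarchimedeanLocalField F] {ψ ψ₀ : AddChar F ℂ}

lemma res_add {x y : F} (hx : x ∈ primePow F 0) (hy : y ∈ primePow F 0) :
    res (x + y) = res x + res y := by
  lift x to 𝒪[F] using mem_primePow_zero.1 hx
  lift y to 𝒪[F] using mem_primePow_zero.1 hy
  rw [res_coe, res_coe, ← map_add, ← res_coe]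
  rfl

/-- A character of conductor one induces a nontrivial additive character of `k_F`. -/
lemma HasConductorOne.exists_addChar (hψ : HasConductorOne ψ) :
    ∃ φ : AddChar 𝓀[F] ℂ, φ ≠ 1 ∧ ∀ x ∈ primePow F 0, φ (res x) = ψ x := by
  choose l hl hl' using exists_res_eq (E := F)
  have key {x y : F} (hx : x ∈ primePow F 0) (hy : y ∈ primePow F 0) (hxy : res x = res y) :
      ψ x = ψ y := hψ.congr ((res_eq_res_iff hx hy).1 hxy)
  have hres0 : res (0 : F) = 0 := by
    rw [← map_zero (IsLocalRing.residue 𝒪[F]), ← res_coe]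
    rfl
  let φ : AddChar 𝓀[F] ℂ :=
    { toFun := fun t => ψ (l t)
      map_zero_eq_one' := by
        rw [key (hl 0) (zero_mem _) (by rw [hl', hres0]), AddChar.map_zero_eq_one]
      map_add_eq_mul' := fun a b => by
        rw [← AddChar.map_add_eq_mul]
        exact key (hl _) (add_mem (hl a) (hl b)) (by rw [res_add (hl a) (hl b), hl', hl', hl']) }
  have hφ : ∀ x ∈ primePow F 0, φ (res x) = ψ x := fun x hx => key (hl _) hx (hl' _)
  refine ⟨φ, fun h1 => ?_, hφ⟩
  obtain ⟨x, hx, hx'⟩ := hψ.2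
  refine hx' ?_
  rw [← hφ x (mem_primePow_zero.2 hx), h1, AddChar.one_apply]

/-- Two additive characters of conductor one differ on `𝔬_F` by multiplication by a unit. -/
lemma HasConductorOne.exists_eq_mul (hψ : HasConductorOne ψ) (hψ₀ : HasConductorOne ψ₀) :
    ∃ a : F, HasOrd a 0 ∧ ∀ x ∈ primePow F 0, ψ x = ψ₀ (a * x) := by
  have : Fintype 𝓀[F] := Fintype.ofFinite _
  obtain ⟨φ, hφ1, hφ⟩ := hψ.exists_addChar
  obtain ⟨φ₀, hφ₀1, hφ₀⟩ := hψ₀.exists_addChar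
  obtain ⟨t, ht⟩ := exists_eq_mulShift (AddChar.IsPrimitive.of_ne_one hφ₀1) φ
  obtain ⟨a, ha, rfl⟩ := exists_res_eq t
  refine ⟨a, (res_ne_zero_iff ha).1 fun h0 => hφ1 ?_, fun x hx => ?_⟩
  · rw [ht, h0, AddChar.mulShift_zero]
  · have hax : a * x ∈ primePow F 0 := by simpa using mul_mem_primePow ha hx
    rw [← hφ x hx, ← hφ₀ _ hax, ht, AddChar.mulShift_apply, res_mul ha hx]

end AdditiveCharacters

section GaussSum

variable {F E V : Type*} [Field F] [ValuativeRel F] [TopologicalSpace F]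
  [IsNonarchimedeanLocalField F] [Field E] [ValuativeRel E] [TopologicalSpace E]
  [IsNonarchimedeanLocalField E] [Algebra F E] [ValuativeExtension F E]
  [AddCommGroup V] [Module F V] [Module E V] [IsScalarTower F E V] {c : F →+* F}
  {h : V →ₛₗ[c] V →ₗ[F] F} {ε : F} {v₀ : V}

namespace SkewStratum

variable {s : SkewStratum E h} (hg : IsChainGenerator s.Λ v₀)
  (hh : IsHermitianForm h ε) [FiniteDimensional F V] [Nontrivial V]
include hg hh

/-- Scaling the additive character by `a` amounts to scaling the uniformizer, as the arguments of
the character are integral. -/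
lemma gaussSum_eq_of_eq_mul (hr : ∀ j < s.len, Odd (s.r j)) {ψ ψ₀ : AddChar F ℂ} {a : F}
    (ha : ∀ x ∈ primePow F 0, ψ x = ψ₀ (a * x)) {ϖ : E} (hϖ : ϖ ∈ primePow E 1) :
    s.gaussSum ϖ ψ = s.gaussSum (ϖ * algebraMap F E a) ψ₀ := by
  refine finsum_congr fun X => Finset.prod_congr rfl fun j _ => ?_
  rw [← pairing_self, ← pairing_self, pairing_algebraMap_mul]
  exact ha _ (pairing_mem_zero hh hg j.2 (hr j j.2) hϖ (rep_mem _) (rep_mem _))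

/-- The Gauss sum is one of a nondegenerate quadratic form over `k_E` of dimension `w = e f - 1`:
its square, and its change under scaling of `ϖ` by a unit. -/
lemma gaussSum_properties [FiniteDimensional F E] (hV : Module.finrank E V = 1)
    (hconj : ∀ x : E, ∃ y, IsConj h x y) (hE : ∀ x ∈ fixedSubfield E h, ¬ IsUniformizer x)
    (hp : ringChar 𝓀[E] ≠ 2) (hr : ∀ j < s.len, Odd (s.r j))
    (htame : (ramificationIndex F E).Coprime (ringChar 𝓀[F])) :
    Nat.card s.Wz ≠ 0 ∧ ∃ w : ℕ, w + 1 = ramificationIndex F E * residueDegree F E ∧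
      ∀ ψ : AddChar F ℂ, HasConductorOne ψ → ∀ ϖ : E, HasOrd ϖ 1 →
        s.gaussSum ϖ ψ ^ 2 = ((unitSign (-1 : E) : ℤ) : ℂ) ^ w * Nat.card s.Wz ∧
        ∀ u : E, HasOrd u 0 →
          s.gaussSum (ϖ * u) ψ = ((unitSign u : ℤ) : ℂ) ^ w * s.gaussSum ϖ ψ := by
  classical
  have : Fintype 𝓀[E] := Fintype.ofFinite _
  let _ : ∀ j : Fin s.len, Module 𝓀[E] (s.W j) := fun j => residueModule hg j
  have hcard := card_Wz hg hh hV hr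
  have hq : 1 < Nat.card 𝓀[E] := Finite.one_lt_card
  have hne : Nat.card s.Wz ≠ 0 := fun h0 => by
    rw [h0, mul_zero] at hcard
    exact (pow_pos (by omega) _).ne hcard
  have : Finite s.Wz := Nat.finite_of_card_ne_zero hne
  refine ⟨hne, Module.finrank 𝓀[E] s.Wz, ?_, fun ψ hψ ϖ hϖ => ?_⟩
  · refine Nat.pow_right_injective hq ?_
    change _ ^ _ = _ ^ _
    rw [← hcard, pow_succ', ← Module.natCard_eq_pow_finrank]
  · have hb := IsSymmetricBicharacter.pi fun j : Fin s.len =>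
      isSymmetricBicharacter hg hh hconj hE j.2 (hr j j.2) hψ htame hϖ
    refine ⟨?_, fun u hu => ?_⟩
    · have hone : HasOrd (-1 : E) 0 := hasOrd_one.neg
      have hres : res (-1 : E) = -1 := by
        have h0 : res (-1 : E) + 1 = 0 := by
          rw [← res_one (E := E), ← res_add hone.mem hasOrd_one.mem, neg_add_cancel,
            ← map_zero (IsLocalRing.residue 𝒪[E]), ← res_coe]
          rfl
        exact eq_neg_of_add_eq_zero_left h0
      rw [coe_unitSign hone, hres]
      exact hb.finsum_sq hp
    · rw [coe_unitSign hu]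
      refine Eq.trans ?_ (hb.finsum_smul hp ((res_ne_zero_iff hu.mem).2 hu))
      refine finsum_congr fun X => Finset.prod_congr rfl fun j _ => ?_
      rw [← pairing_self]
      exact (ψ_pairing_rep_smul hg hh hconj hE j.2 (hr j j.2) hψ hϖ.mem hu.mem _ _).symm

end SkewStratum

end GaussSum

/-! ### The sign -/

section Sign

variable {F E V : Type*} [Field F] [ValuativeRel F] [TopologicalSpace F]
  [IsNonarchimedeanLocalField F] [Field E] [ValuativeRel E] [TopologicalSpace E]
  [IsNonarchimedeanLocalField E] [Algebra F E] [ValuativeExtension F E]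
  [AddCommGroup V] [Module F V] [Module E V] [IsScalarTower F E V] {c : F →+* F}
  {h : V →ₛₗ[c] V →ₗ[F] F} {ε : F} {v₀ : V}

namespace SkewStratum

variable {s : SkewStratum E h}

/-- The dimension `e f - 1` of `𝔚_z` over `k_E` has the parity of `f - 1`. If it is odd then `f`
is even, so that the units of `F` are squares in `k_E`: this is why the normalized Gauss sum is a
sign, and does not depend on the additive character. -/
theorem exists_sign (hg : IsChainGenerator s.Λ v₀)
    (hh : IsHermitianForm h ε) [FiniteDimensional F V] [Nontrivial V]
    [FiniteDimensional F E] (hV : Module.finrank E V = 1)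
    (hconj : ∀ x : E, ∃ y, IsConj h x y) (hE : ∀ x ∈ fixedSubfield E h, ¬ IsUniformizer x)
    (hp : ringChar 𝓀[F] ≠ 2) (hodd : Odd (ramificationIndex F E))
    (htame : (ramificationIndex F E).Coprime (ringChar 𝓀[F])) :
    ∃ sgn : E → ℤˣ,
      (∀ ϖ : E, HasOrd ϖ 1 → ∀ ψ : AddChar F ℂ, HasConductorOne ψ →
        s.epsilonZ ϖ ψ = ((sgn ϖ : ℤ) : ℂ)) ∧
      ∀ ϖ u : E, HasOrd ϖ 1 → HasOrd u 0 →
        sgn (ϖ * u) = sgn ϖ * unitSign u ^ (residueDegree F E - 1) := by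
  obtain ⟨-, hf, hchar⟩ := card_residueField F E
  have hpE : ringChar 𝓀[E] ≠ 2 := hchar ▸ hp
  have hr : ∀ j < s.len, Odd (s.r j) := fun j hj => odd_r hh hg hconj hE hpE hj
  obtain ⟨hne, w, hw, hsum⟩ := gaussSum_properties hg hh hV hconj hE hpE hr htame
  have hpar : w % 2 = (residueDegree F E - 1) % 2 := by
    obtain ⟨k, hk⟩ := hodd
    rw [hk, add_mul, mul_assoc] at hw
    omega
  have hpow (x : ℤˣ) : x ^ w = x ^ (residueDegree F E - 1) := by
    rw [Int.units_pow_eq_pow_mod_two, hpar, ← Int.units_pow_eq_pow_mod_two]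
  have hpow' (x : ℤˣ) : ((x : ℤ) : ℂ) ^ w = ((x ^ (residueDegree F E - 1) : ℤˣ) : ℤ) := by
    rw [← hpow]
    push_cast
    rfl
  have hF (x : F) (hx : HasOrd x 0) :
      unitSign (algebraMap F E x) ^ (residueDegree F E - 1) = 1 := by
    rcases Nat.even_or_odd (residueDegree F E) with hev | hod
    · rw [unitSign_algebraMap hp hev hx, one_pow]
    · rw [Int.units_pow_eq_pow_mod_two, show (residueDegree F E - 1) % 2 = 0 by
        obtain ⟨k, hk⟩ := hod
        omega, pow_zero]
  have hcard : ((Real.sqrt (Nat.card s.Wz) : ℝ) : ℂ) ^ 2 = Nat.card s.Wz := by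
    rw [← Complex.ofReal_pow, Real.sq_sqrt (Nat.cast_nonneg _), Complex.ofReal_natCast]
  have hcard0 : (Nat.card s.Wz : ℂ) ≠ 0 := Nat.cast_ne_zero.2 hne
  obtain ⟨ϖ₀, hϖ₀⟩ := exists_hasOrd (E := E) 1
  -- The sign at a reference uniformizer determines all others.
  obtain ⟨s₀, hs₀⟩ : ∃ s₀ : ℤˣ, ∀ ψ : AddChar F ℂ, HasConductorOne ψ →
      s.epsilonZ ϖ₀ ψ = ((s₀ : ℤ) : ℂ) := by
    by_cases hex : ∃ ψ₀ : AddChar F ℂ, HasConductorOne ψ₀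
    · obtain ⟨ψ₀, hψ₀⟩ := hex
      have hindep (ψ : AddChar F ℂ) (hψ : HasConductorOne ψ) :
          s.epsilonZ ϖ₀ ψ = s.epsilonZ ϖ₀ ψ₀ := by
        obtain ⟨a, ha, haψ⟩ := hψ.exists_eq_mul hψ₀
        have haE : HasOrd (algebraMap F E a) 0 := by simpa using ha.algebraMap (E := E)
        rw [epsilonZ, epsilonZ, gaussSum_eq_of_eq_mul hg hh hr haψ hϖ₀.mem,
          (hsum ψ₀ hψ₀ ϖ₀ hϖ₀).2 _ haE, hpow', hF a ha]
        simp
      have hsq : s.epsilonZ ϖ₀ ψ₀ ^ 2 = 1 := by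
        have h1 := hF (-1) hasOrd_one.neg
        rw [map_neg, map_one] at h1
        rw [epsilonZ, div_pow, hcard, (hsum ψ₀ hψ₀ ϖ₀ hϖ₀).1, hpow', h1]
        simp [hcard0]
      rcases mul_self_eq_one_iff.1 ((sq _).symm.trans hsq) with h1 | h1
      · exact ⟨1, fun ψ hψ => by rw [hindep ψ hψ, h1]; simp⟩
      · exact ⟨-1, fun ψ hψ => by rw [hindep ψ hψ, h1]; simp⟩
    · exact ⟨1, fun ψ hψ => (hex ⟨ψ, hψ⟩).elim⟩
  have hquot {ϖ : E} (hϖ : HasOrd ϖ 1) : HasOrd (ϖ₀⁻¹ * ϖ) 0 := by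
    simpa using hϖ₀.inv.mul hϖ
  refine ⟨fun ϖ => s₀ * unitSign (ϖ₀⁻¹ * ϖ) ^ (residueDegree F E - 1),
    fun ϖ hϖ ψ hψ => ?_, fun ϖ u hϖ hu => ?_⟩
  · have h1 := (hsum ψ hψ ϖ₀ hϖ₀).2 _ (hquot hϖ)
    rw [mul_inv_cancel_left₀ hϖ₀.ne_zero, hpow'] at h1
    rw [Units.val_mul, Int.cast_mul, ← hs₀ ψ hψ, epsilonZ, epsilonZ, h1, mul_div_assoc, mul_comm]
  · change s₀ * unitSign (ϖ₀⁻¹ * (ϖ * u)) ^ _ = s₀ * unitSign (ϖ₀⁻¹ * ϖ) ^ _ * unitSign u ^ _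
    rw [← mul_assoc, unitSign_mul (hquot hϖ) hu, mul_pow, mul_assoc]

end SkewStratum

end Sign

end StronglyRamified

end

theorem proposition4p8
    {F₀ F E V : Type*}
    [Field F₀] [ValuativeRel F₀] [TopologicalSpace F₀] [IsNonarchimedeanLocalField F₀]
    [Field F] [ValuativeRel F] [TopologicalSpace F] [IsNonarchimedeanLocalField F]
    [Field E] [ValuativeRel E] [TopologicalSpace E] [IsNonarchimedeanLocalField E]
    [Algebra F₀ F] [ValuativeExtension F₀ F] [Algebra F E] [ValuativeExtension F E]
    [FiniteDimensional F E]
    [AddCommGroup V] [Module F V] [Module E V] [IsScalarTower F E V]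
    (hp : ringChar 𝓀[F₀] ≠ 2)
    (hquad : Module.finrank F₀ F = 2)
    (hram : StronglyRamified.ramificationIndex F₀ F = 2)
    (c : F ≃ₐ[F₀] F) (hc : c ≠ AlgEquiv.refl)
    (hV : Module.finrank E V = 1)
    (htame : (StronglyRamified.ramificationIndex F E).Coprime (ringChar 𝓀[F]))
    (h : V →ₛₗ[((c : F ≃+* F) : F →+* F)] V →ₗ[F] F) (ε : F)
    (hh : StronglyRamified.IsHermitianForm h ε)
    (s : StronglyRamified.SkewStratum E h)
    (hE : StronglyRamified.IsQuadraticRamified (StronglyRamified.fixedSubfield E h)) :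
    ∃ sgn : E → ℤˣ,
      (∀ ϖ : E, StronglyRamified.IsUniformizer ϖ →
        ∀ ψ : AddChar F ℂ, StronglyRamified.HasConductorOne ψ →
          s.epsilonZ ϖ ψ = ((sgn ϖ : ℤ) : ℂ)) ∧
      ∀ (ρt : Eˣ →* ℂˣ) (ρ : ℤˣ →* ℂˣ), StronglyRamified.IsTamelyRamified ρt →
        (∀ ζ ∈ StronglyRamified.rootsOfUnityPrimeToP E,
          (ρt ζ : ℂ) = StronglyRamified.quadraticCharacter ζ ^
            (StronglyRamified.residueDegree F E - 1)) →
        ∀ ϖ ϖ' : Eˣ, StronglyRamified.IsUniformizer (ϖ : E) →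
          StronglyRamified.IsUniformizer (ϖ' : E) →
          ((ρt ϖ : ℂ) = ((sgn ϖ : ℤ) : ℂ) * (ρ (-1) : ℂ) ↔
            (ρt ϖ' : ℂ) = ((sgn ϖ' : ℤ) : ℂ) * (ρ (-1) : ℂ)) := by
  open StronglyRamified in
  have hdim : FiniteDimensional E V := Module.finite_of_finrank_pos (by omega)
  have : FiniteDimensional F V := Module.Finite.trans E V
  obtain ⟨v₀, hg⟩ := s.isLatticeChain.exists_generator hV
  have : Nontrivial V := ⟨v₀, 0, hg.ne_zero⟩
  have hconj : ∀ x : E, ∃ y, IsConj h x y := by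
    have hγ := SkewStratum.isConj_γ (s := s) (Nat.zero_le _)
    rw [s.γ_zero] at hγ
    exact exists_isConj hγ s.adjoin_eq_top
  have hpF : ringChar 𝓀[F] ≠ 2 := (card_residueField F₀ F).2.2 ▸ hp
  have hpE : ringChar 𝓀[E] ≠ 2 := (card_residueField F E).2.2 ▸ hpF
  obtain ⟨π, hπ⟩ := exists_hasOrd (E := F) 1
  have hodd : Odd (ramificationIndex F E) :=
    odd_ramificationIndex hh hg s.isSelfDual hconj hE.2 hpE hπ
      (map_add_mem hquad hram hc hh.involutive hπ.mem
        ((map_mem_primePow_one_iff (E := E) hh hg s.isSelfDual).2 hπ.mem))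
  obtain ⟨sgn, hsgn, hmul⟩ := SkewStratum.exists_sign hg hh hV hconj hE.2 hpF hodd htame
  refine ⟨sgn, fun ϖ hϖ => hsgn ϖ (isUniformizer_iff.1 hϖ), fun ρt ρ htr hroots ϖ ϖ' hϖ hϖ' => ?_⟩
  rw [isUniformizer_iff] at hϖ hϖ'
  have hu : HasOrd ((ϖ⁻¹ * ϖ' : Eˣ) : E) 0 := by
    simpa using hϖ.inv.mul hϖ'
  have h1 := htr.apply_unit hroots hu
  have h2 := hmul _ _ hϖ hu
  have h3 : (ϖ : E) * ((ϖ⁻¹ * ϖ' : Eˣ) : E) = ϖ' := by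
    rw [← Units.val_mul, mul_inv_cancel_left]
  rw [h3] at h2
  have h4 : (ρt ϖ' : ℂ) = ρt ϖ * ρt (ϖ⁻¹ * ϖ') := by
    rw [← Units.val_mul, ← map_mul, mul_inv_cancel_left]
  have h5 : (ρt (ϖ⁻¹ * ϖ') : ℂ) ≠ 0 := Units.ne_zero _
  have h6 : ((sgn ϖ' : ℤ) : ℂ) = ((sgn ϖ : ℤ) : ℂ) * ρt (ϖ⁻¹ * ϖ') := by
    rw [h2, h1]
    push_cast
    rfl
  rw [h4, h6, mul_right_comm, mul_left_inj' h5]
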